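/- Let $n\ge 1$ be an integer and $1\le p,q\le\infty$ (with $1/\infty=0$). For $k,l=1,\dots,n$ let $u_k$ and $v_l$ be the unitaries on $\ell_2^n$ given by $u_k(e_j)=e^{2\pi i kj/n}e_j$ and $v_l(e_j)=e_{l+j}$ (indices modulo $n$), and put $T_{k,l}=v_l u_{-k}$. Operator spaces: $S_\infty^n=M_n$ and $\ell_\infty^m$ carry their usual structures as $C^*$-algebras, and $S_1^n=(S_\infty^n)^*$, $\ell_1^m=(\ell_\infty^m)^*$ for the pairings $\langle B,C\rangle=\mathrm{tr}(BC^{t})$ and $\langle b,c\rangle=\sum_i b_ic_i$, where $M_k[F^*]=CB(F,M_k)$. By complex interpolation ($M_k[(F_0,F_1)_\theta]=(M_k[F_0],M_k[F_1])_\theta$) one sets $S_p^n=(S_\infty^n,S_1^n)_{1/p}$ and $\ell_p^m=(\ell_\infty^m,\ell_1^m)_{1/p}$. For an operator space $E$ (a complex Banach space with matrix norms satisfying Ruan's axioms), $S_p^n[E]=(S_\infty^n\otimes_{\min}E,\;S_1^n\widehat\otimes E)_{1/p}$ and $\ell_p^m[E]=(\ell_\infty^m\otimes_{\min}E,\;\ell_1^m\widehat\otimes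 E)_{1/p}$, where $\widehat\otimes$ is the operator space projective tensor product. Write $S_q^n(F)=S_q^n[F]$. Let $$J=J_{p,q}:M_n\to \ell_\infty^{n^2}\otimes M_n,\qquad J(\rho)=n^{1-\frac1p-\frac1q}\,\frac1n\sum_{k,l=1}^n e_{k,l}\otimes T_{k,l}\,\rho\, T_{k,l}^*.$$ Then $J$ is completely positive, and there is a completely positive linear map $W:\ell_\infty^{n^2}\otimes M_n\to M_n$ with $W\circ J=\mathrm{id}$ such that the following hold. 1. $J:S_p^n\to S_q^n(\ell_p^{n^2})$ is a complete isometry, $W:S_q^n(\ell_p^{n^2})\to S_p^n$ is a complete contraction, and $P=J\circ W$ is a completely positive and completely contractive projection of $S_q^n(\ell_p^{n^2})$ onto the range of $J$. Thus $S_p^n$ is completely isometric to a completely complemented subspace of $S_q^n(\ell_p^{n^2})$. 2. For every operator space $E$, $J\otimes \mathrm{id}_E:S_p^n[E]\to S_q^n(\ell_p^{n^2}[E])$ is a complete isometry, $W\otimes\mathrm{id}_E:S_q^n(\ell_p^{n^2}[E])\to S_p^n[E]$ is a complete contraction with $(W\otimes\mathrm{id}_E)\circ(J\otimes\mathrm{id}_E)=\mathrm{id}$,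 and $(J\otimes\mathrm{id}_E)\circ(W\otimes\mathrm{id}_E)$ is a completely contractive projection onto the range of $J\otimes\mathrm{id}_E$. -/

import Mathlib

open scoped ENNReal

noncomputable section

namespace OpSp

open scoped Matrix.Norms.L2Operator in
/-- The operator norm of a (possibly rectangular) complex matrix, as an operator between the
Hilbert spaces `ℓ₂`. -/
def opNorm {m n : Type} [Fintype m] [Fintype n] [DecidableEq n] (A : Matrix m n ℂ) : ℝ :=
  ‖A‖

/-- A family of matrix norms on `V`: for each `k`, a real-valued function on `M_k[V]`. -/
abbrev MatNorms (V : Type*) := (k : ℕ) → Matrix (Fin k) (Fin k) V → ℝ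

/-- The product `α w β` of a matrix `w` over `V` with scalar matrices. -/
def sandwich {V : Type*} [AddCommMonoid V] [Module ℂ V] {k l : ℕ} (α : Matrix (Fin k) (Fin l) ℂ)
    (w : Matrix (Fin l) (Fin l) V) (β : Matrix (Fin l) (Fin k) ℂ) : Matrix (Fin k) (Fin k) V :=
  Matrix.of fun r s => ∑ i, ∑ j, (α r i * β j s) • w i j

/-- The block diagonal matrix `v ⊕ w`. -/
def directSum {V : Type*} [Zero V] {k l : ℕ} (v : Matrix (Fin k) (Fin k) V)
    (w : Matrix (Fin l) (Fin l) V) : Matrix (Fin (k + l)) (Fin (k + l)) V :=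
  Matrix.reindex finSumFinEquiv finSumFinEquiv (Matrix.fromBlocks v 0 0 w)

/-- `N` is an operator space structure on the complex normed space `E`: every `N k` is a norm on
`M_k[E]`, `N 1` is the given norm of `E`, and the two axioms of Ruan hold. (Completeness of `E` is
a separate hypothesis.) -/
structure IsOperatorSpace {E : Type*} [NormedAddCommGroup E] [NormedSpace ℂ E]
    (N : MatNorms E) : Prop where
  add_le : ∀ k (x y : Matrix (Fin k) (Fin k) E), N k (x + y) ≤ N k x + N k y
  smul_eq : ∀ k (c : ℂ) (x : Matrix (Fin k) (Fin k) E), N k (c • x) = ‖c‖ * N k x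
  eq_zero : ∀ k (x : Matrix (Fin k) (Fin k) E), N k x = 0 → x = 0
  one_eq : ∀ x : E, N 1 (Matrix.of fun _ _ => x) = ‖x‖
  directSum_eq : ∀ k l (v : Matrix (Fin k) (Fin k) E) (w : Matrix (Fin l) (Fin l) E),
    N (k + l) (directSum v w) = max (N k v) (N l w)
  sandwich_le : ∀ k l (α : Matrix (Fin k) (Fin l) ℂ) (w : Matrix (Fin l) (Fin l) E)
    (β : Matrix (Fin l) (Fin k) ℂ), N k (sandwich α w β) ≤ opNorm α * N l w * opNorm β

/-! ### Completely contractive and completely isometric maps -/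

section Maps

variable {V W : Type*} [AddCommGroup V] [Module ℂ V] [AddCommGroup W] [Module ℂ W]

/-- `id_{M_k} ⊗ T` is a contraction for every `k`. -/
def IsCompleteContraction (N : MatNorms V) (N' : MatNorms W) (T : V →ₗ[ℂ] W) : Prop :=
  ∀ k (x : Matrix (Fin k) (Fin k) V), N' k (x.map T) ≤ N k x

/-- `id_{M_k} ⊗ T` is an isometry for every `k`. -/
def IsCompleteIsometry (N : MatNorms V) (N' : MatNorms W) (T : V →ₗ[ℂ] W) : Prop :=
  ∀ k (x : Matrix (Fin k) (Fin k) V), N' k (x.map T) = N k x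

/-- The completely bounded norm of a completely bounded map `T`. -/
def cbNorm (N : MatNorms V) (N' : MatNorms W) (T : V →ₗ[ℂ] W) : ℝ :=
  sInf {C | 0 ≤ C ∧ ∀ k (x : Matrix (Fin k) (Fin k) V), N' k (x.map T) ≤ C * N k x}

end Maps

/-! ### Basic constructions of operator spaces -/

/-- The operator space `ℂ`. -/
def scalarNorms : MatNorms ℂ := fun _ A => opNorm A

/-- The operator space `S_∞^n[E] = M_n[E] = M_n ⊗_min E`, with `M_k[M_n[E]] = M_{kn}[E]`. -/
def sInfty (n : ℕ) {E : Type*} (N : MatNorms E) : MatNorms (Matrix (Fin n) (Fin n) E) :=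
  fun k x => N (k * n) (Matrix.reindex finProdFinEquiv finProdFinEquiv
    (Matrix.comp (Fin k) (Fin k) (Fin n) (Fin n) E x))

/-- The operator space `ℓ_∞^κ[E] = ℓ_∞^κ ⊗_min E`, with
`‖x‖_{M_k(ℓ_∞^κ[E])} = max_c ‖x_c‖_{M_k[E]}`. -/
def ellInfty (κ : Type) {E : Type*} (N : MatNorms E) : MatNorms (κ → E) :=
  fun k x => ⨆ c : κ, N k (x.map fun v => v c)

/-- For a matrix `x = (x_ij)` over `V` and a pairing `b` of `V` with `W`, the linear map
`W → M_k`, `w ↦ (b x_ij w)_ij`. -/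
def pairingMap {V W : Type*} [AddCommGroup V] [Module ℂ V] [AddCommGroup W] [Module ℂ W]
    (b : V →ₗ[ℂ] W →ₗ[ℂ] ℂ) {k : ℕ} (x : Matrix (Fin k) (Fin k) V) :
    W →ₗ[ℂ] Matrix (Fin k) (Fin k) ℂ where
  toFun w := Matrix.of fun i j => b (x i j) w
  map_add' w w' := by ext i j; simp
  map_smul' c w := by ext i j; simp

/-- The dual operator space structure on `V = W^*`, where `V` is identified with the dual of `W`
by the pairing `b`: `M_k[W^*] = CB(W, M_k)`. -/
def dualNorms {V W : Type*} [AddCommGroup V] [Module ℂ V] [AddCommGroup W] [Module ℂ W]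
    (b : V →ₗ[ℂ] W →ₗ[ℂ] ℂ) (N : MatNorms W) : MatNorms V :=
  fun k x => cbNorm N (sInfty k scalarNorms) (pairingMap b x)

/-- The projective operator space tensor norms on `U`, where `U` is identified with the algebraic
tensor product `V ⊗ W` by the bilinear map `b`. -/
def projNorms {V W U : Type*} [AddCommGroup V] [Module ℂ V] [AddCommGroup W] [Module ℂ W]
    [AddCommGroup U] [Module ℂ U] (b : V →ₗ[ℂ] W →ₗ[ℂ] U) (N : MatNorms V) (N' : MatNorms W) :
    MatNorms U :=
  fun k t => sInf {C | ∃ (l m : ℕ) (α : Matrix (Fin k) (Fin l × Fin m) ℂ)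
    (x : Matrix (Fin l) (Fin l) V) (y : Matrix (Fin m) (Fin m) W)
    (β : Matrix (Fin l × Fin m) (Fin k) ℂ),
    (∀ r s, t r s = ∑ a : Fin l × Fin m, ∑ c : Fin l × Fin m,
      (α r a * β c s) • b (x a.1 c.1) (y a.2 c.2)) ∧
    C = opNorm α * N l x * N' m y * opNorm β}

/-- Complex interpolation (Calderón's method) of two families of matrix norms on one space `V`,
with `M_k[V_θ] = (M_k[V_0], M_k[V_1])_θ`. It is used only for couples of norms on `M_k[V]` that
both induce the topology which the norm of `V` induces entrywise; that norm serves only to say which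
functions on the strip are analytic, continuous and bounded. -/
def interp {V : Type*} [NormedAddCommGroup V] [NormedSpace ℂ V] (N₀ N₁ : MatNorms V) (θ : ℝ) :
    MatNorms V :=
  fun k x => sInf {C | 0 ≤ C ∧ ∃ f : ℂ → Matrix (Fin k) (Fin k) V,
    (∀ i j, DiffContOnCl ℂ (fun z => f z i j) (Complex.HadamardThreeLines.verticalStrip 0 1)) ∧
    (∃ B : ℝ, ∀ z ∈ Complex.HadamardThreeLines.verticalClosedStrip 0 1, ∀ i j, ‖f z i j‖ ≤ B) ∧
    f (θ : ℂ) = x ∧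
    (∀ t : ℝ, N₀ k (f (t * Complex.I)) ≤ C) ∧
    (∀ t : ℝ, N₁ k (f (1 + t * Complex.I)) ≤ C)}

/-! ### The spaces `S_p^n`, `S_p^n[E]`, `ℓ_p^κ` and `ℓ_p^κ[E]` -/

/-- The pairing `⟨B, C⟩ = tr (B Cᵀ)` on `n × n` matrices. -/
def tracePairing (n : ℕ) :
    Matrix (Fin n) (Fin n) ℂ →ₗ[ℂ] Matrix (Fin n) (Fin n) ℂ →ₗ[ℂ] ℂ :=
  LinearMap.mk₂ ℂ (fun B C => (B * C.transpose).trace)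
    (by intros; simp [add_mul]) (by intros; simp)
    (by intros; simp [mul_add]) (by intros; simp)

/-- The pairing `⟨b, c⟩ = ∑ b_i c_i`. -/
def sumPairing (κ : Type) [Fintype κ] : (κ → ℂ) →ₗ[ℂ] (κ → ℂ) →ₗ[ℂ] ℂ :=
  LinearMap.mk₂ ℂ (fun b c => ∑ i, b i * c i)
    (by intros; simp [add_mul, Finset.sum_add_distrib])
    (by intros; simp [mul_assoc, Finset.mul_sum])
    (by intros; simp [mul_add, Finset.sum_add_distrib])
    (by intros; simp [mul_left_comm, Finset.mul_sum])

/-- The identification of `M_n ⊗ E` with the `n × n` matrices over `E`. -/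
def matTensor (n : ℕ) (E : Type*) [AddCommGroup E] [Module ℂ E] :
    Matrix (Fin n) (Fin n) ℂ →ₗ[ℂ] E →ₗ[ℂ] Matrix (Fin n) (Fin n) E :=
  LinearMap.mk₂ ℂ (fun A e => Matrix.of fun i j => A i j • e)
    (by intros; ext; simp [add_smul]) (by intros; ext; simp [mul_smul])
    (by intros; ext; simp) (by intros; ext; simp only [Matrix.smul_apply, Matrix.of_apply]; exact smul_comm _ _ _)

/-- The identification of `ℂ^κ ⊗ E` with `κ → E`. -/
def piTensor (κ : Type) (E : Type*) [AddCommGroup E] [Module ℂ E] :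
    (κ → ℂ) →ₗ[ℂ] E →ₗ[ℂ] (κ → E) :=
  LinearMap.mk₂ ℂ (fun a e => fun i => a i • e)
    (by intros; ext; simp [add_smul]) (by intros; ext; simp [mul_smul])
    (by intros; ext; simp) (by intros; ext; simp only [Pi.smul_apply]; exact smul_comm _ _ _)

/-- The operator space `S_1^n = M_n^*`. -/
def sOne (n : ℕ) : MatNorms (Matrix (Fin n) (Fin n) ℂ) :=
  dualNorms (tracePairing n) (sInfty n scalarNorms)

/-- The operator space `ℓ_1^κ = (ℓ_∞^κ)^*`. -/
def ellOne (κ : Type) [Fintype κ] : MatNorms (κ → ℂ) :=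
  dualNorms (sumPairing κ) (ellInfty κ scalarNorms)

section Lp

/- The entrywise supremum norm on matrices; it only enters through its topology, see `interp`. -/
attribute [local instance] Matrix.normedAddCommGroup Matrix.normedSpace

/-- The operator space `S_p^n = (M_n, S_1^n)_{1/p}`. -/
def schatten (p : ℝ≥0∞) (n : ℕ) : MatNorms (Matrix (Fin n) (Fin n) ℂ) :=
  interp (sInfty n scalarNorms) (sOne n) (p⁻¹).toReal

/-- The operator space `ℓ_p^κ = (ℓ_∞^κ, ℓ_1^κ)_{1/p}`. -/
def ell (p : ℝ≥0∞) (κ : Type) [Fintype κ] : MatNorms (κ → ℂ) :=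
  interp (ellInfty κ scalarNorms) (ellOne κ) (p⁻¹).toReal

variable {E : Type*} [NormedAddCommGroup E] [NormedSpace ℂ E]

/-- The operator space `S_p^n[E] = (M_n[E], S_1^n ⊗^ E)_{1/p}`. -/
def schattenV (p : ℝ≥0∞) (n : ℕ) (N : MatNorms E) : MatNorms (Matrix (Fin n) (Fin n) E) :=
  interp (sInfty n N) (projNorms (matTensor n E) (sOne n) N) (p⁻¹).toReal

/-- The operator space `ℓ_p^κ[E] = (ℓ_∞^κ[E], ℓ_1^κ ⊗^ E)_{1/p}`. -/
def ellV (p : ℝ≥0∞) (κ : Type) [Fintype κ] (N : MatNorms E) : MatNorms (κ → E) :=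
  interp (ellInfty κ N) (projNorms (piTensor κ E) (ellOne κ) N) (p⁻¹).toReal

end Lp

/-! ### Complete positivity -/

/-- `T` is completely positive with respect to the cones `C k` and `D k` of positive elements of
`M_k[V]` and `M_k[W]`. -/
def IsCompletelyPositive {V W : Type*} [AddCommGroup V] [Module ℂ V] [AddCommGroup W] [Module ℂ W]
    (C : (k : ℕ) → Set (Matrix (Fin k) (Fin k) V)) (D : (k : ℕ) → Set (Matrix (Fin k) (Fin k) W))
    (T : V →ₗ[ℂ] W) : Prop :=
  ∀ k, ∀ x ∈ C k, x.map T ∈ D k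

open scoped ComplexOrder in
/-- The positive elements of `M_k[M_n] = M_{kn}`. -/
def matCone (n k : ℕ) : Set (Matrix (Fin k) (Fin k) (Matrix (Fin n) (Fin n) ℂ)) :=
  {x | (Matrix.comp (Fin k) (Fin k) (Fin n) (Fin n) ℂ x).PosSemidef}

open scoped ComplexOrder in
/-- The positive elements of `M_k[M_n(ℓ_∞^κ)] = ℓ_∞^κ(M_{kn})`. -/
def matEllCone (n : ℕ) (κ : Type) (k : ℕ) :
    Set (Matrix (Fin k) (Fin k) (Matrix (Fin n) (Fin n) (κ → ℂ))) :=
  {x | ∀ c : κ, ((Matrix.comp (Fin k) (Fin k) (Fin n) (Fin n) (κ → ℂ) x).map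
    fun v => v c).PosSemidef}

/-! ### Tensoring maps with the identity of `E` -/

/-- `T ⊗ id_E` for a linear map `T : M_n → M_n(ℂ^κ)`. -/
def tensorIdOut {n : ℕ} {κ : Type}
    (T : Matrix (Fin n) (Fin n) ℂ →ₗ[ℂ] Matrix (Fin n) (Fin n) (κ → ℂ))
    (E : Type*) [AddCommGroup E] [Module ℂ E] :
    Matrix (Fin n) (Fin n) E →ₗ[ℂ] Matrix (Fin n) (Fin n) (κ → E) where
  toFun x := Matrix.of fun i j c => ∑ a, ∑ b, T (Matrix.single a b 1) i j c • x a b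
  map_add' x y := by ext i j c; simp [Finset.sum_add_distrib]
  map_smul' r x := by ext i j c; simp only [Matrix.smul_apply, Pi.smul_apply, Matrix.of_apply, RingHom.id_apply, Finset.smul_sum, smul_comm r]

/-- `T ⊗ id_E` for a linear map `T : M_n(ℂ^κ) → M_n`. -/
def tensorIdIn {n : ℕ} {κ : Type} [Fintype κ] [DecidableEq κ]
    (T : Matrix (Fin n) (Fin n) (κ → ℂ) →ₗ[ℂ] Matrix (Fin n) (Fin n) ℂ)
    (E : Type*) [AddCommGroup E] [Module ℂ E] :
    Matrix (Fin n) (Fin n) (κ → E) →ₗ[ℂ] Matrix (Fin n) (Fin n) E where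
  toFun x := Matrix.of fun i j =>
    ∑ a, ∑ b, ∑ c, T (Matrix.single a b (Pi.single c 1)) i j • x a b c
  map_add' x y := by ext i j; simp [Finset.sum_add_distrib]
  map_smul' r x := by ext i j; simp only [Matrix.smul_apply, Pi.smul_apply, Matrix.of_apply, RingHom.id_apply, Finset.smul_sum, smul_comm r]

/-! ### The embedding -/

/-- The unitary `u_k`: `e_j ↦ exp (2 π i k j / n) e_j`. -/
def clock (n : ℕ) (k : ℤ) : Matrix (Fin n) (Fin n) ℂ :=
  Matrix.diagonal fun j => Complex.exp (2 * Real.pi * Complex.I * k * (j : ℕ) / n)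

/-- The unitary `v_l`: `e_j ↦ e_{l + j}`, with `l + j` modulo `n`. -/
def shift (n : ℕ) (l : Fin n) : Matrix (Fin n) (Fin n) ℂ :=
  Matrix.of fun i j => if i = l + j then 1 else 0

/-- `T_{k,l} = v_l u_{-k}`. -/
def weyl (n : ℕ) (k l : Fin n) : Matrix (Fin n) (Fin n) ℂ :=
  shift n l * clock n (-((k : ℕ) : ℤ))

/-- The map `ρ ↦ n^{1 - 1/p - 1/q} (1/n) ∑_{k,l} e_{k,l} ⊗ T_{k,l} ρ T_{k,l}^*`. -/
def teleport (n : ℕ) (p q : ℝ≥0∞) :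
    Matrix (Fin n) (Fin n) ℂ →ₗ[ℂ] Matrix (Fin n) (Fin n) (Fin n × Fin n → ℂ) where
  toFun ρ := Matrix.of fun i j c =>
    (((n : ℝ) ^ (1 - (p⁻¹).toReal - (q⁻¹).toReal) * (1 / (n : ℝ)) : ℝ) : ℂ) *
      (weyl n c.1 c.2 * ρ * (weyl n c.1 c.2).conjTranspose) i j
  map_add' x y := by ext i j c; simp [mul_add, add_mul]
  map_smul' r x := by ext i j c; simp [mul_left_comm]

end OpSp

end

/-
The Weyl matrices `T_c`, `c = (k, l)`, are `n²` unitaries which are orthogonal for the trace, and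
`J` and `W` are multiples of the twirl `ρ ↦ (T_c ρ T_c^*)_c` and of its adjoint
`y ↦ ∑_c T_c^* y_c T_c`; the adjoint after the twirl is `n²` times the identity.

The twirl `S_∞[E] → S_∞(ℓ_∞[E])` is contractive because each `T_c` is unitary, and
`S_1[E] → S_∞(ℓ_1[E])` has norm at most `n` because of orthogonality, so by interpolation
`S_p[E] → S_∞(ℓ_p[E])` has norm at most `n^{1/p}`; interpolating with `S_1[F]`, whose norm is at
most `n` times that of `S_∞[F]`, gives `n^{1/p + 1/q}` for `S_p[E] → S_q(ℓ_p[E])`. In the same way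
the adjoint has norm at most `n^{2 - 1/p - 1/q}`. As the product of these two bounds is exactly
`n²`, after normalisation both maps are complete contractions, and the first, having a completely
contractive left inverse, is a complete isometry.
-/

noncomputable section

namespace OpSp

open Matrix

section OpNorm

open scoped Matrix.Norms.L2Operator Kronecker

variable {ι κ l m n o : Type} [Fintype ι] [Fintype κ] [Fintype l] [Fintype m] [Fintype n]
  [Fintype o]

theorem opNorm_nonneg [DecidableEq n] (A : Matrix m n ℂ) : 0 ≤ opNorm A := norm_nonneg A

theorem opNorm_add_le [DecidableEq n] (A B : Matrix m n ℂ) :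
    opNorm (A + B) ≤ opNorm A + opNorm B :=
  norm_add_le A B

theorem opNorm_sum_le [DecidableEq n] (A : ι → Matrix m n ℂ) :
    opNorm (∑ i, A i) ≤ ∑ i, opNorm (A i) :=
  norm_sum_le (E := Matrix m n ℂ) Finset.univ A

theorem opNorm_smul [DecidableEq n] (c : ℂ) (A : Matrix m n ℂ) :
    opNorm (c • A) = ‖c‖ * opNorm A :=
  norm_smul c A

theorem opNorm_neg [DecidableEq n] (A : Matrix m n ℂ) : opNorm (-A) = opNorm A :=
  norm_neg A

theorem opNorm_eq_zero [DecidableEq n] {A : Matrix m n ℂ} : opNorm A = 0 ↔ A = 0 :=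
  norm_eq_zero (a := A)

@[simp] theorem opNorm_zero [DecidableEq n] : opNorm (0 : Matrix m n ℂ) = 0 :=
  opNorm_eq_zero.2 rfl

theorem opNorm_mul_le [DecidableEq m] [DecidableEq n] (A : Matrix l m ℂ) (B : Matrix m n ℂ) :
    opNorm (A * B) ≤ opNorm A * opNorm B :=
  l2_opNorm_mul A B

theorem opNorm_conjTranspose [DecidableEq m] [DecidableEq n] (A : Matrix m n ℂ) :
    opNorm Aᴴ = opNorm A :=
  l2_opNorm_conjTranspose A

theorem opNorm_conjTranspose_mul_self [DecidableEq n] (A : Matrix m n ℂ) :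
    opNorm (Aᴴ * A) = opNorm A ^ 2 :=
  (l2_opNorm_conjTranspose_mul_self A).trans (sq _).symm

theorem opNorm_mul_conjTranspose_self [DecidableEq m] [DecidableEq n] (A : Matrix m n ℂ) :
    opNorm (A * Aᴴ) = opNorm A ^ 2 := by
  simpa only [conjTranspose_conjTranspose, opNorm_conjTranspose] using
    opNorm_conjTranspose_mul_self Aᴴ

theorem sum_sq_mulVec_le [DecidableEq n] (A : Matrix m n ℂ) (x : n → ℂ) :
    ∑ i, ‖(A *ᵥ x) i‖ ^ 2 ≤ opNorm A ^ 2 * ∑ j, ‖x j‖ ^ 2 := by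
  have h := pow_le_pow_left₀ (norm_nonneg _) (l2_opNorm_mulVec A (WithLp.toLp 2 x)) 2
  rwa [mul_pow, EuclideanSpace.norm_sq_eq, EuclideanSpace.norm_sq_eq] at h

theorem opNorm_le_of_sum_sq [DecidableEq n] {A : Matrix m n ℂ} {C : ℝ} (hC : 0 ≤ C)
    (h : ∀ x : n → ℂ, ∑ i, ‖(A *ᵥ x) i‖ ^ 2 ≤ C ^ 2 * ∑ j, ‖x j‖ ^ 2) : opNorm A ≤ C := by
  unfold opNorm
  rw [l2_opNorm_def]
  refine ContinuousLinearMap.opNorm_le_bound _ hC fun x => ?_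
  refine (sq_le_sq₀ (norm_nonneg _) (by positivity)).mp ?_
  rw [mul_pow, EuclideanSpace.norm_sq_eq, EuclideanSpace.norm_sq_eq]
  exact h x.ofLp

theorem opNorm_one_le [DecidableEq m] : opNorm (1 : Matrix m m ℂ) ≤ 1 :=
  opNorm_le_of_sum_sq zero_le_one fun x => by simp

theorem opNorm_le_one_of_conjTranspose_mul_self [DecidableEq n] {V : Matrix m n ℂ}
    (h : Vᴴ * V = 1) : opNorm V ≤ 1 := by
  rw [← sq_le_one_iff₀ (opNorm_nonneg V), ← opNorm_conjTranspose_mul_self, h]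
  exact opNorm_one_le

theorem opNorm_mul_mul_le [DecidableEq m] [DecidableEq n] [DecidableEq o] {A : Matrix l m ℂ}
    {B : Matrix m n ℂ} {C : Matrix n o ℂ} {a b c : ℝ} (ha : opNorm A ≤ a) (hb : opNorm B ≤ b)
    (hc : opNorm C ≤ c) : opNorm (A * B * C) ≤ a * b * c := by
  have ha₀ := (opNorm_nonneg A).trans ha
  have hb₀ := (opNorm_nonneg B).trans hb
  calc opNorm (A * B * C) ≤ opNorm (A * B) * opNorm C := opNorm_mul_le _ _
    _ ≤ (opNorm A * opNorm B) * opNorm C :=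
      mul_le_mul_of_nonneg_right (opNorm_mul_le _ _) (opNorm_nonneg _)
    _ ≤ a * b * c := mul_le_mul (mul_le_mul ha hb (opNorm_nonneg _) ha₀) hc (opNorm_nonneg _)
        (mul_nonneg ha₀ hb₀)

theorem opNorm_one_submatrix_le [DecidableEq ι] [DecidableEq m] {e : ι → m}
    (he : Function.Injective e) : opNorm ((1 : Matrix m m ℂ).submatrix id e) ≤ 1 := by
  apply opNorm_le_one_of_conjTranspose_mul_self
  ext i j
  simp [mul_apply, one_apply, he.eq_iff]

theorem opNorm_submatrix_le [DecidableEq n] [DecidableEq κ] (A : Matrix m n ℂ) {e : ι → m}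
    {f : κ → n} (he : Function.Injective e) (hf : Function.Injective f) :
    opNorm (A.submatrix e f) ≤ opNorm A := by
  classical
  have hA : A.submatrix e f = ((1 : Matrix m m ℂ).submatrix id e)ᴴ * A *
      (1 : Matrix n n ℂ).submatrix id f := by
    ext i j
    simp [mul_apply, one_apply]
  rw [hA]
  simpa only [one_mul, mul_one] using opNorm_mul_mul_le
    ((opNorm_conjTranspose _).trans_le (opNorm_one_submatrix_le he)) (le_refl (opNorm A))
    (opNorm_one_submatrix_le hf)

theorem opNorm_submatrix_equiv [DecidableEq n] [DecidableEq κ] (A : Matrix m n ℂ) (e : ι ≃ m)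
    (f : κ ≃ n) : opNorm (A.submatrix e f) = opNorm A := by
  refine le_antisymm (opNorm_submatrix_le A e.injective f.injective) ?_
  simpa using opNorm_submatrix_le (A.submatrix e f) e.symm.injective f.symm.injective

theorem opNorm_reindex [DecidableEq n] [DecidableEq κ] (A : Matrix m n ℂ) (e : m ≃ ι)
    (f : n ≃ κ) : opNorm (reindex e f A) = opNorm A :=
  opNorm_submatrix_equiv A e.symm f.symm

theorem norm_entry_le_opNorm [DecidableEq n] (A : Matrix m n ℂ) (i : m) (j : n) :
    ‖A i j‖ ≤ opNorm A := by
  have hcol := sum_sq_mulVec_le A (Pi.single j 1)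
  have hunit : ∑ k, ‖(Pi.single j 1 : n → ℂ) k‖ ^ 2 = 1 := by
    rw [Finset.sum_eq_single j] <;> simp +contextual
  rw [hunit, mul_one, mulVec_single_one] at hcol
  have hentry : ‖A i j‖ ^ 2 ≤ ∑ i, ‖A.col j i‖ ^ 2 :=
    Finset.single_le_sum (f := fun i => ‖A i j‖ ^ 2) (fun _ _ => sq_nonneg _) (Finset.mem_univ i)
  exact (sq_le_sq₀ (norm_nonneg _) (opNorm_nonneg _)).mp (hentry.trans hcol)

theorem opNorm_blockDiagonal_le [DecidableEq κ] [DecidableEq n] {Y : κ → Matrix m n ℂ} {C : ℝ}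
    (hC : 0 ≤ C) (h : ∀ c, opNorm (Y c) ≤ C) : opNorm (blockDiagonal Y) ≤ C := by
  refine opNorm_le_of_sum_sq hC fun x => ?_
  have hx : ∀ i c, (blockDiagonal Y *ᵥ x) (i, c) = (Y c *ᵥ fun j => x (j, c)) i := by
    intro i c
    simp [mulVec, dotProduct, Fintype.sum_prod_type, blockDiagonal_apply]
  simp only [Fintype.sum_prod_type_right, Finset.mul_sum, hx]
  refine Finset.sum_le_sum fun c _ => ?_
  rw [← Finset.mul_sum]
  refine (sum_sq_mulVec_le (Y c) _).trans ?_
  gcongr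
  exacts [opNorm_nonneg _, h c]

theorem opNorm_kronecker_one_le [DecidableEq n] [DecidableEq ι] (A : Matrix m n ℂ) :
    opNorm (A ⊗ₖ (1 : Matrix ι ι ℂ)) ≤ opNorm A := by
  rw [kronecker_one]
  exact opNorm_blockDiagonal_le (opNorm_nonneg A) fun _ => le_rfl

theorem opNorm_one_kronecker_le [DecidableEq n] [DecidableEq ι] (A : Matrix m n ℂ) :
    opNorm ((1 : Matrix ι ι ℂ) ⊗ₖ A) ≤ opNorm A := by
  rw [one_kronecker, opNorm_reindex]
  exact opNorm_blockDiagonal_le (opNorm_nonneg A) fun _ => le_rfl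

theorem opNorm_kronecker_le [DecidableEq n] [DecidableEq κ] (A : Matrix m n ℂ)
    (B : Matrix ι κ ℂ) : opNorm (A ⊗ₖ B) ≤ opNorm A * opNorm B := by
  classical
  have h : A ⊗ₖ B = (A ⊗ₖ (1 : Matrix ι ι ℂ)) * ((1 : Matrix n n ℂ) ⊗ₖ B) := by
    rw [← mul_kronecker_mul, Matrix.mul_one, Matrix.one_mul]
  rw [h]
  exact (opNorm_mul_le _ _).trans (mul_le_mul (opNorm_kronecker_one_le A)
    (opNorm_one_kronecker_le B) (opNorm_nonneg _) (opNorm_nonneg _))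

theorem opNorm_fromBlocks [DecidableEq n] [DecidableEq κ] (A : Matrix m n ℂ)
    (B : Matrix ι κ ℂ) :
    opNorm (fromBlocks A 0 0 B) = max (opNorm A) (opNorm B) := by
  have hA : opNorm ((fromBlocks A 0 0 B).submatrix Sum.inl Sum.inl) ≤
      opNorm (fromBlocks A 0 0 B) := opNorm_submatrix_le _ Sum.inl_injective Sum.inl_injective
  have hB : opNorm ((fromBlocks A 0 0 B).submatrix Sum.inr Sum.inr) ≤
      opNorm (fromBlocks A 0 0 B) := opNorm_submatrix_le _ Sum.inr_injective Sum.inr_injective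
  refine le_antisymm ?_ (max_le hA hB)
  have hmono : ∀ {a b s : ℝ}, 0 ≤ a → a ≤ b → 0 ≤ s → a ^ 2 * s ≤ b ^ 2 * s := fun ha hab hs =>
    mul_le_mul_of_nonneg_right (pow_le_pow_left₀ ha hab 2) hs
  refine opNorm_le_of_sum_sq (le_max_of_le_left (opNorm_nonneg A)) fun x => ?_
  rw [Fintype.sum_sum_type, Fintype.sum_sum_type, mul_add, fromBlocks_mulVec]
  simp only [zero_mulVec, add_zero, zero_add, Sum.elim_inl, Sum.elim_inr]
  exact add_le_add
    ((sum_sq_mulVec_le A _).trans (hmono (opNorm_nonneg A) (le_max_left _ _) (by positivity)))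
    ((sum_sq_mulVec_le B _).trans (hmono (opNorm_nonneg B) (le_max_right _ _) (by positivity)))

theorem norm_bilinear_le [DecidableEq n] (A : Matrix m n ℂ) (ξ : m → ℂ) (η : n → ℂ) :
    ‖∑ i, ∑ j, ξ i * A i j * η j‖ ≤ opNorm A * √(∑ i, ‖ξ i‖ ^ 2) * √(∑ j, ‖η j‖ ^ 2) := by
  let u : EuclideanSpace ℂ m := WithLp.toLp 2 fun i => star (ξ i)
  let v : EuclideanSpace ℂ n := WithLp.toLp 2 η
  have hinner : ∑ i, ∑ j, ξ i * A i j * η j = inner ℂ u (WithLp.toLp 2 (A *ᵥ η)) := by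
    simp [u, PiLp.inner_apply, mulVec, dotProduct, Finset.mul_sum, mul_comm, mul_left_comm]
  have hu : ‖u‖ = √(∑ i, ‖ξ i‖ ^ 2) := by simp [u, EuclideanSpace.norm_eq]
  have hv : ‖v‖ = √(∑ j, ‖η j‖ ^ 2) := by simp [v, EuclideanSpace.norm_eq]
  calc ‖∑ i, ∑ j, ξ i * A i j * η j‖ ≤ ‖u‖ * (opNorm A * ‖v‖) := by
        rw [hinner]
        exact (norm_inner_le_norm _ _).trans
          (mul_le_mul_of_nonneg_left (l2_opNorm_mulVec A v) (norm_nonneg u))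
    _ = _ := by rw [hu, hv]; ring

theorem opNorm_le_one_of_bilinear [DecidableEq n] {A : Matrix m n ℂ}
    (h : ∀ (ξ : m → ℂ) (η : n → ℂ),
      2 * (∑ i, ∑ j, ξ i * A i j * η j).re ≤ ∑ i, ‖ξ i‖ ^ 2 + ∑ j, ‖η j‖ ^ 2) :
    opNorm A ≤ 1 := by
  refine opNorm_le_of_sum_sq zero_le_one fun η => ?_
  have hre : (∑ i, ∑ j, star ((A *ᵥ η) i) * A i j * η j).re = ∑ i, ‖(A *ᵥ η) i‖ ^ 2 := by
    simp only [mul_assoc, ← Finset.mul_sum, Complex.re_sum]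
    refine Finset.sum_congr rfl fun i _ => ?_
    change (star ((A *ᵥ η) i) * (A *ᵥ η) i).re = _
    rw [← starRingEnd_apply, Complex.conj_mul']
    norm_cast
  have hη := h (fun i => star ((A *ᵥ η) i)) η
  rw [hre] at hη
  simp only [norm_star] at hη
  linarith

end OpNorm

section Seminorm

theorem exists_linearMap_eq_seminorm {V : Type*} [AddCommGroup V] [Module ℂ V]
    (p : Seminorm ℂ V) (z : V) : ∃ F : V →ₗ[ℂ] ℂ, F z = p z ∧ ∀ x, ‖F x‖ ≤ p x := by
  obtain rfl | hz := eq_or_ne z 0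
  · exact ⟨0, by simp, by simp⟩
  let f : V →ₗ.[ℂ] ℂ := LinearPMap.mkSpanSingleton z (p z : ℂ) hz
  obtain ⟨F, hFf, hFp⟩ := Module.Dual.exists_extension_of_le_seminorm f.domain f.toFun (p := p) (by
    rintro ⟨x, hx⟩
    obtain ⟨c, rfl⟩ := Submodule.mem_span_singleton.1 hx
    refine le_of_eq ?_
    change ‖f ⟨c • z, hx⟩‖ = _
    rw [LinearPMap.mkSpanSingleton'_apply, map_smul_eq_mul]
    simp [abs_of_nonneg (apply_nonneg p z)])
  exact ⟨F, (hFf ⟨z, Submodule.mem_span_singleton_self z⟩).trans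
    (LinearPMap.mkSpanSingleton_apply ℂ ℂ hz _), hFp⟩

variable {E : Type*} [NormedAddCommGroup E] [NormedSpace ℂ E] {N : MatNorms E}

namespace IsOperatorSpace

/-- The matrix norm of an operator space on `M_k[E]`, as a seminorm. -/
def seminorm (hN : IsOperatorSpace N) (k : ℕ) : Seminorm ℂ (Matrix (Fin k) (Fin k) E) :=
  Seminorm.of (N k) (hN.add_le k) (hN.smul_eq k)

theorem nonneg (hN : IsOperatorSpace N) (k : ℕ) (x : Matrix (Fin k) (Fin k) E) : 0 ≤ N k x :=
  apply_nonneg (hN.seminorm k) x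

theorem map_zero (hN : IsOperatorSpace N) (k : ℕ) : N k 0 = 0 :=
  _root_.map_zero (hN.seminorm k)

end IsOperatorSpace

end Seminorm

section Sandwich

variable {V : Type*} [AddCommGroup V] [Module ℂ V] {k l r s : ℕ}

/-- The linear map `w ↦ α w β`. -/
def sandwichₗ (α : Matrix (Fin k) (Fin l) ℂ) (β : Matrix (Fin l) (Fin k) ℂ) :
    Matrix (Fin l) (Fin l) V →ₗ[ℂ] Matrix (Fin k) (Fin k) V where
  toFun w := sandwich α w β
  map_add' v w := by ext; simp [sandwich, Finset.sum_add_distrib]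
  map_smul' c w := by ext; simp [sandwich, Finset.smul_sum, smul_comm c]

@[simp] theorem sandwichₗ_apply (α : Matrix (Fin k) (Fin l) ℂ) (β : Matrix (Fin l) (Fin k) ℂ)
    (w : Matrix (Fin l) (Fin l) V) : sandwichₗ α β w = sandwich α w β := rfl

@[simp] theorem sandwich_zero (α : Matrix (Fin k) (Fin l) ℂ) (β : Matrix (Fin l) (Fin k) ℂ) :
    sandwich α (0 : Matrix (Fin l) (Fin l) V) β = 0 :=
  map_zero (sandwichₗ α β)

theorem sandwich_one (z : Matrix (Fin k) (Fin k) V) : sandwich 1 z 1 = z := by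
  ext i j
  simp [sandwich, one_apply, ite_smul]

theorem sandwich_smul_smul (c d : ℂ) (α : Matrix (Fin k) (Fin l) ℂ)
    (w : Matrix (Fin l) (Fin l) V) (β : Matrix (Fin l) (Fin k) ℂ) :
    sandwich (c • α) w (d • β) = (c * d) • sandwich α w β := by
  ext i j
  simp only [sandwich, of_apply, Matrix.smul_apply, Finset.smul_sum, smul_smul, smul_eq_mul,
    mul_mul_mul_comm]

theorem sandwich_sandwich (α : Matrix (Fin k) (Fin l) ℂ) (γ : Matrix (Fin l) (Fin r) ℂ)
    (w : Matrix (Fin r) (Fin r) V) (δ : Matrix (Fin r) (Fin l) ℂ)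
    (β : Matrix (Fin l) (Fin k) ℂ) :
    sandwich α (sandwich γ w δ) β = sandwich (α * γ) w (δ * β) := by
  ext i j
  simp only [sandwich, of_apply, mul_apply, Finset.smul_sum, Finset.sum_smul, Finset.sum_mul_sum,
    smul_smul, mul_mul_mul_comm, mul_comm (β _ j)]
  calc _ = ∑ a, ∑ c, ∑ d, ∑ b, (α i a * γ a c * (δ d b * β b j)) • w c d :=
        Finset.sum_congr rfl fun a _ => Finset.sum_comm_cycle.symm
    _ = _ := Finset.sum_comm_cycle.symm

/-- The row matrix `[α, γ]`. -/
def hcat (α : Matrix (Fin k) (Fin r) ℂ) (γ : Matrix (Fin k) (Fin s) ℂ) :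
    Matrix (Fin k) (Fin (r + s)) ℂ :=
  (fromCols α γ).submatrix id finSumFinEquiv.symm

/-- The column matrix with blocks `β` and `δ`. -/
def vcat (β : Matrix (Fin r) (Fin k) ℂ) (δ : Matrix (Fin s) (Fin k) ℂ) :
    Matrix (Fin (r + s)) (Fin k) ℂ :=
  (fromRows β δ).submatrix finSumFinEquiv.symm id

theorem sandwich_directSum (α : Matrix (Fin k) (Fin r) ℂ) (γ : Matrix (Fin k) (Fin s) ℂ)
    (v : Matrix (Fin r) (Fin r) V) (w : Matrix (Fin s) (Fin s) V)
    (β : Matrix (Fin r) (Fin k) ℂ) (δ : Matrix (Fin s) (Fin k) ℂ) :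
    sandwich (hcat α γ) (directSum v w) (vcat β δ) = sandwich α v β + sandwich γ w δ := by
  ext i j
  simp only [sandwich, of_apply, Matrix.add_apply, ← finSumFinEquiv.sum_comp, Fintype.sum_sum_type]
  simp [hcat, vcat, directSum, -finSumFinEquiv_apply_left, -finSumFinEquiv_apply_right]

theorem hcat_mul_conjTranspose (α : Matrix (Fin k) (Fin r) ℂ) (γ : Matrix (Fin k) (Fin s) ℂ) :
    hcat α γ * (hcat α γ)ᴴ = α * αᴴ + γ * γᴴ := by
  simp only [hcat, conjTranspose_submatrix, submatrix_mul_equiv,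
    conjTranspose_fromCols_eq_fromRows_conjTranspose, fromCols_mul_fromRows, submatrix_id_id]

theorem conjTranspose_mul_vcat (β : Matrix (Fin r) (Fin k) ℂ) (δ : Matrix (Fin s) (Fin k) ℂ) :
    (vcat β δ)ᴴ * vcat β δ = βᴴ * β + δᴴ * δ := by
  simp only [vcat, conjTranspose_submatrix, submatrix_mul_equiv,
    conjTranspose_fromRows_eq_fromCols_conjTranspose, fromCols_mul_fromRows, submatrix_id_id]

end Sandwich

section Amplify

variable {V : Type*} [AddCommGroup V] [Module ℂ V]

/-- The amplification of `φ : V → M_κ` applied to a matrix over `V`, as a scalar matrix. -/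
def amplify {ι κ : Type} (φ : V →ₗ[ℂ] Matrix κ κ ℂ) (v : Matrix ι ι V) :
    Matrix (ι × κ) (ι × κ) ℂ :=
  of fun x y => φ (v x.1 y.1) x.2 y.2

theorem amplify_smul {ι κ : Type} (φ : V →ₗ[ℂ] Matrix κ κ ℂ) (c : ℂ) (v : Matrix ι ι V) :
    amplify φ (c • v) = c • amplify φ v := by
  ext; simp [amplify]

/-- The map `V → M_k` with entries `e ↦ F (e_ij ⊗ e)` associated to a functional `F` on
`M_k[V]`. -/
def coeffMap {k : ℕ} (F : Matrix (Fin k) (Fin k) V →ₗ[ℂ] ℂ) :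
    V →ₗ[ℂ] Matrix (Fin k) (Fin k) ℂ where
  toFun e := of fun i j => F (single i j e)
  map_add' a b := by ext; simp [single_add]
  map_smul' c a := by ext; simp [← smul_single]

theorem apply_sandwich {k r : ℕ} (F : Matrix (Fin k) (Fin k) V →ₗ[ℂ] ℂ)
    (α : Matrix (Fin k) (Fin r) ℂ) (v : Matrix (Fin r) (Fin r) V)
    (β : Matrix (Fin r) (Fin k) ℂ) :
    F (sandwich α v β) = ∑ x : Fin r × Fin k, ∑ y : Fin r × Fin k,
      α x.2 x.1 * amplify (coeffMap F) v x y * β y.1 y.2 := by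
  have hexpand : sandwich α v β = ∑ x : Fin r × Fin k, ∑ y : Fin r × Fin k,
      (α x.2 x.1 * β y.1 y.2) • single x.2 y.2 (v x.1 y.1) := by
    ext i j
    simp [sandwich, Matrix.sum_apply, Fintype.sum_prod_type, single_apply, ite_and]
  rw [hexpand]
  simp only [map_sum, map_smul, smul_eq_mul, amplify, coeffMap, of_apply, LinearMap.coe_mk,
    AddHom.coe_mk, mul_right_comm]

end Amplify

section HilbertSchmidt

variable {m n : Type} [Fintype m] [Fintype n]

/-- The square of the Hilbert–Schmidt norm. -/
def hilbertSchmidtSq (A : Matrix m n ℂ) : ℝ := ∑ i, ∑ j, ‖A i j‖ ^ 2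

theorem hilbertSchmidtSq_nonneg (A : Matrix m n ℂ) : 0 ≤ hilbertSchmidtSq A := by
  unfold hilbertSchmidtSq
  positivity

theorem hilbertSchmidtSq_conjTranspose (A : Matrix m n ℂ) :
    hilbertSchmidtSq Aᴴ = hilbertSchmidtSq A := by
  simp only [hilbertSchmidtSq, conjTranspose_apply, norm_star]
  exact Finset.sum_comm

theorem re_trace_mul_conjTranspose_self (A : Matrix m n ℂ) :
    (A * Aᴴ).trace.re = hilbertSchmidtSq A := by
  simp only [hilbertSchmidtSq, trace, diag_apply, mul_apply, conjTranspose_apply, Complex.re_sum]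
  refine Finset.sum_congr rfl fun i _ => Finset.sum_congr rfl fun j _ => ?_
  rw [← starRingEnd_apply, Complex.mul_conj']
  norm_cast

end HilbertSchmidt

section DensityMatrix

open scoped ComplexOrder

variable {m : Type} [Fintype m]

theorem exists_isHermitian_eq_re_trace (p : Matrix m m ℂ →ₗ[ℝ] ℝ) :
    ∃ ρ : Matrix m m ℂ, ρ.IsHermitian ∧
      ∀ P : Matrix m m ℂ, P.IsHermitian → p P = (P * ρ).trace.re := by
  classical
  let g : Matrix m m ℂ →ₗ[ℂ] ℂ := Module.Dual.extendRCLike p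
  let σ : Matrix m m ℂ := of fun j i => g (single i j 1)
  have hg : ∀ P, g P = (P * σ).trace := by
    intro P
    conv_lhs => rw [matrix_eq_sum_single P]
    have hsingle : ∀ i j, g (single i j (P i j)) = P i j * σ j i := by
      intro i j
      rw [show single i j (P i j) = P i j • single i j (1 : ℂ) by simp, map_smul, smul_eq_mul]
      rfl
    simp only [map_sum, hsingle, trace, diag_apply, mul_apply]
  have hp : ∀ P, p P = (P * σ).trace.re := by
    intro P
    rw [← hg]
    simp [g, Module.Dual.extendRCLike_apply]
  refine ⟨(2⁻¹ : ℂ) • (σ + σᴴ), ?_, fun P hP => ?_⟩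
  · ext i j
    simp [add_comm, mul_add]
  · have hconj : (P * σᴴ).trace = star (P * σ).trace := by
      rw [← trace_conjTranspose, conjTranspose_mul, hP.eq, trace_mul_comm]
    rw [hp, Matrix.mul_smul, mul_add, trace_smul, trace_add, hconj, RCLike.star_def,
      Complex.add_conj]
    simp

theorem exists_posSemidef_eq_re_trace (p : Matrix m m ℂ →ₗ[ℝ] ℝ)
    (hp : ∀ ξ : m → ℂ, 0 ≤ p (vecMulVec ξ (star ξ))) :
    ∃ ρ : Matrix m m ℂ, ρ.PosSemidef ∧
      ∀ P : Matrix m m ℂ, P.IsHermitian → p P = (P * ρ).trace.re := by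
  obtain ⟨ρ, hρ, hpρ⟩ := exists_isHermitian_eq_re_trace p
  refine ⟨ρ, .of_dotProduct_mulVec_nonneg hρ fun ξ => ?_, hpρ⟩
  have htrace : star ξ ⬝ᵥ ρ *ᵥ ξ = (vecMulVec ξ (star ξ) * ρ).trace := by
    rw [vecMulVec_mul, trace_vecMulVec, dotProduct_mulVec, dotProduct_comm]
  have hrank : (vecMulVec ξ (star ξ)).IsHermitian := by
    ext i j
    simp [vecMulVec_apply, mul_comm]
  refine Complex.le_def.2 ⟨?_, by simpa using (hρ.im_star_dotProduct_mulVec_self ξ).symm⟩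
  rw [htrace, ← hpρ _ hrank]
  exact hp ξ

variable [DecidableEq m]

/-- The density matrix of `p` is perturbed by a multiple of the identity to make its square root
invertible. -/
theorem exists_isUnit_le_hilbertSchmidtSq (p : Matrix m m ℂ →ₗ[ℝ] ℝ)
    (hp : ∀ ξ : m → ℂ, 0 ≤ p (vecMulVec ξ (star ξ))) (hp1 : p 1 ≤ 1) {ε : ℝ} (hε : 0 < ε) :
    ∃ R : Matrix m m ℂ, IsUnit R.det ∧ hilbertSchmidtSq R ≤ 1 + ε ∧
      ∀ (r : ℕ) (α : Matrix m (Fin r) ℂ), p (α * αᴴ) ≤ hilbertSchmidtSq (R * α) := by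
  obtain ⟨ρ, hρ, hpρ⟩ := exists_posSemidef_eq_re_trace p hp
  obtain ⟨δ, hδ, hδε⟩ : ∃ δ : ℝ, 0 < δ ∧ δ * Fintype.card m ≤ ε := by
    refine ⟨ε / (Fintype.card m + 1), by positivity, ?_⟩
    rw [div_mul_eq_mul_div, div_le_iff₀ (by positivity)]
    nlinarith
  have hpos : (ρ + (δ : ℂ) • 1).PosDef :=
    PosDef.posSemidef_add hρ (PosDef.one.smul (by exact_mod_cast hδ))
  obtain ⟨R, hR⟩ : ∃ R : Matrix m m ℂ, ρ + (δ : ℂ) • 1 = Rᴴ * R := by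
    open scoped MatrixOrder in
    exact CStarAlgebra.nonneg_iff_eq_star_mul_self.mp hpos.posSemidef.nonneg
  have htrace : ∀ P : Matrix m m ℂ, P.IsHermitian →
      (P * (Rᴴ * R)).trace.re = p P + δ * P.trace.re := by
    intro P hP
    simp [← hR, hpρ P hP, mul_add]
  refine ⟨R, ?_, ?_, fun r α => ?_⟩
  · have hunit := (isUnit_iff_isUnit_det _).1 hpos.isUnit
    rw [hR, det_mul] at hunit
    exact isUnit_of_mul_isUnit_right hunit
  · have h1 := htrace 1 isHermitian_one
    rw [one_mul, trace_mul_comm, re_trace_mul_conjTranspose_self, trace_one,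
      Complex.natCast_re] at h1
    linarith
  · have hα := htrace _ (isHermitian_mul_conjTranspose_self α)
    rw [re_trace_mul_conjTranspose_self] at hα
    have hRα : (α * αᴴ * (Rᴴ * R)).trace.re = hilbertSchmidtSq (R * α) := by
      rw [← re_trace_mul_conjTranspose_self, conjTranspose_mul, ← Matrix.mul_assoc,
        trace_mul_comm]
      simp only [Matrix.mul_assoc]
    have := mul_nonneg hδ.le (hilbertSchmidtSq_nonneg α)
    linarith

end DensityMatrix

namespace IsOperatorSpace

variable {E : Type*} [NormedAddCommGroup E] [NormedSpace ℂ E] {N : MatNorms E} {k : ℕ}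

/-- The convex cone whose dual consists of the pairs of functionals dominating `F`, see
`exists_dominating_functionals`. -/
def dominationCone (hN : IsOperatorSpace N) (F : Matrix (Fin k) (Fin k) E →ₗ[ℂ] ℂ) :
    PointedCone ℝ (Matrix (Fin k) (Fin k) ℂ × Matrix (Fin k) (Fin k) ℂ × ℝ) where
  carrier := {X | ∃ (r : ℕ) (α : Matrix (Fin k) (Fin r) ℂ) (v : Matrix (Fin r) (Fin r) E)
    (β : Matrix (Fin r) (Fin k) ℂ), N r v ≤ 1 ∧
    opNorm (X.1 - α * αᴴ) + opNorm (X.2.1 - βᴴ * β) + X.2.2 ≤ 2 * (F (sandwich α v β)).re}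
  add_mem' := by
    rintro ⟨P, Q, t⟩ ⟨P', Q', t'⟩ ⟨r, α, v, β, hv, h⟩ ⟨s, γ, w, δ, hw, h'⟩
    refine ⟨r + s, hcat α γ, directSum v w, vcat β δ,
      (hN.directSum_eq r s v w).trans_le (max_le hv hw), ?_⟩
    rw [hcat_mul_conjTranspose, conjTranspose_mul_vcat, sandwich_directSum, map_add,
      Complex.add_re]
    have hP := opNorm_add_le (P - α * αᴴ) (P' - γ * γᴴ)
    have hQ := opNorm_add_le (Q - βᴴ * β) (Q' - δᴴ * δ)
    simp only [Prod.fst_add, Prod.snd_add, add_sub_add_comm] at h h' ⊢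
    linarith
  zero_mem' := ⟨0, 0, 0, 0, by simp [hN.map_zero], by simp⟩
  smul_mem' := by
    rintro ⟨t, ht⟩ ⟨P, Q, u⟩ ⟨r, α, v, β, hv, h⟩
    have hsqrt : (√t : ℂ) * √t = t := by rw [← Complex.ofReal_mul, Real.mul_self_sqrt ht]
    have hstar : star (√t : ℂ) = √t := Complex.conj_ofReal _
    have hscale : ∀ X Y : Matrix (Fin k) (Fin k) ℂ,
        opNorm (t • X - (t : ℂ) • Y) = t * opNorm (X - Y) := fun X Y => by
      rw [← Complex.coe_smul, ← smul_sub, opNorm_smul, Complex.norm_real, Real.norm_of_nonneg ht]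
    refine ⟨r, (√t : ℂ) • α, v, (√t : ℂ) • β, hv, ?_⟩
    rw [sandwich_smul_smul]
    simp only [conjTranspose_smul, hstar, Matrix.smul_mul, Matrix.mul_smul, smul_smul, hsqrt,
      map_smul, smul_eq_mul, Complex.re_ofReal_mul]
    change opNorm (t • P - (t : ℂ) • _) + opNorm (t • Q - (t : ℂ) • _) + t * u ≤ _
    rw [hscale, hscale]
    linarith [mul_le_mul_of_nonneg_left h ht]

theorem nonpos_of_mem_dominationCone (hN : IsOperatorSpace N)
    {F : Matrix (Fin k) (Fin k) E →ₗ[ℂ] ℂ} (hF : ∀ v, ‖F v‖ ≤ N k v) {c : ℝ}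
    (hc : (0, 0, c) ∈ hN.dominationCone F) : c ≤ 0 := by
  obtain ⟨r, α, v, β, hv, h⟩ := hc
  have hF' : (F (sandwich α v β)).re ≤ opNorm α * opNorm β :=
    calc (F (sandwich α v β)).re ≤ ‖F (sandwich α v β)‖ := Complex.re_le_norm _
      _ ≤ opNorm α * N r v * opNorm β := (hF _).trans (hN.sandwich_le _ _ _ _ _)
      _ ≤ opNorm α * 1 * opNorm β := by
        gcongr
        exacts [opNorm_nonneg β, opNorm_nonneg α]
      _ = opNorm α * opNorm β := by rw [mul_one]
  simp only [zero_sub, opNorm_neg, opNorm_mul_conjTranspose_self,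
    opNorm_conjTranspose_mul_self] at h
  linarith [two_mul_le_add_sq (opNorm α) (opNorm β)]

theorem exists_linearMap_nonneg_dominationCone (hN : IsOperatorSpace N)
    {F : Matrix (Fin k) (Fin k) E →ₗ[ℂ] ℂ} (hF : ∀ v, ‖F v‖ ≤ N k v) :
    ∃ g : Matrix (Fin k) (Fin k) ℂ × Matrix (Fin k) (Fin k) ℂ × ℝ →ₗ[ℝ] ℝ,
      g (0, 0, 1) = -1 ∧ ∀ X ∈ hN.dominationCone F, 0 ≤ g X := by
  have he : (0, 0, 1) ≠ (0 : Matrix (Fin k) (Fin k) ℂ × Matrix (Fin k) (Fin k) ℂ × ℝ) := by simp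
  let f : Matrix (Fin k) (Fin k) ℂ × Matrix (Fin k) (Fin k) ℂ × ℝ →ₗ.[ℝ] ℝ :=
    LinearPMap.mkSpanSingleton (0, 0, 1) (-1) he
  obtain ⟨g, hgf, hg⟩ := riesz_extension (hN.dominationCone F) f (by
    rintro ⟨x, hx⟩ hxc
    obtain ⟨c, rfl⟩ := Submodule.mem_span_singleton.1 hx
    have hc : c ≤ 0 := hN.nonpos_of_mem_dominationCone hF (by simpa using hxc)
    rw [LinearPMap.mkSpanSingleton'_apply]
    simpa using hc) (by
    rintro ⟨P, Q, t⟩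
    refine ⟨⟨(-(opNorm P + opNorm Q + t)) • (0, 0, 1),
      Submodule.smul_mem _ _ (Submodule.mem_span_singleton_self _)⟩,
      0, 0, 0, 0, by simp [hN.map_zero], ?_⟩
    simp)
  exact ⟨g, (hgf ⟨_, Submodule.mem_span_singleton_self _⟩).trans
    (LinearPMap.mkSpanSingleton_apply ℝ ℝ he _), hg⟩

theorem exists_dominating_functionals (hN : IsOperatorSpace N)
    {F : Matrix (Fin k) (Fin k) E →ₗ[ℂ] ℂ} (hF : ∀ v, ‖F v‖ ≤ N k v) :
    ∃ p q : Matrix (Fin k) (Fin k) ℂ →ₗ[ℝ] ℝ, p 1 ≤ 1 ∧ q 1 ≤ 1 ∧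
      ∀ (r : ℕ) (α : Matrix (Fin k) (Fin r) ℂ) (v : Matrix (Fin r) (Fin r) E)
        (β : Matrix (Fin r) (Fin k) ℂ), N r v ≤ 1 →
        2 * (F (sandwich α v β)).re ≤ p (α * αᴴ) + q (βᴴ * β) := by
  let M := Matrix (Fin k) (Fin k) ℂ
  obtain ⟨g, hone, hg⟩ := hN.exists_linearMap_nonneg_dominationCone hF
  let p : M →ₗ[ℝ] ℝ := g ∘ₗ LinearMap.inl ℝ M (M × ℝ)
  let q : M →ₗ[ℝ] ℝ := g ∘ₗ LinearMap.inr ℝ M (M × ℝ) ∘ₗ LinearMap.inl ℝ M ℝ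
  have hsplit : ∀ (P Q : M) (t : ℝ), g (P, Q, t) = p P + q Q - t := by
    intro P Q t
    have : ((P, Q, t) : M × M × ℝ) = (P, 0, 0) + (0, Q, 0) + t • (0, 0, 1) := by simp
    rw [this, map_add, map_add, map_smul, hone, smul_eq_mul, mul_neg_one, ← sub_eq_add_neg]
    rfl
  have hmem : ∀ (P Q : M) (t : ℝ), opNorm P + opNorm Q + t ≤ 0 → 0 ≤ p P + q Q - t :=
    fun P Q t h => (hg _ ⟨0, 0, 0, 0, by simp [hN.map_zero], by simpa using h⟩).trans_eq
      (hsplit P Q t)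
  have hone_le : opNorm (-1 : M) - 1 ≤ 0 := by
    rw [opNorm_neg, sub_nonpos]
    exact opNorm_one_le
  refine ⟨p, q, ?_, ?_, fun r α v β hv => ?_⟩
  · have h := hmem (-1) 0 (-1) (by rwa [opNorm_zero, add_zero])
    rw [map_neg, LinearMap.map_zero] at h
    linarith
  · have h := hmem 0 (-1) (-1) (by rwa [opNorm_zero, zero_add])
    rw [map_neg, LinearMap.map_zero] at h
    linarith
  · have h := hg (α * αᴴ, βᴴ * β, 2 * (F (sandwich α v β)).re) ⟨r, α, v, β, hv, by simp⟩
    rw [hsplit] at h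
    exact sub_nonneg.1 h

end IsOperatorSpace

theorem le_mul_of_forall_gt {a b c : ℝ} (h : ∀ x > c, a ≤ b * x) : a ≤ b * c :=
  have hlim : Filter.Tendsto (b * ·) (nhdsWithin c (Set.Ioi c)) (nhds (b * c)) :=
    ((continuous_const_mul b).tendsto c).mono_left nhdsWithin_le_nhds
  ge_of_tendsto hlim (Filter.eventually_of_mem self_mem_nhdsWithin h)

section Factorization

variable {E : Type*} [NormedAddCommGroup E] [NormedSpace ℂ E] {N : MatNorms E} {k : ℕ}

theorem IsOperatorSpace.exists_isUnit_dominating (hN : IsOperatorSpace N)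
    {F : Matrix (Fin k) (Fin k) E →ₗ[ℂ] ℂ} (hF : ∀ v, ‖F v‖ ≤ N k v) {ε : ℝ} (hε : 0 < ε) :
    ∃ R S : Matrix (Fin k) (Fin k) ℂ, IsUnit R.det ∧ IsUnit S.det ∧
      hilbertSchmidtSq R ≤ 1 + ε ∧ hilbertSchmidtSq S ≤ 1 + ε ∧
      ∀ (r : ℕ) (α : Matrix (Fin k) (Fin r) ℂ) (v : Matrix (Fin r) (Fin r) E)
        (β : Matrix (Fin r) (Fin k) ℂ), N r v ≤ 1 →
        2 * (F (sandwich α v β)).re ≤ hilbertSchmidtSq (R * α) + hilbertSchmidtSq (β * S) := by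
  obtain ⟨p, q, hp1, hq1, hpq⟩ := hN.exists_dominating_functionals hF
  have hzero : N 1 0 ≤ 1 := by simp [hN.map_zero]
  have hcol : ∀ ξ : Fin k → ℂ,
      replicateCol (Fin 1) ξ * replicateRow (Fin 1) (star ξ) = vecMulVec ξ (star ξ) := fun ξ => by
    ext; simp [Matrix.mul_apply, vecMulVec_apply]
  have hp : ∀ ξ : Fin k → ℂ, 0 ≤ p (vecMulVec ξ (star ξ)) := fun ξ => by
    have h := hpq 1 (replicateCol (Fin 1) ξ) 0 0 hzero
    simpa [hcol] using h
  have hq : ∀ ξ : Fin k → ℂ, 0 ≤ q (vecMulVec ξ (star ξ)) := fun ξ => by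
    have h := hpq 1 0 0 (replicateRow (Fin 1) (star ξ)) hzero
    simpa [hcol] using h
  obtain ⟨R, hRu, hR1, hR⟩ := exists_isUnit_le_hilbertSchmidtSq p hp hp1 hε
  obtain ⟨S, hSu, hS1, hS⟩ := exists_isUnit_le_hilbertSchmidtSq q hq hq1 hε
  refine ⟨R, Sᴴ, hRu, by simpa [det_conjTranspose] using hSu, hR1,
    (hilbertSchmidtSq_conjTranspose S).trans_le hS1, fun r α v β hv => ?_⟩
  have hβ := hS r βᴴ
  rw [conjTranspose_conjTranspose, ← hilbertSchmidtSq_conjTranspose, conjTranspose_mul,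
    conjTranspose_conjTranspose] at hβ
  exact (hpq r α v β hv).trans (add_le_add (hR r α) hβ)

theorem IsOperatorSpace.opNorm_amplify_coeffMap_le (hN : IsOperatorSpace N)
    {G : Matrix (Fin k) (Fin k) E →ₗ[ℂ] ℂ}
    (hG : ∀ (r : ℕ) (α : Matrix (Fin k) (Fin r) ℂ) (v : Matrix (Fin r) (Fin r) E)
      (β : Matrix (Fin r) (Fin k) ℂ), N r v ≤ 1 →
      2 * (G (sandwich α v β)).re ≤ hilbertSchmidtSq α + hilbertSchmidtSq β)
    (r : ℕ) (v : Matrix (Fin r) (Fin r) E) : opNorm (amplify (coeffMap G) v) ≤ N r v := by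
  have hunit : ∀ v, N r v ≤ 1 → opNorm (amplify (coeffMap G) v) ≤ 1 := by
    refine fun v hv => opNorm_le_one_of_bilinear fun ξ η => ?_
    have h := hG r (of fun i a => ξ (a, i)) v (of fun a i => η (a, i)) hv
    rw [apply_sandwich] at h
    rw [Fintype.sum_prod_type_right fun x => ‖ξ x‖ ^ 2, Fintype.sum_prod_type fun y => ‖η y‖ ^ 2]
    exact h
  refine le_of_forall_gt_imp_ge_of_dense fun c hc => ?_
  have hc₀ : 0 < c := (hN.nonneg r v).trans_lt hc
  have hnorm : ‖(c⁻¹ : ℂ)‖ = c⁻¹ := by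
    rw [norm_inv, Complex.norm_real, Real.norm_of_nonneg hc₀.le]
  have h := hunit ((c⁻¹ : ℂ) • v) (by
    rw [hN.smul_eq, hnorm, inv_mul_le_one₀ hc₀]
    exact hc.le)
  rwa [amplify_smul, opNorm_smul, hnorm, inv_mul_le_one₀ hc₀] at h

theorem norm_apply_sandwich_le (G : Matrix (Fin k) (Fin k) E →ₗ[ℂ] ℂ) {r : ℕ}
    (α : Matrix (Fin k) (Fin r) ℂ) (v : Matrix (Fin r) (Fin r) E)
    (β : Matrix (Fin r) (Fin k) ℂ) :
    ‖G (sandwich α v β)‖ ≤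
      opNorm (amplify (coeffMap G) v) * √(hilbertSchmidtSq α) * √(hilbertSchmidtSq β) := by
  have h := norm_bilinear_le (amplify (coeffMap G) v) (fun x => α x.2 x.1) (fun y => β y.1 y.2)
  rw [← apply_sandwich, Fintype.sum_prod_type_right, Fintype.sum_prod_type] at h
  exact h

/-- The quantitative core of Ruan's theorem. -/
theorem IsOperatorSpace.le_of_forall_amplify_le (hN : IsOperatorSpace N)
    (z : Matrix (Fin k) (Fin k) E) {D : ℝ}
    (h : ∀ φ : E →ₗ[ℂ] Matrix (Fin k) (Fin k) ℂ,
      (∀ (r : ℕ) (v : Matrix (Fin r) (Fin r) E), opNorm (amplify φ v) ≤ N r v) →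
      opNorm (amplify φ z) ≤ D) : N k z ≤ D := by
  obtain ⟨F, hFz, hF⟩ := exists_linearMap_eq_seminorm (hN.seminorm k) z
  suffices ∀ C > 1, N k z ≤ D * C by simpa using le_mul_of_forall_gt this
  intro C hC
  obtain ⟨R, S, hRu, hSu, hR, hS, hRS⟩ := hN.exists_isUnit_dominating hF (sub_pos.2 hC)
  rw [add_sub_cancel] at hR hS
  let G := F ∘ₗ sandwichₗ R⁻¹ S⁻¹
  have hG := hN.opNorm_amplify_coeffMap_le (G := G) fun r α v β hv => by
    simpa [G, sandwich_sandwich, ← Matrix.mul_assoc, mul_nonsing_inv _ hRu, Matrix.mul_assoc β,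
      nonsing_inv_mul _ hSu] using hRS r (R⁻¹ * α) v (β * S⁻¹) hv
  have hGz : N k z = ‖G (sandwich R z S)‖ := by
    have : G (sandwich R z S) = hN.seminorm k z := by
      simp [G, sandwich_sandwich, nonsing_inv_mul _ hRu, mul_nonsing_inv _ hSu, sandwich_one,
        hFz]
    rw [this, Complex.norm_real]
    exact (Real.norm_of_nonneg (hN.nonneg k z)).symm
  have hD : 0 ≤ D := (opNorm_nonneg _).trans (h (coeffMap G) hG)
  calc N k z ≤ _ := hGz.trans_le (norm_apply_sandwich_le G R z S)
    _ ≤ D * √C * √C := by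
      gcongr
      exact h (coeffMap G) hG
    _ = D * C := by rw [mul_assoc, Real.mul_self_sqrt (by positivity)]

end Factorization

section Interpolation

open Complex.HadamardThreeLines

variable {V V' : Type*} [NormedAddCommGroup V] [NormedSpace ℂ V] [NormedAddCommGroup V']
  [NormedSpace ℂ V'] {k k' : ℕ}

attribute [local instance] Matrix.normedAddCommGroup Matrix.normedSpace

/-- The bounded analytic functions on the strip `0 < re z < 1` that compete in the definition of
`interp`. -/
def IsAdmissible (f : ℂ → Matrix (Fin k) (Fin k) V) : Prop :=
  (∀ i j, DiffContOnCl ℂ (fun z => f z i j) (verticalStrip 0 1)) ∧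
    ∃ B : ℝ, ∀ z ∈ verticalClosedStrip 0 1, ∀ i j, ‖f z i j‖ ≤ B

theorem diffContOnCl_pi {ι : Type*} [Fintype ι] {F : ι → Type*} [∀ i, NormedAddCommGroup (F i)]
    [∀ i, NormedSpace ℂ (F i)] {f : ℂ → ∀ i, F i} {s : Set ℂ} :
    DiffContOnCl ℂ f s ↔ ∀ i, DiffContOnCl ℂ (fun z => f z i) s :=
  ⟨fun h i => ⟨differentiableOn_pi.1 h.1 i, continuousOn_pi.1 h.2 i⟩,
    fun h => ⟨differentiableOn_pi.2 fun i => (h i).1, continuousOn_pi.2 fun i => (h i).2⟩⟩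

theorem isAdmissible_iff {f : ℂ → Matrix (Fin k) (Fin k) V} :
    IsAdmissible f ↔ DiffContOnCl ℂ f (verticalStrip 0 1) ∧
      ∃ B : ℝ, 0 ≤ B ∧ ∀ z ∈ verticalClosedStrip 0 1, ‖f z‖ ≤ B := by
  have hdiff : DiffContOnCl ℂ f (verticalStrip 0 1) ↔
      ∀ i j, DiffContOnCl ℂ (fun z => f z i j) (verticalStrip 0 1) :=
    diffContOnCl_pi.trans (forall_congr' fun i => diffContOnCl_pi)
  refine and_congr hdiff.symm ⟨?_, ?_⟩
  · rintro ⟨B, hB⟩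
    exact ⟨max B 0, le_max_right _ _, fun z hz => (Matrix.norm_le_iff (le_max_right _ _)).2
      fun i j => (hB z hz i j).trans (le_max_left _ _)⟩
  · rintro ⟨B, -, hB⟩
    exact ⟨B, fun z hz i j => (Matrix.norm_entry_le_entrywise_sup_norm _).trans (hB z hz)⟩

theorem diffContOnCl_comp_and_bounded {X Y : Type*} [NormedAddCommGroup X] [NormedSpace ℂ X]
    [NormedAddCommGroup Y] [NormedSpace ℂ Y] (T : X →ₗ[ℂ] Y) (hT : Continuous T) {f : ℂ → X}
    {s t : Set ℂ} (hf : DiffContOnCl ℂ f s) (hB : ∃ B : ℝ, 0 ≤ B ∧ ∀ z ∈ t, ‖f z‖ ≤ B) :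
    DiffContOnCl ℂ (fun z => T (f z)) s ∧ ∃ B : ℝ, 0 ≤ B ∧ ∀ z ∈ t, ‖T (f z)‖ ≤ B := by
  obtain ⟨B, hB₀, hB⟩ := hB
  let T' : X →L[ℂ] Y := ⟨T, hT⟩
  exact ⟨T'.differentiable.comp_diffContOnCl hf, ‖T'‖ * B, by positivity,
    fun z hz => T'.le_opNorm_of_le (hB z hz)⟩

theorem isAdmissible_const (x : Matrix (Fin k) (Fin k) V) : IsAdmissible fun _ => x :=
  isAdmissible_iff.2 ⟨diffContOnCl_const, ‖x‖, norm_nonneg _, fun _ _ => le_rfl⟩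

theorem IsAdmissible.add {f g : ℂ → Matrix (Fin k) (Fin k) V} (hf : IsAdmissible f)
    (hg : IsAdmissible g) : IsAdmissible fun z => f z + g z := by
  obtain ⟨hf, B, hB₀, hB⟩ := isAdmissible_iff.1 hf
  obtain ⟨hg, B', hB₀', hB'⟩ := isAdmissible_iff.1 hg
  exact isAdmissible_iff.2 ⟨hf.add hg, B + B', by positivity, fun z hz =>
    (norm_add_le _ _).trans (add_le_add (hB z hz) (hB' z hz))⟩

theorem IsAdmissible.map {f : ℂ → Matrix (Fin k) (Fin k) V} (hf : IsAdmissible f)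
    {T : Matrix (Fin k) (Fin k) V →ₗ[ℂ] Matrix (Fin k') (Fin k') V'} (hT : Continuous T) :
    IsAdmissible fun z => T (f z) := by
  obtain ⟨hf, hB⟩ := isAdmissible_iff.1 hf
  exact isAdmissible_iff.2 (diffContOnCl_comp_and_bounded T hT hf hB)

/-- The scalar function `z ↦ a ^ (θ - z)`, which balances unequal bounds on the two sides of the
strip. -/
def expScale (a θ : ℝ) (z : ℂ) : ℂ := Complex.exp ((θ - z) * Real.log a)

theorem norm_expScale {a : ℝ} (ha : 0 < a) (θ : ℝ) (z : ℂ) :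
    ‖expScale a θ z‖ = a ^ (θ - z.re) := by
  simp [expScale, Complex.norm_exp, Real.rpow_def_of_pos ha, mul_comm]

theorem expScale_self (a θ : ℝ) : expScale a θ θ = 1 := by simp [expScale]

theorem differentiable_expScale (a θ : ℝ) : Differentiable ℂ (expScale a θ) := by
  unfold expScale
  fun_prop

theorem norm_expScale_le (a θ : ℝ) {z : ℂ} (hz : z ∈ verticalClosedStrip 0 1) :
    ‖expScale a θ z‖ ≤ Real.exp ((|θ| + 1) * |Real.log a|) := by
  have hre : (((θ : ℂ) - z) * (Real.log a : ℂ)).re = (θ - z.re) * Real.log a := by simp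
  have habs : |θ - z.re| ≤ |θ| + 1 :=
    (abs_sub _ _).trans (by rw [abs_of_nonneg hz.1]; linarith [hz.2])
  rw [expScale, Complex.norm_exp, hre, Real.exp_le_exp]
  calc (θ - z.re) * Real.log a ≤ |θ - z.re| * |Real.log a| := (le_abs_self _).trans_eq (abs_mul _ _)
    _ ≤ (|θ| + 1) * |Real.log a| := by gcongr

theorem IsAdmissible.expScale_smul {f : ℂ → Matrix (Fin k) (Fin k) V} (hf : IsAdmissible f)
    (a θ : ℝ) : IsAdmissible fun z => expScale a θ z • f z := by
  obtain ⟨hf, B, hB₀, hB⟩ := isAdmissible_iff.1 hf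
  refine isAdmissible_iff.2 ⟨(differentiable_expScale a θ).diffContOnCl.smul hf,
    Real.exp ((|θ| + 1) * |Real.log a|) * B, by positivity, fun z hz => ?_⟩
  rw [norm_smul]
  gcongr
  exacts [norm_expScale_le a θ hz, hB z hz]

variable {N₀ N₁ : MatNorms V} {N₀' N₁' : MatNorms V'} {θ : ℝ}

theorem interp_nonneg (N₀ N₁ : MatNorms V) (θ : ℝ) (x : Matrix (Fin k) (Fin k) V) :
    0 ≤ interp N₀ N₁ θ k x :=
  Real.sInf_nonneg fun _ hC => hC.1

theorem IsAdmissible.interp_le {f : ℂ → Matrix (Fin k) (Fin k) V} (hf : IsAdmissible f) {C : ℝ}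
    (hC : 0 ≤ C) (h₀ : ∀ t : ℝ, N₀ k (f (t * Complex.I)) ≤ C)
    (h₁ : ∀ t : ℝ, N₁ k (f (1 + t * Complex.I)) ≤ C) : interp N₀ N₁ θ k (f θ) ≤ C :=
  csInf_le ⟨0, fun _ h => h.1⟩ ⟨hC, f, hf.1, hf.2, rfl, h₀, h₁⟩

theorem IsAdmissible.interp_le_rpow_mul {f : ℂ → Matrix (Fin k) (Fin k) V} (hf : IsAdmissible f)
    {a C : ℝ} (ha : 0 < a) (hC : 0 ≤ C)
    (hom₀ : ∀ (c : ℂ) y, N₀ k (c • y) ≤ ‖c‖ * N₀ k y)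
    (hom₁ : ∀ (c : ℂ) y, N₁ k (c • y) ≤ ‖c‖ * N₁ k y)
    (h₀ : ∀ t : ℝ, N₀ k (f (t * Complex.I)) ≤ C)
    (h₁ : ∀ t : ℝ, N₁ k (f (1 + t * Complex.I)) ≤ a * C) :
    interp N₀ N₁ θ k (f θ) ≤ a ^ θ * C := by
  have h := (hf.expScale_smul a θ).interp_le (N₀ := N₀) (N₁ := N₁) (θ := θ) (C := a ^ θ * C)
    (by positivity) (fun t => ?_) (fun t => ?_)
  · simpa [expScale_self] using h
  · have he : ‖expScale a θ (t * Complex.I)‖ = a ^ θ := by simp [norm_expScale ha]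
    refine (hom₀ _ _).trans ?_
    rw [he]
    gcongr
    exact h₀ t
  · have he : ‖expScale a θ (1 + t * Complex.I)‖ * a = a ^ θ := by
      rw [norm_expScale ha, ← Real.rpow_add_one ha.ne']
      simp
    refine (hom₁ _ _).trans ?_
    rw [← he, mul_assoc]
    gcongr
    exact h₁ t

theorem exists_of_interp_lt {x : Matrix (Fin k) (Fin k) V} {C : ℝ} (h : interp N₀ N₁ θ k x < C) :
    ∃ f : ℂ → Matrix (Fin k) (Fin k) V, IsAdmissible f ∧ f θ = x ∧
      (∀ t : ℝ, N₀ k (f (t * Complex.I)) ≤ C) ∧ ∀ t : ℝ, N₁ k (f (1 + t * Complex.I)) ≤ C := by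
  obtain ⟨C', ⟨-, f, hf, hB, hx, h₀, h₁⟩, hC'⟩ := exists_lt_of_csInf_lt (by
    exact ⟨max 0 (max (N₀ k x) (N₁ k x)), le_max_left _ _, fun _ => x, (isAdmissible_const x).1,
      (isAdmissible_const x).2, rfl, fun _ => (le_max_left _ _).trans (le_max_right _ _),
      fun _ => (le_max_right _ _).trans (le_max_right _ _)⟩) h
  exact ⟨f, ⟨hf, hB⟩, hx, fun t => (h₀ t).trans hC'.le, fun t => (h₁ t).trans hC'.le⟩

theorem interp_map_le {T : Matrix (Fin k) (Fin k) V →ₗ[ℂ] Matrix (Fin k') (Fin k') V'}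
    (hT : Continuous T) {D a : ℝ} (hD : 0 ≤ D) (ha : 0 < a)
    (hom₀ : ∀ (c : ℂ) y, N₀' k' (c • y) ≤ ‖c‖ * N₀' k' y)
    (hom₁ : ∀ (c : ℂ) y, N₁' k' (c • y) ≤ ‖c‖ * N₁' k' y)
    (h₀ : ∀ x, N₀' k' (T x) ≤ D * N₀ k x) (h₁ : ∀ x, N₁' k' (T x) ≤ D * a * N₁ k x)
    (x : Matrix (Fin k) (Fin k) V) :
    interp N₀' N₁' θ k' (T x) ≤ D * a ^ θ * interp N₀ N₁ θ k x := by
  refine le_mul_of_forall_gt fun C hC => ?_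
  have hC₀ : 0 ≤ C := (interp_nonneg N₀ N₁ θ x).trans hC.le
  obtain ⟨f, hf, rfl, hf₀, hf₁⟩ := exists_of_interp_lt hC
  rw [mul_comm D, mul_assoc]
  refine (hf.map hT).interp_le_rpow_mul ha (by positivity) hom₀ hom₁ (fun t => ?_) fun t => ?_
  · exact (h₀ _).trans (by gcongr; exact hf₀ t)
  · rw [← mul_assoc, mul_comm a]
    exact (h₁ _).trans (by gcongr; exact hf₁ t)

theorem interp_le_of_le {D a : ℝ} (hD : 0 ≤ D) (ha : 0 < a) {x : Matrix (Fin k) (Fin k) V}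
    (hom₀ : ∀ (c : ℂ) y, N₀ k (c • y) ≤ ‖c‖ * N₀ k y)
    (hom₁ : ∀ (c : ℂ) y, N₁ k (c • y) ≤ ‖c‖ * N₁ k y)
    (h₀ : N₀ k x ≤ D) (h₁ : N₁ k x ≤ a * D) : interp N₀ N₁ θ k x ≤ a ^ θ * D :=
  (isAdmissible_const x).interp_le_rpow_mul ha hD hom₀ hom₁ (fun _ => h₀) fun _ => h₁

theorem interp_smul_le (hom₀ : ∀ (c : ℂ) y, N₀ k (c • y) ≤ ‖c‖ * N₀ k y)
    (hom₁ : ∀ (c : ℂ) y, N₁ k (c • y) ≤ ‖c‖ * N₁ k y) (c : ℂ) (x : Matrix (Fin k) (Fin k) V) :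
    interp N₀ N₁ θ k (c • x) ≤ ‖c‖ * interp N₀ N₁ θ k x := by
  have hcont : Continuous (LinearMap.lsmul ℂ (Matrix (Fin k) (Fin k) V) c) :=
    continuous_const_smul c
  simpa using interp_map_le (θ := θ) hcont (norm_nonneg c) one_pos hom₀ hom₁ (hom₀ c)
    (fun y => by simpa using hom₁ c y) x

theorem interp_add_le (h₀ : ∀ x y, N₀ k (x + y) ≤ N₀ k x + N₀ k y)
    (h₁ : ∀ x y, N₁ k (x + y) ≤ N₁ k x + N₁ k y) (x y : Matrix (Fin k) (Fin k) V) :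
    interp N₀ N₁ θ k (x + y) ≤ interp N₀ N₁ θ k x + interp N₀ N₁ θ k y := by
  refine le_of_forall_pos_le_add fun ε hε => ?_
  have hCx : interp N₀ N₁ θ k x < interp N₀ N₁ θ k x + ε / 2 := by linarith
  have hCy : interp N₀ N₁ θ k y < interp N₀ N₁ θ k y + ε / 2 := by linarith
  obtain ⟨f, hf, rfl, hf₀, hf₁⟩ := exists_of_interp_lt hCx
  obtain ⟨g, hg, rfl, hg₀, hg₁⟩ := exists_of_interp_lt hCy
  rw [← add_halves ε, add_add_add_comm]
  exact (hf.add hg).interp_le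
    (add_nonneg ((interp_nonneg _ _ _ _).trans hCx.le) ((interp_nonneg _ _ _ _).trans hCy.le))
    (fun t => (h₀ _ _).trans (add_le_add (hf₀ t) (hg₀ t)))
    (fun t => (h₁ _ _).trans (add_le_add (hf₁ t) (hg₁ t)))

theorem norm_le_rpow_mul_of_verticalStrip {g : ℂ → ℂ} (hg : DiffContOnCl ℂ g (verticalStrip 0 1))
    (hB : ∃ B : ℝ, 0 ≤ B ∧ ∀ z ∈ verticalClosedStrip 0 1, ‖g z‖ ≤ B) (hθ : θ ∈ Set.Icc (0 : ℝ) 1)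
    {a C : ℝ} (ha : 0 < a) (hC : 0 ≤ C) (h₀ : ∀ t : ℝ, ‖g (t * Complex.I)‖ ≤ C)
    (h₁ : ∀ t : ℝ, ‖g (1 + t * Complex.I)‖ ≤ a * C) : ‖g θ‖ ≤ a ^ θ * C := by
  obtain ⟨B, -, hB⟩ := hB
  have hmem : (θ : ℂ) ∈ verticalClosedStrip 0 1 := by simpa [verticalClosedStrip] using hθ
  have h := norm_le_interp_of_mem_verticalClosedStrip₀₁' (a := C) (b := a * C) g hmem hg
    ⟨B, Set.forall_mem_image.2 fun z hz => hB z hz⟩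
    (fun z (hz : z.re = 0) => by
      have hline : z = z.im * Complex.I := by apply Complex.ext <;> simp [hz]
      exact hline ▸ h₀ z.im)
    (fun z (hz : z.re = 1) => by
      have hline : z = 1 + z.im * Complex.I := by apply Complex.ext <;> simp [hz]
      exact hline ▸ h₁ z.im)
  rw [Complex.ofReal_re, Real.mul_rpow ha.le hC, mul_left_comm,
    ← Real.rpow_add_of_nonneg hC (by linarith [hθ.2]) hθ.1] at h
  simpa using h

theorem seminorm_le_interp (M : Seminorm ℂ (Matrix (Fin k) (Fin k) V)) (hM : Continuous M)
    {D a : ℝ} (hD : 0 ≤ D) (ha : 0 < a) (hθ : θ ∈ Set.Icc (0 : ℝ) 1)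
    (h₀ : ∀ x, M x ≤ D * N₀ k x) (h₁ : ∀ x, M x ≤ D * a * N₁ k x)
    (x : Matrix (Fin k) (Fin k) V) : M x ≤ D * a ^ θ * interp N₀ N₁ θ k x := by
  refine le_mul_of_forall_gt fun C hC => ?_
  have hC₀ : 0 ≤ C := (interp_nonneg N₀ N₁ θ x).trans hC.le
  obtain ⟨f, hf, rfl, hf₀, hf₁⟩ := exists_of_interp_lt hC
  obtain ⟨F, hFx, hF⟩ := exists_linearMap_eq_seminorm M (f θ)
  have hFc : Continuous F := by
    refine continuous_of_continuousAt_zero F ?_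
    rw [ContinuousAt, map_zero]
    exact squeeze_zero_norm hF (by simpa using hM.tendsto 0)
  obtain ⟨hf, hB⟩ := isAdmissible_iff.1 hf
  obtain ⟨hFf, hFB⟩ := diffContOnCl_comp_and_bounded F hFc hf hB
  have h := norm_le_rpow_mul_of_verticalStrip hFf hFB hθ ha (mul_nonneg hD hC₀)
    (fun t => (hF _).trans ((h₀ _).trans (by gcongr; exact hf₀ t)))
    (fun t => (hF _).trans ((h₁ _).trans (by
      rw [← mul_assoc, mul_comm a]; gcongr; exact hf₁ t)))
  calc M (f θ) = ‖F (f θ)‖ := by rw [hFx, Complex.norm_of_nonneg (apply_nonneg M _)]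
    _ ≤ D * a ^ θ * C := h.trans_eq (by ring)

end Interpolation

section TensorSandwich

/-- The product `α (x ⊗ y) β` of a matrix over `V ⊗ W` with scalar matrices, where the bilinear map
`b : V → W → U` plays the role of the tensor product. -/
def tensorSandwich {V W U τ ι κ : Type*} [AddCommGroup V] [Module ℂ V] [AddCommGroup W]
    [Module ℂ W] [AddCommGroup U] [Module ℂ U] [Fintype ι] [Fintype κ] (b : V →ₗ[ℂ] W →ₗ[ℂ] U)
    (α : Matrix τ (ι × κ) ℂ) (x : Matrix ι ι V) (y : Matrix κ κ W) (β : Matrix (ι × κ) τ ℂ) :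
    Matrix τ τ U :=
  of fun r s => ∑ a, ∑ c, (α r a * β c s) • b (x a.1 c.1) (y a.2 c.2)

variable {V W U τ ι κ : Type*} [AddCommGroup V] [Module ℂ V] [AddCommGroup W] [Module ℂ W]
  [AddCommGroup U] [Module ℂ U] [Fintype ι] [Fintype κ]

theorem tensorSandwich_smul (b : V →ₗ[ℂ] W →ₗ[ℂ] U) (c c' d d' : ℂ) (α : Matrix τ (ι × κ) ℂ)
    (x : Matrix ι ι V) (y : Matrix κ κ W) (β : Matrix (ι × κ) τ ℂ) :
    tensorSandwich b (c • α) (d • x) (d' • y) (c' • β) =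
      (c * d * d' * c') • tensorSandwich b α x y β := by
  ext r s
  simp only [tensorSandwich, of_apply, Matrix.smul_apply, map_smul, LinearMap.smul_apply,
    smul_smul, smul_eq_mul, Finset.smul_sum]
  exact Finset.sum_congr rfl fun _ _ => Finset.sum_congr rfl fun _ _ => by ring_nf

theorem tensorSandwich_reindex {τ' ι' κ' : Type*} [Fintype ι'] [Fintype κ']
    (b : V →ₗ[ℂ] W →ₗ[ℂ] U) (e : τ ≃ τ') (f : ι ≃ ι') (g : κ ≃ κ') (α : Matrix τ (ι × κ) ℂ)
    (x : Matrix ι ι V) (y : Matrix κ κ W) (β : Matrix (ι × κ) τ ℂ) :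
    tensorSandwich b (reindex e (f.prodCongr g) α) (reindex f f x) (reindex g g y)
      (reindex (f.prodCongr g) e β) = reindex e e (tensorSandwich b α x y β) := by
  ext r s
  refine Fintype.sum_equiv (f.prodCongr g).symm _ _ fun a =>
    Fintype.sum_equiv (f.prodCongr g).symm _ _ fun c => rfl

end TensorSandwich

section MatrixGauge

/-- Matrix norms that are nonnegative, homogeneous and bounded on block diagonal matrices as
Ruan's axioms require; subadditivity is not assumed. This is what the factors of a projective
tensor product have to satisfy for the product norms to be seminorms. -/
structure IsMatrixGauge {V : Type*} [AddCommGroup V] [Module ℂ V] (N : MatNorms V) : Prop where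
  nonneg : ∀ k (x : Matrix (Fin k) (Fin k) V), 0 ≤ N k x
  smul_le : ∀ k (c : ℂ) (x : Matrix (Fin k) (Fin k) V), N k (c • x) ≤ ‖c‖ * N k x
  directSum_le : ∀ k l (x : Matrix (Fin k) (Fin k) V) (y : Matrix (Fin l) (Fin l) V),
    N (k + l) (directSum x y) ≤ max (N k x) (N l y)

theorem IsOperatorSpace.isMatrixGauge {E : Type*} [NormedAddCommGroup E] [NormedSpace ℂ E]
    {N : MatNorms E} (hN : IsOperatorSpace N) : IsMatrixGauge N where
  nonneg := hN.nonneg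
  smul_le k c x := (hN.smul_eq k c x).le
  directSum_le k l x y := (hN.directSum_eq k l x y).le

theorem opNorm_fin_one_const (c : ℂ) :
    opNorm (of fun _ _ => c : Matrix (Fin 1) (Fin 1) ℂ) = ‖c‖ := by
  refine le_antisymm (opNorm_le_of_sum_sq (norm_nonneg c) fun x => ?_)
    (norm_entry_le_opNorm (of fun _ _ => c : Matrix (Fin 1) (Fin 1) ℂ) 0 0)
  simp [mulVec, dotProduct, mul_pow]

theorem sandwich_eq_mul {k l : ℕ} (α : Matrix (Fin k) (Fin l) ℂ) (w : Matrix (Fin l) (Fin l) ℂ)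
    (β : Matrix (Fin l) (Fin k) ℂ) : sandwich α w β = α * w * β := by
  ext i j
  simp only [sandwich, of_apply, mul_apply, Finset.sum_mul, smul_eq_mul, mul_right_comm]
  exact Finset.sum_comm

theorem isOperatorSpace_scalarNorms : IsOperatorSpace scalarNorms where
  add_le _ := opNorm_add_le
  smul_eq _ := opNorm_smul
  eq_zero _ _ := opNorm_eq_zero.1
  one_eq := opNorm_fin_one_const
  directSum_eq _ _ v w := (opNorm_reindex _ _ _).trans (opNorm_fromBlocks v w)
  sandwich_le k l α w β := by
    rw [sandwich_eq_mul]
    exact opNorm_mul_mul_le le_rfl le_rfl le_rfl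

end MatrixGauge

section Dual

variable {V W : Type*} [AddCommGroup V] [Module ℂ V] [AddCommGroup W] [Module ℂ W]
  {b : V →ₗ[ℂ] W →ₗ[ℂ] ℂ} {N : MatNorms W}

/-- The joint amplification of a pairing, evaluated at matrices over `V` and `W`. -/
def pairMat (b : V →ₗ[ℂ] W →ₗ[ℂ] ℂ) {ι l : Type} (x : Matrix l l V) (A : Matrix ι ι W) :
    Matrix (ι × l) (ι × l) ℂ :=
  of fun i j => b (x i.2 j.2) (A i.1 j.1)

theorem opNorm_pairMat_reindex {ι ι' l l' : Type} [Fintype ι] [Fintype ι'] [Fintype l]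
    [Fintype l'] [DecidableEq ι] [DecidableEq ι'] [DecidableEq l] [DecidableEq l']
    (x : Matrix l l V) (A : Matrix ι ι W) (e : ι ≃ ι') (f : l ≃ l') :
    opNorm (pairMat b (reindex f f x) (reindex e e A)) = opNorm (pairMat b x A) :=
  opNorm_reindex (pairMat b x A) (e.prodCongr f) (e.prodCongr f)

/-- The matrix norms of `W` are nonnegative and every matrix over `V` defines a completely bounded
map on `W`, so that `dualNorms b N` is an infimum over a nonempty set. -/
structure PairingBounded (b : V →ₗ[ℂ] W →ₗ[ℂ] ℂ) (N : MatNorms W) : Prop where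
  nonneg : ∀ r (A : Matrix (Fin r) (Fin r) W), 0 ≤ N r A
  exists_bound : ∀ l (x : Matrix (Fin l) (Fin l) V), ∃ C, 0 ≤ C ∧
    ∀ r (A : Matrix (Fin r) (Fin r) W), opNorm (pairMat b x A) ≤ C * N r A

theorem sInfty_pairingMap {r l : ℕ} (x : Matrix (Fin l) (Fin l) V)
    (A : Matrix (Fin r) (Fin r) W) :
    sInfty l scalarNorms r (A.map (pairingMap b x)) = opNorm (pairMat b x A) :=
  opNorm_reindex (pairMat b x A) _ _

theorem dualNorms_nonneg (b : V →ₗ[ℂ] W →ₗ[ℂ] ℂ) (N : MatNorms W) {l : ℕ}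
    (x : Matrix (Fin l) (Fin l) V) : 0 ≤ dualNorms b N l x :=
  Real.sInf_nonneg fun _ hC => hC.1

theorem dualNorms_le {l : ℕ} {x : Matrix (Fin l) (Fin l) V} {C : ℝ} (hC : 0 ≤ C)
    (h : ∀ r (A : Matrix (Fin r) (Fin r) W), opNorm (pairMat b x A) ≤ C * N r A) :
    dualNorms b N l x ≤ C :=
  csInf_le ⟨0, fun _ h => h.1⟩ ⟨hC, fun r A => (sInfty_pairingMap x A).trans_le (h r A)⟩

theorem opNorm_pairMat_le (hb : PairingBounded b N) {l r : ℕ}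
    (x : Matrix (Fin l) (Fin l) V) (A : Matrix (Fin r) (Fin r) W) :
    opNorm (pairMat b x A) ≤ dualNorms b N l x * N r A := by
  rw [mul_comm]
  refine le_mul_of_forall_gt fun C hC => ?_
  obtain ⟨C₀, hC₀, hb'⟩ := hb.exists_bound l x
  obtain ⟨C', ⟨-, hC'⟩, hlt⟩ := exists_lt_of_csInf_lt
    (by exact ⟨C₀, hC₀, fun r A => (sInfty_pairingMap x A).trans_le (hb' r A)⟩) hC
  calc opNorm (pairMat b x A) ≤ C' * N r A := (sInfty_pairingMap x A).symm.trans_le (hC' r A)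
    _ ≤ C * N r A := mul_le_mul_of_nonneg_right hlt.le (hb.nonneg r A)
    _ = N r A * C := mul_comm _ _

theorem dualNorms_smul_le (hb : PairingBounded b N) {l : ℕ} (c : ℂ)
    (x : Matrix (Fin l) (Fin l) V) : dualNorms b N l (c • x) ≤ ‖c‖ * dualNorms b N l x := by
  refine dualNorms_le (mul_nonneg (norm_nonneg c) (dualNorms_nonneg b N x)) fun r A => ?_
  have hsmul : pairMat b (c • x) A = c • pairMat b x A := by
    ext i j; simp [pairMat]
  rw [hsmul, opNorm_smul, mul_assoc]
  exact mul_le_mul_of_nonneg_left (opNorm_pairMat_le hb x A) (norm_nonneg c)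

theorem dualNorms_directSum_le (hb : PairingBounded b N) {l m : ℕ}
    (x : Matrix (Fin l) (Fin l) V) (y : Matrix (Fin m) (Fin m) V) :
    dualNorms b N (l + m) (directSum x y) ≤ max (dualNorms b N l x) (dualNorms b N m y) := by
  refine dualNorms_le (le_max_of_le_left (dualNorms_nonneg b N x)) fun r A => ?_
  let e : Fin r × Fin (l + m) ≃ (Fin r × Fin l) ⊕ (Fin r × Fin m) :=
    ((Equiv.refl (Fin r)).prodCongr finSumFinEquiv.symm).trans
      (Equiv.prodSumDistrib (Fin r) (Fin l) (Fin m))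
  have h : pairMat b (directSum x y) A =
      (fromBlocks (pairMat b x A) 0 0 (pairMat b y A)).submatrix e e := by
    ext ⟨i, a⟩ ⟨j, c⟩
    obtain ⟨a, rfl⟩ := finSumFinEquiv.surjective a
    obtain ⟨c, rfl⟩ := finSumFinEquiv.surjective c
    rcases a with a | a <;> rcases c with c | c <;>
      simp [e, pairMat, directSum, -finSumFinEquiv_apply_left, -finSumFinEquiv_apply_right]
  rw [h, opNorm_submatrix_equiv, opNorm_fromBlocks, max_mul_of_nonneg _ _ (hb.nonneg r A)]
  exact max_le_max (opNorm_pairMat_le hb x A) (opNorm_pairMat_le hb y A)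

theorem isMatrixGauge_dualNorms (hb : PairingBounded b N) : IsMatrixGauge (dualNorms b N) where
  nonneg _ := dualNorms_nonneg b N
  smul_le _ := dualNorms_smul_le hb
  directSum_le _ _ := dualNorms_directSum_le hb

open scoped Kronecker in
theorem pairMat_tensorSandwich_flip_lsmul {ι k l m : Type} [Fintype ι] [DecidableEq ι] [Fintype l]
    [Fintype m] (α : Matrix k (l × m) ℂ) (x : Matrix l l V) (y : Matrix m m ℂ)
    (β : Matrix (l × m) k ℂ) (A : Matrix ι ι W) :
    pairMat b (tensorSandwich (LinearMap.lsmul ℂ V).flip α x y β) A =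
      ((1 : Matrix ι ι ℂ) ⊗ₖ α) *
        reindex (Equiv.prodAssoc ι l m) (Equiv.prodAssoc ι l m) (pairMat b x A ⊗ₖ y) *
        ((1 : Matrix ι ι ℂ) ⊗ₖ β) := by
  ext ⟨i, a⟩ ⟨j, c⟩
  simp only [pairMat, tensorSandwich, of_apply, mul_apply, Fintype.sum_prod_type (α₁ := ι),
    kroneckerMap_apply, one_apply, ite_mul, one_mul, zero_mul, mul_ite, mul_zero, reindex_apply,
    submatrix_apply, Finset.sum_ite_irrel, Finset.sum_const_zero, Finset.sum_ite_eq,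
    Finset.sum_ite_eq', Finset.mem_univ, if_true, map_sum, map_smul, LinearMap.sum_apply,
    LinearMap.smul_apply, smul_eq_mul, Equiv.prodAssoc_symm_apply, Finset.sum_mul,
    LinearMap.flip_apply, LinearMap.lsmul_apply]
  rw [Finset.sum_comm]
  exact Finset.sum_congr rfl fun _ _ => Finset.sum_congr rfl fun _ _ => by ring

theorem dualNorms_tensorSandwich_flip_lsmul_le (hb : PairingBounded b N) {k l m : ℕ}
    (α : Matrix (Fin k) (Fin l × Fin m) ℂ) (x : Matrix (Fin l) (Fin l) V)
    (y : Matrix (Fin m) (Fin m) ℂ) (β : Matrix (Fin l × Fin m) (Fin k) ℂ) :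
    dualNorms b N k (tensorSandwich (LinearMap.lsmul ℂ V).flip α x y β) ≤
      opNorm α * dualNorms b N l x * opNorm y * opNorm β := by
  have hx := dualNorms_nonneg b N x
  refine dualNorms_le (mul_nonneg (mul_nonneg (mul_nonneg (opNorm_nonneg _) hx)
    (opNorm_nonneg _)) (opNorm_nonneg _)) fun r A => ?_
  rw [pairMat_tensorSandwich_flip_lsmul]
  refine (opNorm_mul_mul_le (opNorm_one_kronecker_le α)
    ((opNorm_reindex _ _ _).trans_le ((opNorm_kronecker_le _ _).trans
      (mul_le_mul_of_nonneg_right (opNorm_pairMat_le hb x A) (opNorm_nonneg y))))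
    (opNorm_one_kronecker_le β)).trans_eq (by ring)

end Dual

section Proj

variable {V W U : Type*} [AddCommGroup V] [Module ℂ V] [AddCommGroup W] [Module ℂ W]
  [AddCommGroup U] [Module ℂ U] {b : V →ₗ[ℂ] W →ₗ[ℂ] U} {N : MatNorms V} {N' : MatNorms W} {k : ℕ}

theorem projNorms_tensorSandwich_le (b : V →ₗ[ℂ] W →ₗ[ℂ] U) (hN : ∀ l x, 0 ≤ N l x)
    (hN' : ∀ l x, 0 ≤ N' l x) {τ ι κ : Type} [Fintype τ] [Fintype ι] [Fintype κ] [DecidableEq τ]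
    [DecidableEq ι] [DecidableEq κ] {l m : ℕ} (e : τ ≃ Fin k) (f : ι ≃ Fin l) (g : κ ≃ Fin m)
    (α : Matrix τ (ι × κ) ℂ) (x : Matrix ι ι V) (y : Matrix κ κ W) (β : Matrix (ι × κ) τ ℂ) :
    projNorms b N N' k (reindex e e (tensorSandwich b α x y β)) ≤
      opNorm α * N l (reindex f f x) * N' m (reindex g g y) * opNorm β := by
  rw [← opNorm_reindex α e (f.prodCongr g), ← opNorm_reindex β (f.prodCongr g) e]
  refine csInf_le ⟨0, ?_⟩ ⟨l, m, _, _, _, _, fun r s => ?_, rfl⟩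
  · rintro _ ⟨l, m, α, x, y, β, -, rfl⟩
    exact mul_nonneg (mul_nonneg (mul_nonneg (opNorm_nonneg _) (hN _ _)) (hN' _ _))
      (opNorm_nonneg _)
  · rw [← tensorSandwich_reindex b e f g]
    rfl

/-- Every matrix over `U` is of the form that enters in the definition of `projNorms`, so that
`projNorms` is an infimum over a nonempty set. -/
def ProjSpanning (b : V →ₗ[ℂ] W →ₗ[ℂ] U) : Prop :=
  ∀ k (t : Matrix (Fin k) (Fin k) U), ∃ (l m : ℕ) (α : Matrix (Fin k) (Fin l × Fin m) ℂ)
    (x : Matrix (Fin l) (Fin l) V) (y : Matrix (Fin m) (Fin m) W)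
    (β : Matrix (Fin l × Fin m) (Fin k) ℂ), t = tensorSandwich b α x y β

theorem exists_of_projNorms_lt (hb : ProjSpanning b) {t : Matrix (Fin k) (Fin k) U} {C : ℝ}
    (h : projNorms b N N' k t < C) :
    ∃ (l m : ℕ) (α : Matrix (Fin k) (Fin l × Fin m) ℂ)
      (x : Matrix (Fin l) (Fin l) V) (y : Matrix (Fin m) (Fin m) W)
      (β : Matrix (Fin l × Fin m) (Fin k) ℂ), t = tensorSandwich b α x y β ∧
      opNorm α * N l x * N' m y * opNorm β < C := by
  obtain ⟨l, m, α, x, y, β, ht⟩ := hb k t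
  obtain ⟨_, ⟨l, m, α, x, y, β, ht, rfl⟩, hlt⟩ := exists_lt_of_csInf_lt
    (by exact ⟨_, l, m, α, x, y, β, fun r s => congr_fun₂ ht r s, rfl⟩) h
  exact ⟨l, m, α, x, y, β, Matrix.ext ht, hlt⟩

theorem projNorms_smul_le (hb : ProjSpanning b) (hN : ∀ l x, 0 ≤ N l x)
    (hN' : ∀ l x, 0 ≤ N' l x) (c : ℂ) (t : Matrix (Fin k) (Fin k) U) :
    projNorms b N N' k (c • t) ≤ ‖c‖ * projNorms b N N' k t := by
  refine le_mul_of_forall_gt fun C hC => ?_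
  obtain ⟨l, m, α, x, y, β, rfl, hlt⟩ := exists_of_projNorms_lt hb hC
  have hc : c • tensorSandwich b α x y β = tensorSandwich b (c • α) x y β := by
    simpa using (tensorSandwich_smul b c 1 1 1 α x y β).symm
  calc projNorms b N N' k (c • tensorSandwich b α x y β)
      ≤ opNorm (c • α) * N l x * N' m y * opNorm β := by
        rw [hc]
        exact projNorms_tensorSandwich_le b hN hN' (Equiv.refl _) (Equiv.refl _) (Equiv.refl _) ..
    _ = ‖c‖ * (opNorm α * N l x * N' m y * opNorm β) := by rw [opNorm_smul]; ring
    _ ≤ ‖c‖ * C := mul_le_mul_of_nonneg_left hlt.le (norm_nonneg c)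

theorem exists_add_mul_lt {a b c d C : ℝ} (h : a * b * c * d < C) :
    ∃ δ : ℝ, 0 < δ ∧ (a + δ) * (b + δ) * (c + δ) * (d + δ) < C := by
  have hcont : Continuous fun δ : ℝ => (a + δ) * (b + δ) * (c + δ) * (d + δ) := by fun_prop
  have hlim := (hcont.tendsto 0).mono_left (nhdsWithin_le_nhds (s := Set.Ioi 0))
  simp only [add_zero] at hlim
  obtain ⟨δ, hδ, hδ'⟩ := ((hlim.eventually (gt_mem_nhds h)).and self_mem_nhdsWithin).exists
  exact ⟨δ, hδ', hδ⟩

theorem exists_rescaling {a p q d C : ℝ} (ha : 0 ≤ a) (hp : 0 ≤ p) (hq : 0 ≤ q) (hd : 0 ≤ d)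
    (h : a * p * q * d < C) : ∃ u v w z : ℝ, 0 < u ∧ 0 < v ∧ 0 < w ∧ 0 < z ∧ u * v * w * z = 1 ∧
      (u * a) ^ 2 ≤ C ∧ v * p ≤ 1 ∧ w * q ≤ 1 ∧ (z * d) ^ 2 ≤ C := by
  have hC : 0 < C := (by positivity : 0 ≤ a * p * q * d).trans_lt h
  obtain ⟨δ, hδ, hlt⟩ := exists_add_mul_lt h
  have hsC : 0 < √C := Real.sqrt_pos.2 hC
  refine ⟨√C / (a + δ), (p + δ)⁻¹, (q + δ)⁻¹, (a + δ) * (p + δ) * (q + δ) / √C, by positivity,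
    by positivity, by positivity, by positivity, by field_simp, ?_, ?_, ?_, ?_⟩
  · calc (√C / (a + δ) * a) ^ 2 ≤ (√C / (a + δ) * (a + δ)) ^ 2 := by gcongr; linarith
      _ = C := by rw [div_mul_cancel₀ _ (by positivity), Real.sq_sqrt hC.le]
  · rw [inv_mul_le_iff₀ (by positivity)]
    linarith
  · rw [inv_mul_le_iff₀ (by positivity)]
    linarith
  · refine (pow_le_pow_left₀ (by positivity) ?_ 2).trans_eq (Real.sq_sqrt hC.le)
    rw [div_mul_eq_mul_div, div_le_iff₀ hsC, Real.mul_self_sqrt hC.le]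
    calc (a + δ) * (p + δ) * (q + δ) * d ≤ (a + δ) * (p + δ) * (q + δ) * (d + δ) := by
          gcongr; linarith
      _ ≤ C := hlt.le

theorem exists_normalized_of_projNorms_lt (hb : ProjSpanning b) (hN : IsMatrixGauge N)
    (hN' : IsMatrixGauge N') {t : Matrix (Fin k) (Fin k) U} {C : ℝ}
    (h : projNorms b N N' k t < C) :
    ∃ (l m : ℕ) (α : Matrix (Fin k) (Fin l × Fin m) ℂ)
      (x : Matrix (Fin l) (Fin l) V) (y : Matrix (Fin m) (Fin m) W)
      (β : Matrix (Fin l × Fin m) (Fin k) ℂ), t = tensorSandwich b α x y β ∧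
      opNorm α ^ 2 ≤ C ∧ N l x ≤ 1 ∧ N' m y ≤ 1 ∧ opNorm β ^ 2 ≤ C := by
  obtain ⟨l, m, α, x, y, β, rfl, hlt⟩ := exists_of_projNorms_lt hb h
  obtain ⟨u, v, w, z, hu, hv, hw, hz, huvwz, hα, hx, hy, hβ⟩ := exists_rescaling (opNorm_nonneg α)
    (hN.nonneg l x) (hN'.nonneg m y) (opNorm_nonneg β) hlt
  have hnorm {r : ℝ} (hr : 0 < r) : ‖(r : ℂ)‖ = r := Complex.norm_of_nonneg hr.le
  refine ⟨l, m, (u : ℂ) • α, (v : ℂ) • x, (w : ℂ) • y, (z : ℂ) • β, ?_, ?_, ?_, ?_, ?_⟩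
  · rw [tensorSandwich_smul, ← Complex.ofReal_mul, ← Complex.ofReal_mul, ← Complex.ofReal_mul,
      huvwz, Complex.ofReal_one, one_smul]
  · rwa [opNorm_smul, hnorm hu]
  · exact (hN.smul_le l v x).trans ((hnorm hv).symm ▸ hx)
  · exact (hN'.smul_le m w y).trans ((hnorm hw).symm ▸ hy)
  · rwa [opNorm_smul, hnorm hz]

/-- The row matrix over `(V ⊕ V') ⊗ (W ⊕ W')` with blocks `α` on `V ⊗ W` and `α'` on `V' ⊗ W'`,
zero on the mixed blocks. -/
def blockRow {τ ι ι' κ κ' : Type*} (α : Matrix τ (ι × κ) ℂ) (α' : Matrix τ (ι' × κ') ℂ) :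
    Matrix τ ((ι ⊕ ι') × (κ ⊕ κ')) ℂ :=
  of fun r a => match a with
    | (.inl i, .inl j) => α r (i, j)
    | (.inr i, .inr j) => α' r (i, j)
    | _ => 0

section BlockRow

variable {τ ι ι' κ κ' : Type*} [Fintype ι] [Fintype ι'] [Fintype κ] [Fintype κ']

theorem blockRow_mul_conjTranspose (α : Matrix τ (ι × κ) ℂ) (α' : Matrix τ (ι' × κ') ℂ) :
    blockRow α α' * (blockRow α α')ᴴ = α * αᴴ + α' * α'ᴴ := by
  ext i j
  simp [blockRow, mul_apply, Fintype.sum_prod_type]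

theorem tensorSandwich_blockRow (b : V →ₗ[ℂ] W →ₗ[ℂ] U) (α : Matrix τ (ι × κ) ℂ)
    (α' : Matrix τ (ι' × κ') ℂ) (x : Matrix ι ι V) (x' : Matrix ι' ι' V) (y : Matrix κ κ W)
    (y' : Matrix κ' κ' W) (β : Matrix (ι × κ) τ ℂ) (β' : Matrix (ι' × κ') τ ℂ) :
    tensorSandwich b (blockRow α α') (fromBlocks x 0 0 x') (fromBlocks y 0 0 y')
        (blockRow βᴴ β'ᴴ)ᴴ = tensorSandwich b α x y β + tensorSandwich b α' x' y' β' := by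
  ext r s
  simp [tensorSandwich, blockRow, Fintype.sum_prod_type]

end BlockRow

theorem opNorm_blockRow_sq_le {τ ι ι' κ κ' : Type} [Fintype τ] [Fintype ι] [Fintype ι'] [Fintype κ]
    [Fintype κ'] [DecidableEq ι] [DecidableEq ι'] [DecidableEq κ] [DecidableEq κ']
    (α : Matrix τ (ι × κ) ℂ) (α' : Matrix τ (ι' × κ') ℂ) :
    opNorm (blockRow α α') ^ 2 ≤ opNorm α ^ 2 + opNorm α' ^ 2 := by
  classical
  rw [← opNorm_mul_conjTranspose_self, blockRow_mul_conjTranspose]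
  refine (opNorm_add_le _ _).trans_eq ?_
  rw [opNorm_mul_conjTranspose_self, opNorm_mul_conjTranspose_self]

theorem projNorms_add_le (hb : ProjSpanning b) (hN : IsMatrixGauge N) (hN' : IsMatrixGauge N')
    (t t' : Matrix (Fin k) (Fin k) U) :
    projNorms b N N' k (t + t') ≤ projNorms b N N' k t + projNorms b N N' k t' := by
  refine le_of_forall_gt_imp_ge_of_dense fun D hD => ?_
  obtain ⟨C, C', hC, hC', rfl⟩ : ∃ C C', projNorms b N N' k t < C ∧ projNorms b N N' k t' < C' ∧
      C + C' = D :=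
    ⟨_, _, lt_add_of_pos_right _ (half_pos (sub_pos.2 hD)),
      lt_add_of_pos_right _ (half_pos (sub_pos.2 hD)), by ring⟩
  obtain ⟨l, m, α, x, y, β, rfl, hα, hx, hy, hβ⟩ := exists_normalized_of_projNorms_lt hb hN hN' hC
  obtain ⟨l', m', α', x', y', β', rfl, hα', hx', hy', hβ'⟩ :=
    exists_normalized_of_projNorms_lt hb hN hN' hC'
  have hA : opNorm (blockRow α α') ^ 2 ≤ C + C' :=
    (opNorm_blockRow_sq_le α α').trans (add_le_add hα hα')
  have hB : opNorm (blockRow βᴴ β'ᴴ)ᴴ ^ 2 ≤ C + C' := by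
    rw [opNorm_conjTranspose]
    refine (opNorm_blockRow_sq_le βᴴ β'ᴴ).trans ?_
    rw [opNorm_conjTranspose, opNorm_conjTranspose]
    exact add_le_add hβ hβ'
  have hX : N (l + l') (directSum x x') ≤ 1 := (hN.directSum_le l l' x x').trans (max_le hx hx')
  have hY : N' (m + m') (directSum y y') ≤ 1 := (hN'.directSum_le m m' y y').trans (max_le hy hy')
  have hA₀ := opNorm_nonneg (blockRow α α')
  have hB₀ := opNorm_nonneg (blockRow βᴴ β'ᴴ)ᴴ
  rw [← tensorSandwich_blockRow]
  calc _ ≤ opNorm (blockRow α α') * N (l + l') (directSum x x') * N' (m + m') (directSum y y') *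
        opNorm (blockRow βᴴ β'ᴴ)ᴴ :=
        projNorms_tensorSandwich_le b hN.nonneg hN'.nonneg (Equiv.refl _) finSumFinEquiv
          finSumFinEquiv ..
    _ ≤ opNorm (blockRow α α') * 1 * 1 * opNorm (blockRow βᴴ β'ᴴ)ᴴ := by
        gcongr
        exact hN'.nonneg _ _
    _ ≤ C + C' := by nlinarith [sq_nonneg (opNorm (blockRow α α') - opNorm (blockRow βᴴ β'ᴴ)ᴴ)]

end Proj

section Scalar

variable {V W : Type*} [AddCommGroup V] [Module ℂ V] [AddCommGroup W] [Module ℂ W]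

theorem eq_tensorSandwich_flip_lsmul {k : ℕ} (t : Matrix (Fin k) (Fin k) V) :
    t = tensorSandwich (LinearMap.lsmul ℂ V).flip
      ((1 : Matrix (Fin k) (Fin k) ℂ).submatrix id (Equiv.prodUnique (Fin k) (Fin 1))) t
      (of fun _ _ => (1 : ℂ))
      ((1 : Matrix (Fin k) (Fin k) ℂ).submatrix (Equiv.prodUnique (Fin k) (Fin 1)) id) := by
  ext r s
  simp [tensorSandwich, Fintype.sum_prod_type, one_apply, ite_smul]

theorem projSpanning_flip_lsmul : ProjSpanning (LinearMap.lsmul ℂ V).flip :=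
  fun k t => ⟨k, 1, _, t, _, _, eq_tensorSandwich_flip_lsmul t⟩

theorem projNorms_flip_lsmul_le {N : MatNorms V} (hN : IsMatrixGauge N) {k : ℕ}
    (t : Matrix (Fin k) (Fin k) V) :
    projNorms (LinearMap.lsmul ℂ V).flip N scalarNorms k t ≤ N k t := by
  let e : Fin k × Fin 1 ≃ Fin k := Equiv.prodUnique (Fin k) (Fin 1)
  have hα : opNorm ((1 : Matrix (Fin k) (Fin k) ℂ).submatrix id e) ≤ 1 :=
    opNorm_one_submatrix_le e.injective
  have hβ : opNorm ((1 : Matrix (Fin k) (Fin k) ℂ).submatrix e id) ≤ 1 :=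
    (opNorm_submatrix_le _ e.injective Function.injective_id).trans opNorm_one_le
  have hone : scalarNorms 1 (of fun _ _ => 1) = 1 := (opNorm_fin_one_const 1).trans norm_one
  have ht := hN.nonneg k t
  conv_lhs => rw [eq_tensorSandwich_flip_lsmul t]
  calc _ ≤ opNorm ((1 : Matrix (Fin k) (Fin k) ℂ).submatrix id e) * N k t *
        scalarNorms 1 (of fun _ _ => 1) * opNorm ((1 : Matrix (Fin k) (Fin k) ℂ).submatrix e id) :=
        projNorms_tensorSandwich_le _ hN.nonneg isOperatorSpace_scalarNorms.nonneg (Equiv.refl _)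
          (Equiv.refl _) (Equiv.refl _) ..
    _ ≤ 1 * N k t * 1 * 1 := by
        rw [hone]
        gcongr
        exact opNorm_nonneg _
    _ = N k t := by ring

theorem projNorms_flip_lsmul_dualNorms {b : V →ₗ[ℂ] W →ₗ[ℂ] ℂ} {N : MatNorms W}
    (hb : PairingBounded b N) :
    projNorms (LinearMap.lsmul ℂ V).flip (dualNorms b N) scalarNorms = dualNorms b N := by
  funext k t
  refine le_antisymm (projNorms_flip_lsmul_le (isMatrixGauge_dualNorms hb) t) ?_
  refine le_of_forall_gt_imp_ge_of_dense fun C hC => ?_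
  obtain ⟨l, n, α, x, y, β, rfl, hlt⟩ := exists_of_projNorms_lt projSpanning_flip_lsmul hC
  exact (dualNorms_tensorSandwich_flip_lsmul_le hb α x y β).trans hlt.le

end Scalar

section TracePairing

variable {n : ℕ}

theorem tracePairing_apply (B C : Matrix (Fin n) (Fin n) ℂ) :
    tracePairing n B C = ∑ p, ∑ q, B p q * C p q := by
  simp [tracePairing, trace, mul_apply]

theorem sInfty_scalarNorms (r : ℕ) (A : Matrix (Fin r) (Fin r) (Matrix (Fin n) (Fin n) ℂ)) :
    sInfty n scalarNorms r A = opNorm (comp (Fin r) (Fin r) (Fin n) (Fin n) ℂ A) :=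
  opNorm_reindex _ _ _

open scoped Kronecker in
theorem pairingBounded_tracePairing (n : ℕ) :
    PairingBounded (tracePairing n) (sInfty n scalarNorms) where
  nonneg r A := (sInfty_scalarNorms r A).symm ▸ opNorm_nonneg _
  exists_bound l x := by
    refine ⟨∑ p, ∑ q, opNorm (of fun a c => x a c p q), Finset.sum_nonneg fun p _ =>
      Finset.sum_nonneg fun q _ => opNorm_nonneg _, fun r A => ?_⟩
    have hsum : pairMat (tracePairing n) x A =
        ∑ p, ∑ q, (of fun i j => A i j p q) ⊗ₖ (of fun a c => x a c p q) := by
      ext i j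
      simp [pairMat, tracePairing_apply, Matrix.sum_apply, mul_comm]
    rw [hsum, Finset.sum_mul]
    refine (opNorm_sum_le _).trans (Finset.sum_le_sum fun p _ => ?_)
    rw [Finset.sum_mul]
    refine (opNorm_sum_le _).trans (Finset.sum_le_sum fun q _ =>
      (opNorm_kronecker_le _ _).trans ?_)
    rw [mul_comm, sInfty_scalarNorms]
    refine mul_le_mul_of_nonneg_left ?_ (opNorm_nonneg _)
    exact opNorm_submatrix_le (comp (Fin r) (Fin r) (Fin n) (Fin n) ℂ A) (e := fun i => (i, p))
      (f := fun i => (i, q)) (Prod.mk_left_injective p) (Prod.mk_left_injective q)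

theorem isMatrixGauge_sOne (n : ℕ) : IsMatrixGauge (sOne n) :=
  isMatrixGauge_dualNorms (pairingBounded_tracePairing n)

theorem opNorm_pairMat_tracePairing_le {ι L : Type} [Fintype ι] [Fintype L] [DecidableEq ι]
    [DecidableEq L] {l : ℕ} (f : L ≃ Fin l) (x : Matrix L L (Matrix (Fin n) (Fin n) ℂ))
    (A : Matrix ι ι (Matrix (Fin n) (Fin n) ℂ)) :
    opNorm (pairMat (tracePairing n) x A) ≤
      sOne n l (reindex f f x) * opNorm (comp ι ι (Fin n) (Fin n) ℂ A) := by
  let e := Fintype.equivFin ι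
  have h := opNorm_pairMat_le (pairingBounded_tracePairing n) (reindex f f x) (reindex e e A)
  rw [opNorm_pairMat_reindex, sInfty_scalarNorms] at h
  exact h.trans_eq (congrArg _ (opNorm_reindex (comp ι ι (Fin n) (Fin n) ℂ A)
    (e.prodCongr (Equiv.refl _)) (e.prodCongr (Equiv.refl _))))

theorem sOne_le {L : Type} [Fintype L] [DecidableEq L] {l : ℕ} (f : L ≃ Fin l)
    {x : Matrix L L (Matrix (Fin n) (Fin n) ℂ)} {C : ℝ} (hC : 0 ≤ C)
    (h : ∀ r (A : Matrix (Fin r) (Fin r) (Matrix (Fin n) (Fin n) ℂ)),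
      opNorm (pairMat (tracePairing n) x A) ≤
        C * opNorm (comp (Fin r) (Fin r) (Fin n) (Fin n) ℂ A)) :
    sOne n l (reindex f f x) ≤ C := by
  refine dualNorms_le hC fun r A => ?_
  rw [sInfty_scalarNorms]
  exact (opNorm_pairMat_reindex (b := tracePairing n) x A (Equiv.refl _) f).trans_le (h r A)

end TracePairing

section SumPairing

theorem ellInfty_nonneg (κ : Type) {E : Type*} {N : MatNorms E} (hN : ∀ r x, 0 ≤ N r x) {r : ℕ}
    (x : Matrix (Fin r) (Fin r) (κ → E)) : 0 ≤ ellInfty κ N r x :=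
  Real.iSup_nonneg fun _ => hN _ _

theorem le_ellInfty {κ : Type} [Finite κ] {E : Type*} (N : MatNorms E) {r : ℕ}
    (x : Matrix (Fin r) (Fin r) (κ → E)) (c : κ) :
    N r (x.map fun v => v c) ≤ ellInfty κ N r x :=
  le_ciSup (f := fun c => N r (x.map fun v => v c)) (Set.finite_range _).bddAbove c

variable {κ : Type} [Fintype κ]

theorem sumPairing_apply (b c : κ → ℂ) : sumPairing κ b c = ∑ i, b i * c i := rfl

open scoped Kronecker in
theorem pairingBounded_sumPairing (κ : Type) [Fintype κ] :
    PairingBounded (sumPairing κ) (ellInfty κ scalarNorms) where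
  nonneg r A := ellInfty_nonneg κ (fun _ _ => opNorm_nonneg _) A
  exists_bound l x := by
    refine ⟨∑ c, opNorm (of fun a d => x a d c), Finset.sum_nonneg fun p _ => opNorm_nonneg _,
      fun r A => ?_⟩
    have hsum : pairMat (sumPairing κ) x A =
        ∑ c, (A.map fun v => v c) ⊗ₖ (of fun a d => x a d c) := by
      ext i j
      simp [pairMat, sumPairing_apply, Matrix.sum_apply, mul_comm]
    rw [hsum, Finset.sum_mul]
    refine (opNorm_sum_le _).trans (Finset.sum_le_sum fun c _ =>
      (opNorm_kronecker_le _ _).trans ?_)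
    rw [mul_comm]
    exact mul_le_mul_of_nonneg_left (le_ellInfty scalarNorms A c) (opNorm_nonneg _)

theorem isMatrixGauge_ellOne (κ : Type) [Fintype κ] : IsMatrixGauge (ellOne κ) :=
  isMatrixGauge_dualNorms (pairingBounded_sumPairing κ)

theorem opNorm_pairMat_sumPairing_le {ι L : Type} [Fintype ι] [Fintype L] [DecidableEq ι]
    [DecidableEq L] {l : ℕ} (f : L ≃ Fin l) (x : Matrix L L (κ → ℂ))
    (A : Matrix ι ι (κ → ℂ)) {M : ℝ} (hM : 0 ≤ M)
    (hA : ∀ c, opNorm (A.map fun v => v c) ≤ M) :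
    opNorm (pairMat (sumPairing κ) x A) ≤ ellOne κ l (reindex f f x) * M := by
  let e := Fintype.equivFin ι
  have h := opNorm_pairMat_le (pairingBounded_sumPairing κ) (reindex f f x) (reindex e e A)
  rw [opNorm_pairMat_reindex] at h
  refine h.trans (mul_le_mul_of_nonneg_left ?_ (dualNorms_nonneg _ _ _))
  exact Real.iSup_le (fun c => (opNorm_reindex (A.map fun v => v c) e e).trans_le (hA c)) hM

theorem ellOne_le {L : Type} [Fintype L] [DecidableEq L] {l : ℕ} (f : L ≃ Fin l)
    {x : Matrix L L (κ → ℂ)} {C : ℝ} (hC : 0 ≤ C)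
    (h : ∀ r (A : Matrix (Fin r) (Fin r) (κ → ℂ)) (M : ℝ), 0 ≤ M →
      (∀ c, opNorm (A.map fun v => v c) ≤ M) → opNorm (pairMat (sumPairing κ) x A) ≤ C * M) :
    ellOne κ l (reindex f f x) ≤ C :=
  dualNorms_le hC fun r A =>
    (opNorm_pairMat_reindex (b := sumPairing κ) x A (Equiv.refl _) f).trans_le
      (h r A _
        (ellInfty_nonneg κ (fun _ _ => opNorm_nonneg _) A) fun c => le_ellInfty scalarNorms A c)

end SumPairing

section GraphRow

variable {τ ι ρ : Type*} [DecidableEq ρ]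

/-- The `0`-`1` matrix whose row `r` is the indicator of the graph of `u r`. -/
def graphRow (u : τ → ι → ρ) : Matrix τ (ι × ρ) ℂ :=
  of fun r a => if a.2 = u r a.1 then 1 else 0

theorem conjTranspose_graphRow_apply (u : τ → ι → ρ) (a : ι × ρ) (r : τ) :
    (graphRow u)ᴴ a r = if a.2 = u r a.1 then 1 else 0 := by
  simp [graphRow, apply_ite]

theorem tensorSandwich_graphRow [Fintype ι] [Fintype ρ] {V W U : Type*} [AddCommGroup V]
    [Module ℂ V] [AddCommGroup W] [Module ℂ W] [AddCommGroup U] [Module ℂ U]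
    (b : V →ₗ[ℂ] W →ₗ[ℂ] U) (u : τ → ι → ρ) (x : Matrix ι ι V) (y : Matrix ρ ρ W) (r s : τ) :
    tensorSandwich b (graphRow u) x y (graphRow u)ᴴ r s =
      ∑ i, ∑ j, b (x i j) (y (u r i) (u s j)) := by
  simp only [tensorSandwich, of_apply, conjTranspose_graphRow_apply, Fintype.sum_prod_type]
  simp [graphRow]

end GraphRow

section Representation

theorem projSpanning_of_exists {V W U : Type*} [AddCommGroup V] [Module ℂ V] [AddCommGroup W]
    [Module ℂ W] [AddCommGroup U] [Module ℂ U] {b : V →ₗ[ℂ] W →ₗ[ℂ] U}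
    (h : ∀ k (t : Matrix (Fin k) (Fin k) U), ∃ (ι κ : Type) (_ : Fintype ι) (_ : Fintype κ)
      (α : Matrix (Fin k) (ι × κ) ℂ) (x : Matrix ι ι V) (y : Matrix κ κ W)
      (β : Matrix (ι × κ) (Fin k) ℂ), t = tensorSandwich b α x y β) : ProjSpanning b := by
  intro k t
  obtain ⟨ι, κ, _, _, α, x, y, β, rfl⟩ := h k t
  exact ⟨_, _, _, _, _, _, (tensorSandwich_reindex b (Equiv.refl _) (Fintype.equivFin ι)
    (Fintype.equivFin κ) α x y β).symm⟩

variable {E : Type*} [AddCommGroup E] [Module ℂ E] {n k : ℕ} {κ : Type} [Fintype κ]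

theorem eq_tensorSandwich_matTensor (t : Matrix (Fin k) (Fin k) (Matrix (Fin n) (Fin n) E)) :
    t = tensorSandwich (matTensor n E) (graphRow Prod.mk) (of fun i j => single i j 1)
      (comp (Fin k) (Fin k) (Fin n) (Fin n) E t) (graphRow Prod.mk)ᴴ := by
  ext r s a b
  simp [tensorSandwich_graphRow, matTensor, Matrix.sum_apply, single_apply, ite_and, ite_smul]

theorem eq_tensorSandwich_piTensor [DecidableEq κ] (t : Matrix (Fin k) (Fin k) (κ → E)) :
    t = tensorSandwich (piTensor κ E) (graphRow fun r i => (i, r))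
      (diagonal fun d => Pi.single d 1) (of fun a b => t a.2 b.2 a.1)
      (graphRow fun r i => (i, r))ᴴ := by
  ext r s c
  rw [tensorSandwich_graphRow]
  have hdiag : ∀ i, ∑ j, piTensor κ E ((diagonal fun d => Pi.single d 1 : Matrix κ κ (κ → ℂ)) i j)
      (t r s i) = piTensor κ E (Pi.single i 1) (t r s i) := fun i => by
    rw [Finset.sum_eq_single i (fun j _ hj => by rw [diagonal_apply_ne' _ hj, map_zero,
      LinearMap.zero_apply]) (by simp), diagonal_apply_eq]
  simp only [of_apply, hdiag]
  simp [piTensor, Pi.single_apply, Finset.sum_apply, ite_smul]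

theorem projSpanning_matTensor (n : ℕ) (E : Type*) [AddCommGroup E] [Module ℂ E] :
    ProjSpanning (matTensor n E) :=
  projSpanning_of_exists fun _ t => ⟨_, _, _, _, _, _, _, _, eq_tensorSandwich_matTensor t⟩

theorem projSpanning_piTensor (κ : Type) [Finite κ] (E : Type*) [AddCommGroup E] [Module ℂ E] :
    ProjSpanning (piTensor κ E) := by
  classical
  have := Fintype.ofFinite κ
  exact projSpanning_of_exists fun _ t => ⟨_, _, _, _, _, _, _, _, eq_tensorSandwich_piTensor t⟩

theorem opNorm_graphRow_mk_sq_le (n k : ℕ) :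
    opNorm (graphRow (Prod.mk : Fin k → Fin n → Fin k × Fin n)) ^ 2 ≤ n := by
  have h : graphRow (Prod.mk : Fin k → Fin n → Fin k × Fin n) *
      (graphRow (Prod.mk : Fin k → Fin n → Fin k × Fin n))ᴴ = (n : ℂ) • (1 : Matrix _ _ ℂ) := by
    ext r s
    simp [mul_apply, graphRow, Fintype.sum_prod_type (α₁ := Fin n), one_apply, @eq_comm _ s r]
  rw [← opNorm_mul_conjTranspose_self, h, opNorm_smul, Complex.norm_natCast]
  exact mul_le_of_le_one_right (Nat.cast_nonneg n) opNorm_one_le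

theorem sOne_single_le_one (n : ℕ) : sOne n n (of fun i j => single i j 1) ≤ 1 := by
  refine sOne_le (Equiv.refl (Fin n)) zero_le_one fun r A => le_of_eq ?_
  rw [one_mul]
  congr 1
  ext i j
  simp [pairMat, tracePairing_apply, single_apply, ite_and]

theorem projNorms_matTensor_le_sInfty {N : MatNorms E} (hN : ∀ l x, 0 ≤ N l x)
    (t : Matrix (Fin k) (Fin k) (Matrix (Fin n) (Fin n) E)) :
    projNorms (matTensor n E) (sOne n) N k t ≤ n * sInfty n N k t := by
  set α : Matrix (Fin k) (Fin n × (Fin k × Fin n)) ℂ := graphRow Prod.mk with hα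
  have hα₀ := opNorm_nonneg α
  have ht₀ : 0 ≤ sInfty n N k t := hN _ _
  conv_lhs => rw [eq_tensorSandwich_matTensor t, ← hα]
  calc _ ≤ opNorm α * sOne n n (of fun i j => single i j 1) * sInfty n N k t * opNorm αᴴ :=
        projNorms_tensorSandwich_le _ (isMatrixGauge_sOne n).nonneg hN (Equiv.refl _) (Equiv.refl _)
          finProdFinEquiv ..
    _ ≤ opNorm α * 1 * sInfty n N k t * opNorm α := by
        rw [opNorm_conjTranspose]
        gcongr
        exact sOne_single_le_one n
    _ = opNorm α ^ 2 * sInfty n N k t := by ring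
    _ ≤ n * sInfty n N k t := mul_le_mul_of_nonneg_right (opNorm_graphRow_mk_sq_le n k) ht₀

end Representation

section Twirl

variable {n : ℕ} {κ : Type}

section Defs

variable (T : κ → Matrix (Fin n) (Fin n) ℂ) (E : Type*) [AddCommGroup E] [Module ℂ E]

/-- The map `x ↦ ∑_c T_c x T_c^* ⊗ e_c` on `M_n ⊗ E`, of which the teleportation embedding `J` is
a multiple. -/
def twirl : Matrix (Fin n) (Fin n) E →ₗ[ℂ] Matrix (Fin n) (Fin n) (κ → E) where
  toFun x := of fun i j c => ∑ a, ∑ b, (T c i a * star (T c j b)) • x a b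
  map_add' x y := by ext i j c; simp [Finset.sum_add_distrib]
  map_smul' r x := by
    ext i j c
    simp only [Matrix.smul_apply, Pi.smul_apply, of_apply, RingHom.id_apply, Finset.smul_sum,
      smul_comm r]

/-- The map `y ↦ ∑_c T_c^* y_c T_c` on `M_n ⊗ ℂ^κ ⊗ E`, of which the left inverse `W` of `J` is
a multiple. -/
def untwirl [Fintype κ] : Matrix (Fin n) (Fin n) (κ → E) →ₗ[ℂ] Matrix (Fin n) (Fin n) E where
  toFun y := of fun i j => ∑ c, ∑ a, ∑ b, (star (T c a i) * T c b j) • y a b c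
  map_add' x y := by ext i j; simp [Finset.sum_add_distrib]
  map_smul' r x := by
    ext i j
    simp only [Matrix.smul_apply, Pi.smul_apply, of_apply, RingHom.id_apply, Finset.smul_sum,
      smul_comm r]

/-- The map `untwirl` as a bilinear map of a matrix in `M_n` and a vector in `E^κ`. -/
def untwirlTensor [Fintype κ] :
    Matrix (Fin n) (Fin n) ℂ →ₗ[ℂ] (κ → E) →ₗ[ℂ] Matrix (Fin n) (Fin n) E :=
  (matTensor n (κ → E)).compr₂ (untwirl T E)

end Defs

section Algebra

variable {T : κ → Matrix (Fin n) (Fin n) ℂ} {E : Type*} [AddCommGroup E] [Module ℂ E]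

theorem matTensor_single (i j : Fin n) (e : E) :
    matTensor n E (single i j 1) e = single i j e := by
  ext a b
  simp [matTensor, single_apply]

theorem twirl_complex_apply (X : Matrix (Fin n) (Fin n) ℂ) (i j : Fin n) (c : κ) :
    twirl T ℂ X i j c = (T c * X * (T c)ᴴ) i j := by
  simp only [twirl, LinearMap.coe_mk, AddHom.coe_mk, of_apply, mul_apply, conjTranspose_apply,
    Finset.sum_mul, smul_eq_mul, mul_right_comm]
  exact Finset.sum_comm

theorem twirl_matTensor (X : Matrix (Fin n) (Fin n) ℂ) (e : E) (i j : Fin n) :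
    twirl T E (matTensor n E X e) i j = piTensor κ E (twirl T ℂ X i j) e := by
  ext c
  simp [twirl, matTensor, piTensor, smul_smul, Finset.sum_smul]

variable [Fintype κ]

theorem untwirlTensor_apply (X : Matrix (Fin n) (Fin n) ℂ) (v : κ → E) (i j : Fin n) :
    untwirlTensor T E X v i j = ∑ c, ((T c)ᴴ * X * T c) i j • v c := by
  simp only [untwirlTensor, LinearMap.compr₂_apply, untwirl, matTensor, LinearMap.coe_mk,
    AddHom.coe_mk, LinearMap.mk₂_apply, of_apply, mul_apply, conjTranspose_apply, Finset.sum_mul,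
    Finset.sum_smul, Pi.smul_apply, smul_smul, mul_right_comm]
  exact Finset.sum_congr rfl fun c _ => Finset.sum_comm

theorem untwirlTensor_complex (X : Matrix (Fin n) (Fin n) ℂ) (b : κ → ℂ) :
    untwirlTensor T ℂ X b = ∑ c, b c • ((T c)ᴴ * X * T c) := by
  ext i j
  simp [untwirlTensor_apply, Matrix.sum_apply, mul_comm]

theorem untwirlTensor_piTensor (X : Matrix (Fin n) (Fin n) ℂ) (b : κ → ℂ) (e : E) :
    untwirlTensor T E X (piTensor κ E b e) = matTensor n E (untwirlTensor T ℂ X b) e := by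
  ext i j
  simp [untwirlTensor_apply, matTensor, piTensor, smul_smul, Finset.sum_smul]

end Algebra

/-- Unitary matrices which are pairwise orthogonal with respect to the trace. -/
structure IsUnitaryFamily [DecidableEq κ] (T : κ → Matrix (Fin n) (Fin n) ℂ) : Prop where
  conjTranspose_mul : ∀ c, (T c)ᴴ * T c = 1
  trace_eq : ∀ c d, ((T c)ᴴ * T d).trace = if c = d then (n : ℂ) else 0

namespace IsUnitaryFamily

variable [DecidableEq κ] {T : κ → Matrix (Fin n) (Fin n) ℂ}

theorem mul_conjTranspose (hT : IsUnitaryFamily T) (c : κ) : T c * (T c)ᴴ = 1 :=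
  mul_eq_one_comm.1 (hT.conjTranspose_mul c)

theorem conjTranspose (hT : IsUnitaryFamily T) : IsUnitaryFamily fun c => (T c)ᴴ where
  conjTranspose_mul c := by rw [conjTranspose_conjTranspose]; exact hT.mul_conjTranspose c
  trace_eq c d := by
    rw [conjTranspose_conjTranspose, trace_mul_comm, hT.trace_eq]
    simp only [eq_comm]

theorem opNorm_le_one (hT : IsUnitaryFamily T) (c : κ) : opNorm (T c) ≤ 1 :=
  opNorm_le_one_of_conjTranspose_mul_self (hT.conjTranspose_mul c)

theorem opNorm_transpose_le_one (hT : IsUnitaryFamily T) (c : κ) : opNorm (T c)ᵀ ≤ 1 :=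
  opNorm_le_one_of_conjTranspose_mul_self <| by
    rw [conjTranspose_transpose_eq_transpose_conjTranspose, ← transpose_mul,
      hT.mul_conjTranspose, transpose_one]

open scoped Kronecker in
theorem opNorm_comp_conj_le (hT : IsUnitaryFamily T) (c : κ) {r : ℕ}
    (A : Matrix (Fin r) (Fin r) (Matrix (Fin n) (Fin n) ℂ)) :
    opNorm (comp (Fin r) (Fin r) (Fin n) (Fin n) ℂ
      (A.map fun X => (T c)ᴴᵀ * X * (T c)ᵀ)) ≤
        opNorm (comp (Fin r) (Fin r) (Fin n) (Fin n) ℂ A) := by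
  have h : comp (Fin r) (Fin r) (Fin n) (Fin n) ℂ (A.map fun X => (T c)ᴴᵀ * X * (T c)ᵀ) =
      ((1 : Matrix (Fin r) (Fin r) ℂ) ⊗ₖ (T c)ᴴᵀ) * comp (Fin r) (Fin r) (Fin n) (Fin n) ℂ A *
        ((1 : Matrix (Fin r) (Fin r) ℂ) ⊗ₖ (T c)ᵀ) := by
    ext ⟨i, p⟩ ⟨j, q⟩
    simp [mul_apply, Fintype.sum_prod_type, one_apply, Finset.sum_ite_irrel]
  rw [h]
  refine (opNorm_mul_mul_le
    ((opNorm_one_kronecker_le _).trans (hT.conjTranspose.opNorm_transpose_le_one c)) le_rfl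
    ((opNorm_one_kronecker_le _).trans (hT.opNorm_transpose_le_one c))).trans_eq ?_
  rw [one_mul, mul_one]

variable [Fintype κ] {E : Type*} [AddCommGroup E] [Module ℂ E]

theorem untwirl_twirl_matTensor (hT : IsUnitaryFamily T) (X : Matrix (Fin n) (Fin n) ℂ) (e : E) :
    untwirl T E (twirl T E (matTensor n E X e)) = (Fintype.card κ : ℂ) • matTensor n E X e := by
  have hsplit : twirl T E (matTensor n E X e) =
      ∑ c, matTensor n (κ → E) (T c * X * (T c)ᴴ) (Pi.single c e) := by
    ext i j d
    rw [twirl_matTensor]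
    simp [matTensor, piTensor, twirl_complex_apply, Matrix.sum_apply, Pi.single_apply]
  have hunitary (c : κ) : (T c)ᴴ * (T c * X * (T c)ᴴ) * T c = X := by
    rw [Matrix.mul_assoc (T c), ← Matrix.mul_assoc, hT.conjTranspose_mul, Matrix.one_mul,
      Matrix.mul_assoc, hT.conjTranspose_mul, Matrix.mul_one]
  have hterm (c : κ) : untwirlTensor T E (T c * X * (T c)ᴴ) (Pi.single c e) =
      matTensor n E X e := by
    ext i j
    rw [untwirlTensor_apply, Finset.sum_eq_single c (fun d _ hd => by simp [hd]) (by simp),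
      hunitary, Pi.single_eq_same]
    rfl
  rw [hsplit, map_sum, ← Finset.card_univ, Nat.cast_smul_eq_nsmul, ← Finset.sum_const]
  exact Finset.sum_congr rfl fun c _ => hterm c

theorem untwirl_twirl (hT : IsUnitaryFamily T) (x : Matrix (Fin n) (Fin n) E) :
    untwirl T E (twirl T E x) = (Fintype.card κ : ℂ) • x := by
  suffices h : untwirl T E ∘ₗ twirl T E = (Fintype.card κ : ℂ) • LinearMap.id from
    congr($h x)
  refine Matrix.ext_linearMap _ fun a b => LinearMap.ext fun e => ?_
  have h := hT.untwirl_twirl_matTensor (single a b 1) e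
  rwa [matTensor_single] at h

end IsUnitaryFamily

end Twirl

section TwirlEstimates

open scoped Kronecker

variable {n : ℕ} {κ : Type} {T : κ → Matrix (Fin n) (Fin n) ℂ}

/-- The matrix whose columns are the matrices `T c`, written as vectors of length `n²`. -/
def vecMatrix (T : κ → Matrix (Fin n) (Fin n) ℂ) : Matrix (Fin n × Fin n) κ ℂ :=
  of fun i c => T c i.1 i.2

theorem tracePairing_conj (U X A : Matrix (Fin n) (Fin n) ℂ) :
    tracePairing n (Uᴴ * X * U) A = tracePairing n X (Uᴴᵀ * A * Uᵀ) := by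
  simp only [tracePairing, LinearMap.mk₂_apply, transpose_mul, transpose_transpose]
  rw [Matrix.mul_assoc Uᴴ, Matrix.mul_assoc Uᴴ, trace_mul_comm]
  simp only [Matrix.mul_assoc]

variable [Fintype κ]

/-- The adjoint of `twirl` with respect to the pairings `tracePairing` and `sumPairing`:
`a ↦ ∑_c a_c (T_c)_{ip} conj (T_c)_{jq}`, amplified to matrices over `ℂ^κ`. -/
def dualTwirl (T : κ → Matrix (Fin n) (Fin n) ℂ) {ρ : Type} (A : Matrix ρ ρ (κ → ℂ)) :
    Matrix (ρ × Fin n) (ρ × Fin n) (Matrix (Fin n) (Fin n) ℂ) :=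
  of fun u v => of fun p q => ∑ c, T c u.2 p * star (T c v.2 q) * A u.1 v.1 c

theorem pairMat_twirl {L ρ : Type} (x : Matrix L L (Matrix (Fin n) (Fin n) ℂ))
    (A : Matrix ρ ρ (κ → ℂ)) :
    pairMat (sumPairing κ) (comp L L (Fin n) (Fin n) (κ → ℂ) (x.map (twirl T ℂ))) A =
      (pairMat (tracePairing n) x (dualTwirl T A)).submatrix
        (fun u : ρ × (L × Fin n) => ((u.1, u.2.2), u.2.1)) fun u => ((u.1, u.2.2), u.2.1) := by
  ext u v
  simp only [pairMat, of_apply, submatrix_apply, sumPairing_apply, tracePairing_apply, dualTwirl,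
    comp_apply, map_apply, twirl, LinearMap.coe_mk, AddHom.coe_mk, Finset.sum_mul, Finset.mul_sum,
    smul_eq_mul]
  rw [Finset.sum_comm]
  refine Finset.sum_congr rfl fun p _ => ?_
  rw [Finset.sum_comm]
  exact Finset.sum_congr rfl fun q _ => Finset.sum_congr rfl fun c _ => by ring

variable [DecidableEq κ]

theorem comp_dualTwirl {ρ : Type} [Fintype ρ] [DecidableEq ρ] (A : Matrix ρ ρ (κ → ℂ)) :
    comp (ρ × Fin n) (ρ × Fin n) (Fin n) (Fin n) ℂ (dualTwirl T A) =
      reindex (Equiv.prodAssoc ρ (Fin n) (Fin n)).symm (Equiv.prodAssoc ρ (Fin n) (Fin n)).symm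
        (((1 : Matrix ρ ρ ℂ) ⊗ₖ vecMatrix T) * blockDiagonal (fun c => A.map fun v => v c) *
          ((1 : Matrix ρ ρ ℂ) ⊗ₖ (vecMatrix T)ᴴ)) := by
  ext ⟨⟨r, i⟩, p⟩ ⟨⟨s, j⟩, q⟩
  simp [dualTwirl, vecMatrix, mul_apply, Fintype.sum_prod_type, blockDiagonal_apply, one_apply,
    mul_right_comm]

namespace IsUnitaryFamily

theorem opNorm_vecMatrix_sq_le (hT : IsUnitaryFamily T) : opNorm (vecMatrix T) ^ 2 ≤ n := by
  have h : (vecMatrix T)ᴴ * vecMatrix T = (n : ℂ) • 1 := by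
    ext c d
    have htrace := hT.trace_eq c d
    simp only [trace, diag_apply, mul_apply, conjTranspose_apply] at htrace
    rw [Finset.sum_comm] at htrace
    simpa [mul_apply, vecMatrix, Fintype.sum_prod_type, one_apply] using htrace
  rw [← opNorm_conjTranspose_mul_self, h, opNorm_smul, Complex.norm_natCast]
  exact mul_le_of_le_one_right (Nat.cast_nonneg n) opNorm_one_le

theorem opNorm_dualTwirl_le (hT : IsUnitaryFamily T) {ρ : Type} [Fintype ρ] [DecidableEq ρ]
    {A : Matrix ρ ρ (κ → ℂ)} {M : ℝ} (hM : 0 ≤ M) (hA : ∀ c, opNorm (A.map fun v => v c) ≤ M) :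
    opNorm (comp (ρ × Fin n) (ρ × Fin n) (Fin n) (Fin n) ℂ (dualTwirl T A)) ≤ n * M := by
  rw [comp_dualTwirl, opNorm_reindex]
  calc _ ≤ opNorm (vecMatrix T) * M * opNorm (vecMatrix T)ᴴ :=
        opNorm_mul_mul_le (opNorm_one_kronecker_le _) (opNorm_blockDiagonal_le hM hA)
          (opNorm_one_kronecker_le _)
    _ = opNorm (vecMatrix T) ^ 2 * M := by rw [opNorm_conjTranspose]; ring
    _ ≤ n * M := mul_le_mul_of_nonneg_right hT.opNorm_vecMatrix_sq_le hM

theorem opNorm_pairMat_twirl_le (hT : IsUnitaryFamily T) {L ρ : Type} [Fintype L] [DecidableEq L]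
    [Fintype ρ] [DecidableEq ρ] {l : ℕ} (f : L ≃ Fin l)
    (x : Matrix L L (Matrix (Fin n) (Fin n) ℂ)) {A : Matrix ρ ρ (κ → ℂ)} {M : ℝ} (hM : 0 ≤ M)
    (hA : ∀ c, opNorm (A.map fun v => v c) ≤ M) :
    opNorm (pairMat (sumPairing κ) (comp L L (Fin n) (Fin n) (κ → ℂ) (x.map (twirl T ℂ))) A) ≤
      n * sOne n l (reindex f f x) * M := by
  let e : ρ × (L × Fin n) ≃ (ρ × Fin n) × L :=
    ((Equiv.refl ρ).prodCongr (Equiv.prodComm L (Fin n))).trans (Equiv.prodAssoc ρ (Fin n) L).symm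
  rw [pairMat_twirl]
  calc _ = opNorm (pairMat (tracePairing n) x (dualTwirl T A)) := opNorm_submatrix_equiv _ e e
    _ ≤ sOne n l (reindex f f x) * (n * M) :=
        (opNorm_pairMat_tracePairing_le f x _).trans
          (mul_le_mul_of_nonneg_left (hT.opNorm_dualTwirl_le hM hA) (dualNorms_nonneg _ _ _))
    _ = n * sOne n l (reindex f f x) * M := by ring

theorem ellOne_twirl_le (hT : IsUnitaryFamily T) {l : ℕ}
    (x : Matrix (Fin l) (Fin l) (Matrix (Fin n) (Fin n) ℂ)) :
    ellOne κ (l * n) (reindex finProdFinEquiv finProdFinEquiv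
      (comp (Fin l) (Fin l) (Fin n) (Fin n) (κ → ℂ) (x.map (twirl T ℂ)))) ≤ n * sOne n l x :=
  ellOne_le finProdFinEquiv (mul_nonneg (Nat.cast_nonneg n) (dualNorms_nonneg _ _ _))
    fun _ _ _ hM hA => hT.opNorm_pairMat_twirl_le (Equiv.refl (Fin l)) x hM hA

end IsUnitaryFamily

theorem IsUnitaryFamily.sOne_untwirlTensor_le (hT : IsUnitaryFamily T) {l l' : ℕ}
    (x : Matrix (Fin l) (Fin l) (Matrix (Fin n) (Fin n) ℂ)) (b : Matrix (Fin l') (Fin l') (κ → ℂ)) :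
    sOne n (l * l') (reindex finProdFinEquiv finProdFinEquiv
      (of fun a d => untwirlTensor T ℂ (x a.1 d.1) (b a.2 d.2))) ≤ sOne n l x * ellOne κ l' b := by
  have hx : 0 ≤ sOne n l x := dualNorms_nonneg _ _ _
  refine sOne_le finProdFinEquiv (mul_nonneg hx (dualNorms_nonneg _ _ _)) fun r A => ?_
  let B : Matrix (Fin r × Fin l) (Fin r × Fin l) (κ → ℂ) := of fun u v c =>
    pairMat (tracePairing n) x (A.map fun X => (T c)ᴴᵀ * X * (T c)ᵀ) u v
  have hB (c : κ) : opNorm (B.map fun v => v c) ≤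
      sOne n l x * opNorm (comp (Fin r) (Fin r) (Fin n) (Fin n) ℂ A) :=
    (opNorm_pairMat_tracePairing_le (Equiv.refl (Fin l)) x
      (A.map fun X => (T c)ᴴᵀ * X * (T c)ᵀ)).trans
        (mul_le_mul_of_nonneg_left (hT.opNorm_comp_conj_le c A) hx)
  have hpair : pairMat (tracePairing n)
      (of fun a d : Fin l × Fin l' => untwirlTensor T ℂ (x a.1 d.1) (b a.2 d.2)) A =
      reindex (Equiv.prodAssoc _ _ _) (Equiv.prodAssoc _ _ _) (pairMat (sumPairing κ) b B) := by
    ext ⟨i, a, a'⟩ ⟨j, d, d'⟩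
    simp [pairMat, untwirlTensor_complex, sumPairing_apply, tracePairing_conj, B]
  rw [hpair, opNorm_reindex]
  calc _ ≤ ellOne κ l' b * (sOne n l x * opNorm (comp (Fin r) (Fin r) (Fin n) (Fin n) ℂ A)) :=
        opNorm_pairMat_sumPairing_le (Equiv.refl (Fin l')) b B
          (mul_nonneg hx (opNorm_nonneg _)) hB
    _ = _ := by ring

end TwirlEstimates

section TensorSandwich

open scoped Kronecker

/-- The exchange of the last two factors of a triple product, which moves the index of an inner
matrix past the index of the second tensor factor. -/
def prodRightComm (α β γ : Type*) : (α × β) × γ ≃ (α × γ) × β where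
  toFun a := ((a.1.1, a.2), a.1.2)
  invFun a := ((a.1.1, a.2), a.1.2)

variable {V V' W W' U U' τ ι ι' κ κ' : Type*} [AddCommGroup V] [Module ℂ V] [AddCommGroup W]
  [Module ℂ W] [AddCommGroup U] [Module ℂ U] [AddCommGroup V'] [Module ℂ V'] [AddCommGroup U']
  [Module ℂ U'] [AddCommGroup W'] [Module ℂ W'] [Fintype ι] [Fintype κ]

theorem comp_map_tensorSandwich {ν : Type*} [Fintype ν] [DecidableEq ν] {b : V →ₗ[ℂ] W →ₗ[ℂ] U}
    {b' : V' →ₗ[ℂ] W →ₗ[ℂ] U'} {f : U →ₗ[ℂ] Matrix ν ν U'} {g : V → Matrix ν ν V'}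
    (h : ∀ v w i j, f (b v w) i j = b' (g v i j) w) (α : Matrix τ (ι × κ) ℂ) (x : Matrix ι ι V)
    (y : Matrix κ κ W) (β : Matrix (ι × κ) τ ℂ) :
    comp τ τ ν ν U' ((tensorSandwich b α x y β).map f) =
      tensorSandwich b' ((α ⊗ₖ (1 : Matrix ν ν ℂ)).submatrix id (prodRightComm ι ν κ))
        (comp ι ι ν ν V' (x.map g)) y
        ((β ⊗ₖ (1 : Matrix ν ν ℂ)).submatrix (prodRightComm ι ν κ) id) := by
  ext ⟨r, i⟩ ⟨s, j⟩
  simp [tensorSandwich, Fintype.sum_prod_type, one_apply, Matrix.sum_apply, h, ite_smul,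
    prodRightComm, Finset.sum_ite_irrel]

theorem sum_mul_one_kronecker_smul [Fintype ι'] [DecidableEq ι] (α : Matrix τ (ι × κ) ℂ)
    (α' : Matrix κ ι' ℂ) (r : τ) (K : ι × ι' → U) :
    ∑ d, (α * ((1 : Matrix ι ι ℂ) ⊗ₖ α')) r d • K d =
      ∑ a, ∑ a', (α r a * α' a.2 a') • K (a.1, a') := by
  simp only [mul_apply, kroneckerMap_apply, one_apply, ite_mul, one_mul, zero_mul, mul_ite,
    mul_zero, Fintype.sum_prod_type, Finset.sum_ite_irrel, Finset.sum_const_zero,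
    Finset.sum_ite_eq', Finset.mem_univ, if_true, Finset.sum_smul]
  exact Finset.sum_congr rfl fun _ _ => Finset.sum_comm

theorem sum_one_kronecker_mul_smul [Fintype ι'] [DecidableEq ι] (β' : Matrix ι' κ ℂ)
    (β : Matrix (ι × κ) τ ℂ) (s : τ) (K : ι × ι' → U) :
    ∑ d, (((1 : Matrix ι ι ℂ) ⊗ₖ β') * β) d s • K d =
      ∑ c, ∑ c', (β' c' c.2 * β c s) • K (c.1, c') := by
  have h : ((1 : Matrix ι ι ℂ) ⊗ₖ β') * β = (βᵀ * ((1 : Matrix ι ι ℂ) ⊗ₖ β'ᵀ))ᵀ := by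
    rw [transpose_mul, transpose_transpose, ← kroneckerMap_transpose, transpose_one,
      transpose_transpose]
  simp only [h, transpose_apply, sum_mul_one_kronecker_smul, mul_comm (β _ s)]

theorem tensorSandwich_assoc [Fintype ι'] [Fintype κ'] [DecidableEq ι]
    {b : V →ₗ[ℂ] U →ₗ[ℂ] U'} {b' : V' →ₗ[ℂ] W →ₗ[ℂ] U} {c : W' →ₗ[ℂ] W →ₗ[ℂ] U'}
    {m : V → V' → W'} (h : ∀ v v' w, b v (b' v' w) = c (m v v') w)
    (α : Matrix τ (ι × κ) ℂ) (α' : Matrix κ (ι' × κ') ℂ) (x : Matrix ι ι V) (y : Matrix ι' ι' V')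
    (w : Matrix κ' κ' W) (β' : Matrix (ι' × κ') κ ℂ) (β : Matrix (ι × κ) τ ℂ) :
    tensorSandwich b α x (tensorSandwich b' α' y w β') β =
      tensorSandwich c ((α * ((1 : Matrix ι ι ℂ) ⊗ₖ α')).submatrix id (Equiv.prodAssoc ι ι' κ'))
        (of fun a d => m (x a.1 d.1) (y a.2 d.2)) w
        ((((1 : Matrix ι ι ℂ) ⊗ₖ β') * β).submatrix (Equiv.prodAssoc ι ι' κ') id) := by
  ext r s
  let F (d e : ι × (ι' × κ')) := c (m (x d.1 e.1) (y d.2.1 e.2.1)) (w d.2.2 e.2.2)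
  calc tensorSandwich b α x (tensorSandwich b' α' y w β') β r s
    _ = ∑ a, ∑ a', ∑ c, ∑ c',
          ((α r a * α' a.2 a') * (β' c' c.2 * β c s)) • F (a.1, a') (c.1, c') := by
        simp only [tensorSandwich, of_apply, map_sum, map_smul, Finset.smul_sum, smul_smul, h, F]
        refine Finset.sum_congr rfl fun a _ => ?_
        rw [Finset.sum_comm]
        refine Finset.sum_congr rfl fun a' _ => Finset.sum_congr rfl fun c _ =>
          Finset.sum_congr rfl fun c' _ => ?_
        congr 1
        ring
    _ = ∑ d, ∑ e, ((α * ((1 : Matrix ι ι ℂ) ⊗ₖ α')) r d * (((1 : Matrix ι ι ℂ) ⊗ₖ β') * β) e s) •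
          F d e := by
        simp only [← smul_smul, ← Finset.smul_sum, sum_mul_one_kronecker_smul,
          sum_one_kronecker_mul_smul]
    _ = _ := by
        rw [← (Equiv.prodAssoc ι ι' κ').sum_comp]
        refine Finset.sum_congr rfl fun d _ => ?_
        rw [← (Equiv.prodAssoc ι ι' κ').sum_comp]
        rfl

theorem amplify_comp_tensorSandwich {τ ι κ ν K : Type} [Fintype ι] [Fintype κ] [Fintype ν]
    [Fintype K] [DecidableEq ν] [DecidableEq K] (b : V →ₗ[ℂ] W →ₗ[ℂ] Matrix ν ν U)
    (φ : U →ₗ[ℂ] Matrix K K ℂ)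
    (α : Matrix τ (ι × κ) ℂ) (x : Matrix ι ι V) (y : Matrix κ κ W) (β : Matrix (ι × κ) τ ℂ) :
    amplify φ (comp τ τ ν ν U (tensorSandwich b α x y β)) =
      ((α ⊗ₖ (1 : Matrix (ν × K) (ν × K) ℂ)) *
        comp (ι × κ) (ι × κ) (ν × K) (ν × K) ℂ
          (of fun a c => amplify φ (b (x a.1 c.1) (y a.2 c.2))) *
        (β ⊗ₖ (1 : Matrix (ν × K) (ν × K) ℂ))).submatrix (Equiv.prodAssoc τ ν K)
          (Equiv.prodAssoc τ ν K) := by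
  ext ⟨⟨r, i⟩, u⟩ ⟨⟨s, j⟩, v⟩
  simp only [amplify, tensorSandwich, of_apply, comp_apply, Matrix.sum_apply, Matrix.smul_apply,
    map_sum, map_smul, smul_eq_mul, submatrix_apply, Equiv.prodAssoc_apply, mul_apply,
    Fintype.sum_prod_type (α₁ := ι × κ), kroneckerMap_apply, one_apply, mul_ite, mul_one,
    mul_zero, ite_mul, zero_mul, Finset.sum_ite_eq, Finset.sum_ite_eq', Finset.mem_univ, if_true,
    Finset.sum_mul]
  rw [Finset.sum_comm]
  exact Finset.sum_congr rfl fun _ _ => Finset.sum_congr rfl fun _ _ => by ring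

end TensorSandwich

section EndpointEstimates

open scoped Kronecker

variable {n : ℕ} {κ : Type} [DecidableEq κ] {T : κ → Matrix (Fin n) (Fin n) ℂ}

section Normed

variable {E : Type*} [NormedAddCommGroup E] [NormedSpace ℂ E] {N : MatNorms E}

theorem IsUnitaryFamily.ellInfty_twirl_le (hT : IsUnitaryFamily T) (hN : IsOperatorSpace N) {k : ℕ}
    (x : Matrix (Fin k) (Fin k) (Matrix (Fin n) (Fin n) E)) :
    sInfty n (ellInfty κ N) k (x.map (twirl T E)) ≤ sInfty n N k x := by
  refine Real.iSup_le (fun c => ?_) (hN.nonneg _ _)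
  let U : Matrix (Fin (k * n)) (Fin (k * n)) ℂ :=
    reindex finProdFinEquiv finProdFinEquiv ((1 : Matrix (Fin k) (Fin k) ℂ) ⊗ₖ T c)
  have hU : opNorm U ≤ 1 := (opNorm_reindex _ _ _).trans_le
    ((opNorm_one_kronecker_le _).trans (hT.opNorm_le_one c))
  have hU' : opNorm Uᴴ ≤ 1 := (opNorm_conjTranspose U).trans_le hU
  have h : (reindex finProdFinEquiv finProdFinEquiv (comp (Fin k) (Fin k) (Fin n) (Fin n) (κ → E)
      (x.map (twirl T E)))).map (fun v => v c) = sandwich U (reindex finProdFinEquiv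
      finProdFinEquiv (comp (Fin k) (Fin k) (Fin n) (Fin n) E x)) Uᴴ := by
    ext i j
    obtain ⟨⟨r, i⟩, rfl⟩ := finProdFinEquiv.surjective i
    obtain ⟨⟨s, j⟩, rfl⟩ := finProdFinEquiv.surjective j
    simp [sandwich, ← finProdFinEquiv.sum_comp, Fintype.sum_prod_type, U, one_apply, twirl,
      Finset.sum_ite_irrel, apply_ite star, ite_smul, -finProdFinEquiv_symm_apply]
  change N (k * n) (_root_.Matrix.map _ _) ≤ _
  rw [h]
  refine (hN.sandwich_le _ _ _ _ _).trans ?_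
  have h0 : 0 ≤ sInfty n N k x := hN.nonneg _ _
  calc _ ≤ 1 * sInfty n N k x * 1 :=
        mul_le_mul (mul_le_mul_of_nonneg_right hU h0) hU' (opNorm_nonneg _) (by simpa using h0)
    _ = _ := by rw [one_mul, mul_one]

theorem IsUnitaryFamily.sInfty_untwirlTensor_le [Fintype κ] (hT : IsUnitaryFamily T)
    (hN : IsOperatorSpace N) {k l m : ℕ} (α : Matrix (Fin k) (Fin l × Fin m) ℂ)
    (x : Matrix (Fin l) (Fin l) (Matrix (Fin n) (Fin n) ℂ)) (y : Matrix (Fin m) (Fin m) (κ → E))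
    (β : Matrix (Fin l × Fin m) (Fin k) ℂ) :
    sInfty n N k (tensorSandwich (untwirlTensor T E) α x y β) ≤
      opNorm α * opNorm β * (n * sOne n l x) * ellInfty κ N m y := by
  have hy := ellInfty_nonneg κ hN.nonneg y
  refine hN.le_of_forall_amplify_le _ fun φ hφ => ?_
  let A : Matrix (Fin m × Fin (k * n)) (Fin m × Fin (k * n)) (κ → ℂ) :=
    of fun u v c => amplify φ (y.map fun w => w c) u v
  have hA : ∀ c, opNorm (A.map fun v => v c) ≤ ellInfty κ N m y := fun c =>
    (hφ m _).trans (le_ellInfty N y c)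
  let e : (Fin l × Fin m) × (Fin n × Fin (k * n)) ≃ (Fin m × Fin (k * n)) × (Fin l × Fin n) :=
    { toFun := fun a => ((a.1.2, a.2.2), (a.1.1, a.2.1))
      invFun := fun a => ((a.2.1, a.1.1), (a.2.2, a.1.2)) }
  have hpair : comp (Fin l × Fin m) (Fin l × Fin m) (Fin n × Fin (k * n)) (Fin n × Fin (k * n)) ℂ
      (of fun a c => amplify φ (untwirlTensor T E (x a.1 c.1) (y a.2 c.2))) =
      (pairMat (sumPairing κ) (comp (Fin l) (Fin l) (Fin n) (Fin n) (κ → ℂ)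
        (x.map (twirl (fun c => (T c)ᴴ) ℂ))) A).submatrix e e := by
    ext ⟨a, i, u⟩ ⟨c, j, v⟩
    simp [amplify, untwirlTensor_apply, pairMat, sumPairing_apply, twirl_complex_apply, A, e,
      Matrix.sum_apply]
  have hle := hT.conjTranspose.opNorm_pairMat_twirl_le (Equiv.refl (Fin l)) x hy hA
  let g : Fin (k * n) × Fin (k * n) ≃ (Fin k × Fin n) × Fin (k * n) :=
    finProdFinEquiv.symm.prodCongr (Equiv.refl _)
  calc _ = opNorm ((amplify φ (comp (Fin k) (Fin k) (Fin n) (Fin n) E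
          (tensorSandwich (untwirlTensor T E) α x y β))).submatrix g g) := rfl
    _ ≤ opNorm α * (n * sOne n l x * ellInfty κ N m y) * opNorm β := by
        rw [amplify_comp_tensorSandwich, hpair, opNorm_submatrix_equiv, opNorm_submatrix_equiv]
        exact opNorm_mul_mul_le (opNorm_kronecker_one_le α)
          ((opNorm_submatrix_equiv _ e e).trans_le hle) (opNorm_kronecker_one_le β)
    _ = _ := by ring

end Normed

section Algebraic

variable [Fintype κ] {E : Type*} [AddCommGroup E] [Module ℂ E] {N : MatNorms E}

theorem IsUnitaryFamily.projNorms_twirl_le (hT : IsUnitaryFamily T) (hN : ∀ l x, 0 ≤ N l x) {k : ℕ}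
    (x : Matrix (Fin k) (Fin k) (Matrix (Fin n) (Fin n) E)) :
    sInfty n (projNorms (piTensor κ E) (ellOne κ) N) k (x.map (twirl T E)) ≤
      n * projNorms (matTensor n E) (sOne n) N k x := by
  refine le_mul_of_forall_gt fun C hC => ?_
  obtain ⟨l, m, α, z, y, β, rfl, hlt⟩ := exists_of_projNorms_lt (projSpanning_matTensor n E) hC
  have hα := opNorm_nonneg α
  have hz := (isMatrixGauge_sOne n).nonneg l z
  have hy := hN m y
  rw [sInfty, comp_map_tensorSandwich (g := twirl T ℂ) fun X e i j => twirl_matTensor X e i j]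
  refine (projNorms_tensorSandwich_le _ (isMatrixGauge_ellOne κ).nonneg hN finProdFinEquiv
    finProdFinEquiv (Equiv.refl (Fin m)) _ _ _ _).trans ?_
  calc _ ≤ opNorm α * (n * sOne n l z) * N m y * opNorm β := by
        have hβ' := opNorm_nonneg
          ((β ⊗ₖ (1 : Matrix (Fin n) (Fin n) ℂ)).submatrix (prodRightComm _ _ _) id)
        refine mul_le_mul (mul_le_mul_of_nonneg_right (mul_le_mul ?_ (hT.ellOne_twirl_le z)
          ((isMatrixGauge_ellOne κ).nonneg _ _) hα) hy) ?_ hβ' (by positivity)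
        · exact (opNorm_submatrix_equiv _ (Equiv.refl _) (prodRightComm _ _ _)).trans_le
            (opNorm_kronecker_one_le α)
        · exact (opNorm_submatrix_equiv _ (prodRightComm _ _ _) (Equiv.refl _)).trans_le
            (opNorm_kronecker_one_le β)
    _ = n * (opNorm α * sOne n l z * N m y * opNorm β) := by ring
    _ ≤ n * C := mul_le_mul_of_nonneg_left hlt.le (Nat.cast_nonneg n)

theorem IsUnitaryFamily.projNorms_untwirlTensor_le (hT : IsUnitaryFamily T)
    (hN : ∀ l x, 0 ≤ N l x) {k l m : ℕ} (α : Matrix (Fin k) (Fin l × Fin m) ℂ)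
    (x : Matrix (Fin l) (Fin l) (Matrix (Fin n) (Fin n) ℂ)) (y : Matrix (Fin m) (Fin m) (κ → E))
    (β : Matrix (Fin l × Fin m) (Fin k) ℂ) :
    projNorms (matTensor n E) (sOne n) N k (tensorSandwich (untwirlTensor T E) α x y β) ≤
      opNorm α * opNorm β * sOne n l x * projNorms (piTensor κ E) (ellOne κ) N m y := by
  refine le_mul_of_forall_gt fun C hC => ?_
  obtain ⟨l', m', α', b, w, β', rfl, hlt⟩ := exists_of_projNorms_lt (projSpanning_piTensor κ E) hC
  have hα := opNorm_nonneg α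
  have hβ := opNorm_nonneg β
  have hα' := opNorm_nonneg α'
  have hx := (isMatrixGauge_sOne n).nonneg l x
  have hb := (isMatrixGauge_ellOne κ).nonneg l' b
  have hw := hN m' w
  rw [tensorSandwich_assoc untwirlTensor_piTensor]
  refine (projNorms_tensorSandwich_le _ (isMatrixGauge_sOne n).nonneg hN (Equiv.refl (Fin k))
    finProdFinEquiv (Equiv.refl (Fin m')) _ _ _ _).trans ?_
  calc _ ≤ (opNorm α * opNorm α') * (sOne n l x * ellOne κ l' b) * N m' w *
          (opNorm β' * opNorm β) := by
        refine mul_le_mul (mul_le_mul_of_nonneg_right (mul_le_mul ?_ (hT.sOne_untwirlTensor_le x b)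
          ((isMatrixGauge_sOne n).nonneg _ _) (by positivity)) hw) ?_ (opNorm_nonneg _)
          (by positivity)
        · exact (opNorm_submatrix_equiv _ (Equiv.refl _) (Equiv.prodAssoc _ _ _)).trans_le
            ((opNorm_mul_le _ _).trans (mul_le_mul_of_nonneg_left (opNorm_one_kronecker_le α') hα))
        · exact (opNorm_submatrix_equiv _ (Equiv.prodAssoc _ _ _) (Equiv.refl _)).trans_le
            ((opNorm_mul_le _ _).trans (mul_le_mul_of_nonneg_right (opNorm_one_kronecker_le β') hβ))
    _ = opNorm α * opNorm β * sOne n l x * (opNorm α' * ellOne κ l' b * N m' w * opNorm β') := by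
        ring
    _ ≤ _ := mul_le_mul_of_nonneg_left hlt.le (by positivity)

end Algebraic

end EndpointEstimates

section Interpolated

attribute [local instance] Matrix.normedAddCommGroup Matrix.normedSpace

variable {E : Type*} [NormedAddCommGroup E] [NormedSpace ℂ E] {N : MatNorms E} {n k : ℕ}
  {κ : Type} {p q : ℝ≥0∞}

theorem toReal_inv_mem_Icc (hp : 1 ≤ p) : (p⁻¹).toReal ∈ Set.Icc (0 : ℝ) 1 :=
  ⟨ENNReal.toReal_nonneg, ENNReal.toReal_mono ENNReal.one_ne_top (ENNReal.inv_le_one.2 hp)⟩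

section Norms

theorem opNorm_single_zero_le_one (i : Fin k) :
    opNorm (single i (0 : Fin 1) (1 : ℂ)) ≤ 1 :=
  opNorm_le_one_of_conjTranspose_mul_self <| by
    ext a b
    obtain rfl := Subsingleton.elim a 0
    obtain rfl := Subsingleton.elim b 0
    simp

theorem IsOperatorSpace.single_le (hN : IsOperatorSpace N) (i j : Fin k) (e : E) :
    N k (single i j e) ≤ ‖e‖ := by
  have h : single i j e = sandwich (single i (0 : Fin 1) 1) (of fun _ _ => e)
      (single j (0 : Fin 1) 1)ᴴ := by
    ext r s
    simp [sandwich, single_apply, ite_and, eq_comm]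
  rw [h]
  refine (hN.sandwich_le _ _ _ _ _).trans ?_
  rw [opNorm_conjTranspose, hN.one_eq]
  calc _ ≤ 1 * ‖e‖ * 1 := mul_le_mul
        (mul_le_mul_of_nonneg_right (opNorm_single_zero_le_one i) (norm_nonneg e))
        (opNorm_single_zero_le_one j) (opNorm_nonneg _) (by positivity)
    _ = ‖e‖ := by rw [one_mul, mul_one]

theorem IsOperatorSpace.le_sum_norm (hN : IsOperatorSpace N) (x : Matrix (Fin k) (Fin k) E) :
    N k x ≤ ∑ i, ∑ j, ‖x i j‖ := by
  have hs := Finset.le_sum_of_subadditive (N k) (hN.map_zero k).le (hN.add_le k)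
    (Finset.univ : Finset (Fin k))
  conv_lhs => rw [matrix_eq_sum_single x]
  exact (hs _).trans (Finset.sum_le_sum fun i _ =>
    (hs _).trans (Finset.sum_le_sum fun j _ => hN.single_le i j _))

theorem sInfty_le_norm (hN : IsOperatorSpace N)
    (x : Matrix (Fin k) (Fin k) (Matrix (Fin n) (Fin n) E)) :
    sInfty n N k x ≤ (k * n * (k * n) : ℕ) * ‖x‖ := by
  have hentry (i j : Fin (k * n)) : ‖reindex finProdFinEquiv finProdFinEquiv
      (comp (Fin k) (Fin k) (Fin n) (Fin n) E x) i j‖ ≤ ‖x‖ :=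
    (norm_entry_le_entrywise_sup_norm (x (finProdFinEquiv.symm i).1
      (finProdFinEquiv.symm j).1)).trans (norm_entry_le_entrywise_sup_norm x)
  refine (hN.le_sum_norm _).trans ((Finset.sum_le_sum fun i _ => Finset.sum_le_sum fun j _ =>
    hentry i j).trans_eq ?_)
  simp [mul_assoc]

theorem sInfty_smul_le (hN : IsOperatorSpace N) (c : ℂ)
    (x : Matrix (Fin k) (Fin k) (Matrix (Fin n) (Fin n) E)) :
    sInfty n N k (c • x) ≤ ‖c‖ * sInfty n N k x :=
  (hN.smul_eq (k * n) c _).le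

theorem ellInfty_smul_le [Finite κ] (hN : IsOperatorSpace N) (c : ℂ)
    (x : Matrix (Fin k) (Fin k) (κ → E)) : ellInfty κ N k (c • x) ≤ ‖c‖ * ellInfty κ N k x := by
  refine Real.iSup_le (fun d => ?_) (mul_nonneg (norm_nonneg _) (ellInfty_nonneg κ hN.nonneg _))
  exact (hN.smul_eq k c (x.map fun v => v d)).trans_le
    (mul_le_mul_of_nonneg_left (le_ellInfty N x d) (norm_nonneg c))

theorem projNorms_matTensor_smul_le {N : MatNorms E} (hN : ∀ l x, 0 ≤ N l x) (c : ℂ)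
    (x : Matrix (Fin k) (Fin k) (Matrix (Fin n) (Fin n) E)) :
    projNorms (matTensor n E) (sOne n) N k (c • x) ≤
      ‖c‖ * projNorms (matTensor n E) (sOne n) N k x :=
  projNorms_smul_le (projSpanning_matTensor n E) (isMatrixGauge_sOne n).nonneg hN c x

theorem projNorms_piTensor_smul_le [Fintype κ] (hN : IsOperatorSpace N) (c : ℂ)
    (x : Matrix (Fin k) (Fin k) (κ → E)) :
    projNorms (piTensor κ E) (ellOne κ) N k (c • x) ≤
      ‖c‖ * projNorms (piTensor κ E) (ellOne κ) N k x :=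
  projNorms_smul_le (projSpanning_piTensor κ E) (isMatrixGauge_ellOne κ).nonneg hN.nonneg c x

theorem ellV_nonneg [Fintype κ] (l : ℕ) (x : Matrix (Fin l) (Fin l) (κ → E)) :
    0 ≤ ellV p κ N l x :=
  interp_nonneg _ _ _ x

theorem ellV_smul_le [Fintype κ] (hN : IsOperatorSpace N) (c : ℂ)
    (x : Matrix (Fin k) (Fin k) (κ → E)) : ellV p κ N k (c • x) ≤ ‖c‖ * ellV p κ N k x :=
  interp_smul_le (N₀ := ellInfty κ N) (ellInfty_smul_le hN) (projNorms_piTensor_smul_le hN) c x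

theorem schattenV_nonneg (x : Matrix (Fin k) (Fin k) (Matrix (Fin n) (Fin n) E)) :
    0 ≤ schattenV p n N k x :=
  interp_nonneg _ _ _ x

theorem schattenV_smul_le (hN : IsOperatorSpace N) (c : ℂ)
    (x : Matrix (Fin k) (Fin k) (Matrix (Fin n) (Fin n) E)) :
    schattenV p n N k (c • x) ≤ ‖c‖ * schattenV p n N k x :=
  interp_smul_le (N₀ := sInfty n N) (sInfty_smul_le hN) (projNorms_matTensor_smul_le hN.nonneg) c x

theorem schattenV_add_le (hN : IsOperatorSpace N)
    (x y : Matrix (Fin k) (Fin k) (Matrix (Fin n) (Fin n) E)) :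
    schattenV p n N k (x + y) ≤ schattenV p n N k x + schattenV p n N k y :=
  interp_add_le (N₀ := sInfty n N) (fun _ _ => hN.add_le (k * n) _ _)
    (projNorms_add_le (projSpanning_matTensor n E) (isMatrixGauge_sOne n) hN.isMatrixGauge) x y

/-- The norm of `M_k[S_p^n[E]]` as a seminorm, to which the duality argument behind
`seminorm_le_interp` applies. -/
def schattenVSeminorm (hN : IsOperatorSpace N) (p : ℝ≥0∞) (n k : ℕ) :
    Seminorm ℂ (Matrix (Fin k) (Fin k) (Matrix (Fin n) (Fin n) E)) :=
  Seminorm.ofSMulLE (schattenV p n N k)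
    (le_antisymm (by simpa using schattenV_smul_le (p := p) (k := k) (n := n) hN 0 0)
      (schattenV_nonneg _))
    (schattenV_add_le hN) (schattenV_smul_le hN)

theorem schattenV_le_norm (hN : IsOperatorSpace N) (hn : 0 < n)
    (x : Matrix (Fin k) (Fin k) (Matrix (Fin n) (Fin n) E)) :
    schattenV p n N k x ≤ (n : ℝ) ^ (p⁻¹).toReal * ((k * n * (k * n) : ℕ) * ‖x‖) :=
  interp_le_of_le (by positivity) (Nat.cast_pos.2 hn) (sInfty_smul_le hN)
    (projNorms_matTensor_smul_le hN.nonneg) (sInfty_le_norm hN x)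
    ((projNorms_matTensor_le_sInfty hN.nonneg x).trans
      (mul_le_mul_of_nonneg_left (sInfty_le_norm hN x) (Nat.cast_nonneg n)))

theorem continuous_schattenVSeminorm (hN : IsOperatorSpace N) (hn : 0 < n) :
    Continuous (schattenVSeminorm hN p n k) := by
  let C : NNReal := (n : NNReal) ^ (p⁻¹).toReal * (k * n * (k * n) : ℕ)
  refine Seminorm.continuous_of_le (q := C • normSeminorm ℂ _) (continuous_norm.const_smul C)
    fun x => (schattenV_le_norm hN hn x).trans_eq ?_
  simp only [C, _root_.smul_apply, coe_normSeminorm, NNReal.smul_def, NNReal.coe_mul,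
    NNReal.coe_rpow, NNReal.coe_natCast, smul_eq_mul, mul_assoc]

end Norms

section Scalar

theorem schattenV_scalarNorms (p : ℝ≥0∞) (n : ℕ) : schattenV p n scalarNorms = schatten p n := by
  have hb : matTensor n ℂ = (LinearMap.lsmul ℂ (Matrix (Fin n) (Fin n) ℂ)).flip := by
    ext; simp [matTensor, mul_comm]
  rw [schattenV, schatten, hb, sOne, projNorms_flip_lsmul_dualNorms (pairingBounded_tracePairing n)]

theorem ellV_scalarNorms (p : ℝ≥0∞) (κ : Type) [Fintype κ] : ellV p κ scalarNorms = ell p κ := by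
  have hb : piTensor κ ℂ = (LinearMap.lsmul ℂ (κ → ℂ)).flip :=
    LinearMap.ext₂ fun b c => by ext; simp [piTensor, mul_comm]
  rw [ellV, ell, hb, ellOne, projNorms_flip_lsmul_dualNorms (pairingBounded_sumPairing κ)]

end Scalar

section Maps

variable {T : κ → Matrix (Fin n) (Fin n) ℂ}

theorem continuous_twirl : Continuous (twirl T E) := by
  refine continuous_pi fun i => continuous_pi fun j => continuous_pi fun c => ?_
  change Continuous fun x : Matrix (Fin n) (Fin n) E =>
    ∑ a, ∑ b, (T c i a * star (T c j b)) • x a b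
  fun_prop

theorem continuous_mapMatrix {V W : Type*} [AddCommGroup V] [Module ℂ V] [AddCommGroup W]
    [Module ℂ W] [TopologicalSpace V] [TopologicalSpace W] {f : V →ₗ[ℂ] W} (hf : Continuous f) :
    Continuous (f.mapMatrix : Matrix (Fin k) (Fin k) V →ₗ[ℂ] Matrix (Fin k) (Fin k) W) :=
  continuous_id.matrix_map hf

variable [Fintype κ]

theorem continuous_untwirl : Continuous (untwirl T E) := by
  refine continuous_pi fun i => continuous_pi fun j => ?_
  change Continuous fun y : Matrix (Fin n) (Fin n) (κ → E) =>
    ∑ c, ∑ a, ∑ b, (star (T c a i) * T c b j) • y a b c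
  fun_prop

theorem continuous_untwirlTensor (X : Matrix (Fin n) (Fin n) ℂ) :
    Continuous (untwirlTensor T E X) := by
  refine continuous_untwirl.comp (continuous_pi fun i => continuous_pi fun j => ?_)
  exact continuous_const_smul (X i j)

end Maps

end Interpolated

section InterpolatedTwirl

attribute [local instance] Matrix.normedAddCommGroup Matrix.normedSpace

variable {E : Type*} [NormedAddCommGroup E] [NormedSpace ℂ E] {N : MatNorms E} {n k : ℕ}
  {κ : Type} [Fintype κ] [DecidableEq κ] {T : κ → Matrix (Fin n) (Fin n) ℂ} {p q : ℝ≥0∞}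

namespace IsUnitaryFamily

theorem ellV_twirl_le (hT : IsUnitaryFamily T) (hN : IsOperatorSpace N) (hn : 0 < n)
    (x : Matrix (Fin k) (Fin k) (Matrix (Fin n) (Fin n) E)) :
    sInfty n (ellV p κ N) k (x.map (twirl T E)) ≤
      (n : ℝ) ^ (p⁻¹).toReal * schattenV p n N k x := by
  let e : Fin k × Fin n ≃ Fin (k * n) := finProdFinEquiv
  let τ : Matrix (Fin k) (Fin k) (Matrix (Fin n) (Fin n) E) →ₗ[ℂ]
      Matrix (Fin (k * n)) (Fin (k * n)) (κ → E) :=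
    (reindexLinearEquiv ℂ (κ → E) e e).toLinearMap ∘ₗ
      (compLinearEquiv (Fin k) (Fin k) (Fin n) (Fin n) (κ → E) ℂ).toLinearMap ∘ₗ
        (twirl T E).mapMatrix
  have hmap := continuous_mapMatrix (k := k) (continuous_twirl (T := T) (E := E))
  have hτ : Continuous τ := continuous_pi fun r => continuous_pi fun s =>
    (hmap.matrix_elem (e.symm r).1 (e.symm s).1).matrix_elem (e.symm r).2 (e.symm s).2
  have h := interp_map_le (θ := (p⁻¹).toReal) hτ zero_le_one (a := n) (Nat.cast_pos.2 hn)
    (N₀ := sInfty n N) (N₀' := ellInfty κ N) (N₁ := projNorms (matTensor n E) (sOne n) N)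
    (ellInfty_smul_le hN) (projNorms_piTensor_smul_le hN)
    (fun x => by rw [one_mul]; exact hT.ellInfty_twirl_le hN x)
    (fun x => by rw [one_mul]; exact hT.projNorms_twirl_le hN.nonneg x) x
  rwa [one_mul] at h

theorem schattenV_twirl_le (hT : IsUnitaryFamily T) (hN : IsOperatorSpace N) (hn : 0 < n)
    (x : Matrix (Fin k) (Fin k) (Matrix (Fin n) (Fin n) E)) :
    schattenV q n (ellV p κ N) k (x.map (twirl T E)) ≤
      (n : ℝ) ^ (q⁻¹).toReal * ((n : ℝ) ^ (p⁻¹).toReal * schattenV p n N k x) :=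
  interp_le_of_le (mul_nonneg (by positivity) (schattenV_nonneg x)) (Nat.cast_pos.2 hn)
    (fun c y => ellV_smul_le hN c (reindex finProdFinEquiv finProdFinEquiv
      (comp (Fin k) (Fin k) (Fin n) (Fin n) (κ → E) y)))
    (projNorms_matTensor_smul_le ellV_nonneg) (hT.ellV_twirl_le hN hn x)
    ((projNorms_matTensor_le_sInfty ellV_nonneg _).trans
      (mul_le_mul_of_nonneg_left (hT.ellV_twirl_le hN hn x) (Nat.cast_nonneg n)))

theorem schattenV_untwirlTensor_le (hT : IsUnitaryFamily T) (hN : IsOperatorSpace N) (hn : 0 < n)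
    {l m : ℕ} (α : Matrix (Fin k) (Fin l × Fin m) ℂ)
    (x : Matrix (Fin l) (Fin l) (Matrix (Fin n) (Fin n) ℂ)) (y : Matrix (Fin m) (Fin m) (κ → E))
    (β : Matrix (Fin l × Fin m) (Fin k) ℂ) :
    schattenV p n N k (tensorSandwich (untwirlTensor T E) α x y β) ≤
      (n : ℝ) ^ (1 - (p⁻¹).toReal) *
        (opNorm α * sOne n l x * ellV p κ N m y * opNorm β) := by
  have hn' : (0 : ℝ) < n := Nat.cast_pos.2 hn
  have hα := opNorm_nonneg α
  have hβ := opNorm_nonneg β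
  have hx := (isMatrixGauge_sOne n).nonneg l x
  let σ : Matrix (Fin m) (Fin m) (κ → E) →ₗ[ℂ] Matrix (Fin k) (Fin k) (Matrix (Fin n) (Fin n) E) :=
    { toFun := fun y => tensorSandwich (untwirlTensor T E) α x y β
      map_add' := fun y y' => by ext1 r s; simp [tensorSandwich, Finset.sum_add_distrib]
      map_smul' := fun c y => by
        ext1 r s; simp [tensorSandwich, Finset.smul_sum, smul_comm c] }
  have hσ : Continuous σ := continuous_pi fun r => continuous_pi fun s =>
    continuous_finsetSum _ fun a _ => continuous_finsetSum _ fun c _ =>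
      ((continuous_untwirlTensor (x a.1 c.1)).comp
        (continuous_id.matrix_elem a.2 c.2)).fun_const_smul (α r a * β c s)
  have h := interp_map_le (θ := (p⁻¹).toReal) hσ (D := opNorm α * opNorm β * (n * sOne n l x))
    (a := (n : ℝ)⁻¹) (by positivity) (by positivity) (N₀' := sInfty n N) (N₀ := ellInfty κ N)
    (N₁ := projNorms (piTensor κ E) (ellOne κ) N)
    (sInfty_smul_le hN) (projNorms_matTensor_smul_le hN.nonneg)
    (fun y => hT.sInfty_untwirlTensor_le hN α x y β)
    (fun y => (hT.projNorms_untwirlTensor_le hN.nonneg α x y β).trans_eq (by field_simp)) y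
  refine h.trans_eq ?_
  rw [Real.rpow_sub hn', Real.rpow_one, Real.inv_rpow hn'.le]
  change _ * ellV p κ N m y = _
  ring

theorem schattenV_untwirl_le_projNorms (hT : IsUnitaryFamily T) (hN : IsOperatorSpace N)
    (hn : 0 < n) (t : Matrix (Fin k) (Fin k) (Matrix (Fin n) (Fin n) (κ → E))) :
    schattenV p n N k (t.map (untwirl T E)) ≤ (n : ℝ) ^ (1 - (p⁻¹).toReal) *
      projNorms (matTensor n (κ → E)) (sOne n) (ellV p κ N) k t := by
  refine le_mul_of_forall_gt fun C hC => ?_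
  obtain ⟨l, m, α, x, y, β, rfl, hlt⟩ :=
    exists_of_projNorms_lt (projSpanning_matTensor n (κ → E)) hC
  have hmap : (tensorSandwich (matTensor n (κ → E)) α x y β).map (untwirl T E) =
      tensorSandwich (untwirlTensor T E) α x y β := by
    ext1 r s
    simp only [tensorSandwich, map_apply, of_apply, map_sum, map_smul, untwirlTensor,
      LinearMap.compr₂_apply]
  rw [hmap]
  exact (hT.schattenV_untwirlTensor_le hN hn α x y β).trans
    (mul_le_mul_of_nonneg_left hlt.le (by positivity))

theorem schattenV_untwirl_le (hT : IsUnitaryFamily T) (hN : IsOperatorSpace N) (hn : 0 < n)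
    (hq : 1 ≤ q) (t : Matrix (Fin k) (Fin k) (Matrix (Fin n) (Fin n) (κ → E))) :
    schattenV p n N k (t.map (untwirl T E)) ≤ (n : ℝ) ^ (2 - (p⁻¹).toReal - (q⁻¹).toReal) *
      schattenV q n (ellV p κ N) k t := by
  have hn' : (0 : ℝ) < n := Nat.cast_pos.2 hn
  have hproj := hT.schattenV_untwirl_le_projNorms (p := p) (k := k) hN hn
  have h := seminorm_le_interp (θ := (q⁻¹).toReal) (a := (n : ℝ)⁻¹)
    (D := (n : ℝ) ^ (1 - (p⁻¹).toReal) * n) (N₀ := sInfty n (ellV p κ N))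
    (N₁ := projNorms (matTensor n (κ → E)) (sOne n) (ellV p κ N))
    ((schattenVSeminorm hN p n k).comp (untwirl T E).mapMatrix)
    ((continuous_schattenVSeminorm hN hn).comp (continuous_mapMatrix continuous_untwirl))
    (by positivity) (by positivity) (toReal_inv_mem_Icc hq)
    (fun t => (hproj t).trans ((mul_le_mul_of_nonneg_left
      (projNorms_matTensor_le_sInfty ellV_nonneg t) (by positivity)).trans_eq (by ring)))
    (fun t => (hproj t).trans_eq (by field_simp)) t
  refine h.trans_eq ?_
  rw [Real.rpow_sub hn', Real.rpow_sub hn', Real.rpow_sub hn', Real.rpow_one,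
    Real.inv_rpow hn'.le, Real.rpow_two]
  change _ * schattenV q n (ellV p κ N) k t = _
  ring

end IsUnitaryFamily

end InterpolatedTwirl

section Retraction

variable {V V' : Type*} [AddCommGroup V] [Module ℂ V] [AddCommGroup V'] [Module ℂ V']
  {N : MatNorms V} {N' : MatNorms V'} {J : V →ₗ[ℂ] V'} {W : V' →ₗ[ℂ] V}

theorem IsCompleteContraction.comp (hJ : IsCompleteContraction N N' J)
    (hW : IsCompleteContraction N' N W) : IsCompleteContraction N' N' (J ∘ₗ W) :=
  fun k y => (hJ k (y.map W)).trans (hW k y)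

theorem IsCompleteContraction.isCompleteIsometry (hJ : IsCompleteContraction N N' J)
    (hW : IsCompleteContraction N' N W) (hWJ : W ∘ₗ J = LinearMap.id) :
    IsCompleteIsometry N N' J := by
  refine fun k x => (hJ k x).antisymm ?_
  have hx : (x.map J).map W = x := by
    ext1 i j
    exact congr($hWJ (x i j))
  calc N k x = N k ((x.map J).map W) := by rw [hx]
    _ ≤ N' k (x.map J) := hW k _

theorem isProj_range_of_comp_eq_id (hWJ : W ∘ₗ J = LinearMap.id) :
    LinearMap.IsProj (LinearMap.range J) (J ∘ₗ W) where
  map_mem y := ⟨W y, rfl⟩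
  map_id := by
    rintro _ ⟨x, rfl⟩
    exact congr(J ($hWJ x))

end Retraction

section TensorId

variable {n : ℕ} {κ : Type} (T : κ → Matrix (Fin n) (Fin n) ℂ) (E : Type*) [AddCommGroup E]
  [Module ℂ E]

theorem mul_single_mul_apply (A B : Matrix (Fin n) (Fin n) ℂ) (r s i j : Fin n) :
    (A * single r s (1 : ℂ) * B : Matrix (Fin n) (Fin n) ℂ) i j = A i r * B s j := by
  rw [mul_apply, Finset.sum_eq_single s]
  · simp
  · intro t _ ht
    simp [ht]
  · simp

theorem tensorIdOut_smul_twirl (a : ℂ) : tensorIdOut (a • twirl T ℂ) E = a • twirl T E := by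
  ext x i j c
  change ∑ r, ∑ s, (a * twirl T ℂ (single r s 1) i j c) • x r s =
    a • ∑ r, ∑ s, (T c i r * star (T c j s)) • x r s
  simp only [twirl_complex_apply, mul_single_mul_apply, conjTranspose_apply, Finset.smul_sum,
    smul_smul]

theorem tensorIdIn_smul_untwirl [Fintype κ] [DecidableEq κ] (a : ℂ) :
    tensorIdIn (a • untwirl T ℂ) E = a • untwirl T E := by
  have hsingle (r s i j : Fin n) (c : κ) :
      untwirl T ℂ (single r s (Pi.single c 1)) i j = star (T c r i) * T c s j := by
    rw [← matTensor_single]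
    change untwirlTensor T ℂ (single r s 1) (Pi.single c 1) i j = _
    rw [untwirlTensor_apply, Finset.sum_eq_single c (fun d _ hd => by simp [hd]) (by simp),
      mul_single_mul_apply, Pi.single_eq_same, conjTranspose_apply, smul_eq_mul, mul_one]
  ext x i j
  change ∑ r, ∑ s, ∑ c, (a * untwirl T ℂ (single r s (Pi.single c 1)) i j) • x r s c =
    a • ∑ c, ∑ r, ∑ s, (star (T c r i) * T c s j) • x r s c
  simp only [hsingle, Finset.smul_sum, smul_smul]
  rw [Finset.sum_congr rfl fun r _ => Finset.sum_comm, Finset.sum_comm]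

end TensorId

section Positivity

open scoped ComplexOrder Kronecker

variable {n : ℕ} {κ : Type} {a : ℝ}

theorem posSemidef_comp_map_mul_mul_conjTranspose {k : ℕ} (A : Matrix (Fin n) (Fin n) ℂ)
    {x : Matrix (Fin k) (Fin k) (Matrix (Fin n) (Fin n) ℂ)}
    (hx : (comp (Fin k) (Fin k) (Fin n) (Fin n) ℂ x).PosSemidef) :
    (comp (Fin k) (Fin k) (Fin n) (Fin n) ℂ (x.map fun y => A * y * Aᴴ)).PosSemidef := by
  have hcomp : comp (Fin k) (Fin k) (Fin n) (Fin n) ℂ (x.map fun y => A * y * Aᴴ) =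
      ((1 : Matrix (Fin k) (Fin k) ℂ) ⊗ₖ A) * comp (Fin k) (Fin k) (Fin n) (Fin n) ℂ x *
        ((1 : Matrix (Fin k) (Fin k) ℂ) ⊗ₖ A)ᴴ := by
    ext ⟨r, i⟩ ⟨s, j⟩
    simp [mul_apply, Fintype.sum_prod_type, one_apply, Finset.sum_ite_irrel, apply_ite star]
  rw [hcomp]
  exact hx.mul_mul_conjTranspose_same _

theorem isCompletelyPositive_smul_twirl (T : κ → Matrix (Fin n) (Fin n) ℂ) (ha : 0 ≤ a) :
    IsCompletelyPositive (matCone n) (matEllCone n κ) ((a : ℂ) • twirl T ℂ) := by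
  intro k x hx c
  have hslice : (comp (Fin k) (Fin k) (Fin n) (Fin n) (κ → ℂ)
      (x.map ⇑((a : ℂ) • twirl T ℂ))).map (· c) =
        (a : ℂ) • comp (Fin k) (Fin k) (Fin n) (Fin n) ℂ (x.map fun y => T c * y * (T c)ᴴ) := by
    ext ⟨r, i⟩ ⟨s, j⟩
    exact congrArg ((a : ℂ) * ·) (twirl_complex_apply (x r s) i j c)
  rw [hslice]
  exact (posSemidef_comp_map_mul_mul_conjTranspose _ hx).smul (Complex.zero_le_real.2 ha)

theorem isCompletelyPositive_smul_untwirl [Fintype κ] (T : κ → Matrix (Fin n) (Fin n) ℂ)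
    (ha : 0 ≤ a) :
    IsCompletelyPositive (matEllCone n κ) (matCone n) ((a : ℂ) • untwirl T ℂ) := by
  intro k y hy
  let slice (c : κ) : Matrix (Fin k) (Fin k) (Matrix (Fin n) (Fin n) ℂ) :=
    y.map fun z => z.map (· c)
  have hsum : comp (Fin k) (Fin k) (Fin n) (Fin n) ℂ (y.map ⇑((a : ℂ) • untwirl T ℂ)) =
      (a : ℂ) • ∑ c, comp (Fin k) (Fin k) (Fin n) (Fin n) ℂ
        ((slice c).map fun z => (T c)ᴴ * z * (T c)ᴴᴴ) := by
    ext ⟨r, i⟩ ⟨s, j⟩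
    change a * ∑ c, ∑ u, ∑ v, (star (T c u i) * T c v j) • y r s u v c = _
    simp only [slice, Matrix.smul_apply, Matrix.sum_apply, comp_apply, map_apply, mul_apply,
      conjTranspose_apply, star_star, Finset.sum_mul, smul_eq_mul, mul_right_comm]
    exact congrArg ((a : ℂ) * ·) (Finset.sum_congr rfl fun c _ => Finset.sum_comm)
  change (comp (Fin k) (Fin k) (Fin n) (Fin n) ℂ _).PosSemidef
  rw [hsum]
  exact (posSemidef_sum _ fun c _ => posSemidef_comp_map_mul_mul_conjTranspose (T c)ᴴ
    (x := slice c) (hy c)).smul (Complex.zero_le_real.2 ha)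

end Positivity

section Normalized

variable {n : ℕ} {κ : Type} [Fintype κ] [DecidableEq κ] {T : κ → Matrix (Fin n) (Fin n) ℂ}
  {E : Type*}

namespace IsUnitaryFamily

theorem smul_untwirl_comp_smul_twirl [AddCommGroup E] [Module ℂ E] (hT : IsUnitaryFamily T)
    {a b : ℂ} (h : a * b * Fintype.card κ = 1) :
    (a • untwirl T E) ∘ₗ (b • twirl T E) = LinearMap.id := by
  ext1 x
  change a • untwirl T E (b • twirl T E x) = x
  rw [map_smul, hT.untwirl_twirl, smul_smul, smul_smul, h, one_smul]

variable [NormedAddCommGroup E] [NormedSpace ℂ E] {N : MatNorms E} {p q : ℝ≥0∞} {a : ℝ}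

theorem isCompleteContraction_smul_twirl (hT : IsUnitaryFamily T) (hN : IsOperatorSpace N)
    (hn : 0 < n) (ha : 0 ≤ a) (ha' : a * (n : ℝ) ^ ((p⁻¹).toReal + (q⁻¹).toReal) ≤ 1) :
    IsCompleteContraction (schattenV p n N) (schattenV q n (ellV p κ N))
      ((a : ℂ) • twirl T E) := by
  intro k x
  have hmap : x.map ((a : ℂ) • twirl T E) = ((a : ℂ) • x).map (twirl T E) := by
    ext1 i j
    exact ((twirl T E).map_smul _ _).symm
  rw [hmap]
  calc _ ≤ (n : ℝ) ^ (q⁻¹).toReal *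
        ((n : ℝ) ^ (p⁻¹).toReal * schattenV p n N k ((a : ℂ) • x)) :=
        hT.schattenV_twirl_le hN hn _
    _ ≤ (n : ℝ) ^ (q⁻¹).toReal * ((n : ℝ) ^ (p⁻¹).toReal * (a * schattenV p n N k x)) := by
        gcongr
        refine (schattenV_smul_le hN _ x).trans_eq ?_
        rw [Complex.norm_real, Real.norm_of_nonneg ha]
    _ = a * (n : ℝ) ^ ((p⁻¹).toReal + (q⁻¹).toReal) * schattenV p n N k x := by
        rw [Real.rpow_add (Nat.cast_pos.2 hn)]; ring
    _ ≤ _ := mul_le_of_le_one_left (schattenV_nonneg x) ha'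

theorem isCompleteContraction_smul_untwirl (hT : IsUnitaryFamily T) (hN : IsOperatorSpace N)
    (hn : 0 < n) (hq : 1 ≤ q) (ha : 0 ≤ a)
    (ha' : a * (n : ℝ) ^ (2 - (p⁻¹).toReal - (q⁻¹).toReal) ≤ 1) :
    IsCompleteContraction (schattenV q n (ellV p κ N)) (schattenV p n N)
      ((a : ℂ) • untwirl T E) := by
  intro k y
  calc _ ≤ a * schattenV p n N k (y.map (untwirl T E)) := by
        refine (schattenV_smul_le hN (a : ℂ) (y.map (untwirl T E))).trans_eq ?_
        rw [Complex.norm_real, Real.norm_of_nonneg ha]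
    _ ≤ a * ((n : ℝ) ^ (2 - (p⁻¹).toReal - (q⁻¹).toReal) * schattenV q n (ellV p κ N) k y) :=
        mul_le_mul_of_nonneg_left (hT.schattenV_untwirl_le hN hn hq y) ha
    _ = a * (n : ℝ) ^ (2 - (p⁻¹).toReal - (q⁻¹).toReal) * schattenV q n (ellV p κ N) k y := by
        ring
    _ ≤ _ := mul_le_of_le_one_left (schattenV_nonneg y) ha'

end IsUnitaryFamily

end Normalized

section Weyl

variable {n : ℕ}

theorem weyl_apply (k l i j : Fin n) : weyl n k l i j =
    if i = l + j then Complex.exp (2 * Real.pi * Complex.I * (-(k : ℕ) * (j : ℕ)) / n) else 0 := by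
  rw [weyl, clock, mul_diagonal, shift, of_apply, ite_mul, one_mul, zero_mul]
  congr 3
  push_cast
  ring

theorem conjTranspose_weyl_mul_weyl_apply (k l k' l' a b : Fin n) :
    ((weyl n k l)ᴴ * weyl n k' l') a b = if l + a = l' + b then
      Complex.exp (2 * Real.pi * Complex.I * ((k : ℕ) * (a : ℕ) - (k' : ℕ) * (b : ℕ)) / n)
    else 0 := by
  rw [mul_apply, Finset.sum_eq_single (l + a)]
  · simp only [conjTranspose_apply, weyl_apply, if_true]
    split_ifs
    · rw [← starRingEnd_apply, ← Complex.exp_conj, ← Complex.exp_add]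
      congr 1
      simp only [map_div₀, map_mul, map_neg, Complex.conj_ofReal, Complex.conj_I, map_natCast,
        map_ofNat]
      ring
    · rw [mul_zero]
  · intro i _ hi
    simp [weyl_apply, hi]
  · simp

theorem sum_exp_mul_eq_zero (hn : 0 < n) {m : ℤ} (hm : ¬ (n : ℤ) ∣ m) :
    ∑ a : Fin n, Complex.exp (2 * Real.pi * Complex.I * (m * (a : ℕ)) / n) = 0 := by
  let ζ := Complex.exp (2 * Real.pi * Complex.I / n)
  have hζ : IsPrimitiveRoot ζ n := Complex.isPrimitiveRoot_exp n hn.ne'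
  have hterm (a : ℕ) : Complex.exp (2 * Real.pi * Complex.I * (m * a) / n) = (ζ ^ m) ^ a := by
    rw [← Complex.exp_int_mul, ← Complex.exp_nat_mul]
    congr 1
    ring
  have hne : ζ ^ m ≠ 1 := fun h => hm ((hζ.zpow_eq_one_iff_dvd m).1 h)
  have hpow : (ζ ^ m) ^ n = 1 := by
    rw [← zpow_natCast, _root_.zpow_comm, zpow_natCast, hζ.pow_eq_one, _root_.one_zpow]
  simp only [hterm]
  rw [Fin.sum_univ_eq_sum_range (fun a => (ζ ^ m) ^ a), geom_sum_eq hne, hpow, sub_self, zero_div]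

theorem isUnitaryFamily_weyl (hn : 0 < n) :
    IsUnitaryFamily fun c : Fin n × Fin n => weyl n c.1 c.2 where
  conjTranspose_mul := by
    have : NeZero n := ⟨hn.ne'⟩
    rintro ⟨k, l⟩
    ext a b
    rw [conjTranspose_weyl_mul_weyl_apply, one_apply]
    by_cases hab : a = b <;> simp [hab]
  trace_eq := by
    have : NeZero n := ⟨hn.ne'⟩
    rintro ⟨k, l⟩ ⟨k', l'⟩
    simp only [trace, diag_apply, conjTranspose_weyl_mul_weyl_apply, add_left_inj, ← sub_mul]
    rcases eq_or_ne l l' with rfl | hl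
    · rcases eq_or_ne k k' with rfl | hk
      · simp
      · have hdvd : ¬ (n : ℤ) ∣ (k : ℕ) - (k' : ℕ) := fun h => hk <| Fin.ext <| by
          have := Int.eq_zero_of_abs_lt_dvd h (by rw [abs_lt]; omega)
          omega
        simpa [hk] using sum_exp_mul_eq_zero hn hdvd
    · simp [hl]

end Weyl

section Teleportation

variable {n : ℕ} {E : Type*} {N : MatNorms E} {p q : ℝ≥0∞}

/-- The left inverse `W = n^{1/p + 1/q - 2} ∑_{k,l} T_{k,l}^* (·)_{k,l} T_{k,l}` of `J_{p,q}`. -/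
def recovery (n : ℕ) (p q : ℝ≥0∞) :
    Matrix (Fin n) (Fin n) (Fin n × Fin n → ℂ) →ₗ[ℂ] Matrix (Fin n) (Fin n) ℂ :=
  (((n : ℝ) ^ ((p⁻¹).toReal + (q⁻¹).toReal - 2) : ℝ) : ℂ) •
    untwirl (fun c : Fin n × Fin n => weyl n c.1 c.2) ℂ

theorem teleport_eq_smul_twirl (n : ℕ) (p q : ℝ≥0∞) : teleport n p q =
    (((n : ℝ) ^ (1 - (p⁻¹).toReal - (q⁻¹).toReal) * (1 / (n : ℝ)) : ℝ) : ℂ) •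
      twirl (fun c : Fin n × Fin n => weyl n c.1 c.2) ℂ := by
  ext1 ρ
  ext i j c
  change _ * (weyl n c.1 c.2 * ρ * (weyl n c.1 c.2)ᴴ) i j = _ * twirl _ ℂ ρ i j c
  rw [twirl_complex_apply]

theorem tensorIdOut_teleport_complex (n : ℕ) (p q : ℝ≥0∞) :
    tensorIdOut (teleport n p q) ℂ = teleport n p q := by
  rw [teleport_eq_smul_twirl, tensorIdOut_smul_twirl]

theorem tensorIdIn_recovery_complex (n : ℕ) (p q : ℝ≥0∞) :
    tensorIdIn (recovery n p q) ℂ = recovery n p q := by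
  rw [recovery, tensorIdIn_smul_untwirl]

theorem isCompletelyPositive_teleport (n : ℕ) (p q : ℝ≥0∞) :
    IsCompletelyPositive (matCone n) (matEllCone n (Fin n × Fin n)) (teleport n p q) := by
  rw [teleport_eq_smul_twirl]
  exact isCompletelyPositive_smul_twirl _ (by positivity)

theorem isCompletelyPositive_recovery (n : ℕ) (p q : ℝ≥0∞) :
    IsCompletelyPositive (matEllCone n (Fin n × Fin n)) (matCone n) (recovery n p q) :=
  isCompletelyPositive_smul_untwirl _ (by positivity)

theorem tensorIdIn_recovery_comp_tensorIdOut_teleport [AddCommGroup E] [Module ℂ E] (hn : 0 < n)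
    (p q : ℝ≥0∞) :
    tensorIdIn (recovery n p q) E ∘ₗ tensorIdOut (teleport n p q) E = LinearMap.id := by
  have hn' : (0 : ℝ) < n := Nat.cast_pos.2 hn
  rw [recovery, teleport_eq_smul_twirl, tensorIdIn_smul_untwirl, tensorIdOut_smul_twirl]
  refine (isUnitaryFamily_weyl hn).smul_untwirl_comp_smul_twirl ?_
  rw [Fintype.card_prod, Fintype.card_fin]
  norm_cast
  rw [← mul_assoc, ← Real.rpow_add hn', show (p⁻¹).toReal + (q⁻¹).toReal - 2 +
    (1 - (p⁻¹).toReal - (q⁻¹).toReal) = -1 by ring, Real.rpow_neg_one]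
  push_cast
  field_simp

variable [NormedAddCommGroup E] [NormedSpace ℂ E]

theorem isCompleteContraction_tensorIdOut_teleport (hN : IsOperatorSpace N) (hn : 0 < n)
    (p q : ℝ≥0∞) :
    IsCompleteContraction (schattenV p n N) (schattenV q n (ellV p (Fin n × Fin n) N))
      (tensorIdOut (teleport n p q) E) := by
  have hn' : (0 : ℝ) < n := Nat.cast_pos.2 hn
  rw [teleport_eq_smul_twirl, tensorIdOut_smul_twirl]
  refine (isUnitaryFamily_weyl hn).isCompleteContraction_smul_twirl hN hn (by positivity)
    (le_of_eq ?_)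
  rw [mul_right_comm, ← Real.rpow_add hn', sub_sub, sub_add_cancel, Real.rpow_one,
    mul_one_div_cancel hn'.ne']

theorem isCompleteContraction_tensorIdIn_recovery (hN : IsOperatorSpace N) (hn : 0 < n)
    (p : ℝ≥0∞) (hq : 1 ≤ q) :
    IsCompleteContraction (schattenV q n (ellV p (Fin n × Fin n) N)) (schattenV p n N)
      (tensorIdIn (recovery n p q) E) := by
  rw [recovery, tensorIdIn_smul_untwirl]
  refine (isUnitaryFamily_weyl hn).isCompleteContraction_smul_untwirl hN hn hq (by positivity)
    (le_of_eq ?_)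
  rw [← Real.rpow_add (Nat.cast_pos.2 hn), sub_sub, sub_add_sub_cancel, sub_self, Real.rpow_zero]

theorem recovery_comp_teleport (hn : 0 < n) (p q : ℝ≥0∞) :
    recovery n p q ∘ₗ teleport n p q = LinearMap.id := by
  simpa only [tensorIdIn_recovery_complex, tensorIdOut_teleport_complex] using
    tensorIdIn_recovery_comp_tensorIdOut_teleport (E := ℂ) hn p q

theorem isCompleteContraction_teleport (hn : 0 < n) (p q : ℝ≥0∞) :
    IsCompleteContraction (schatten p n) (schattenV q n (ell p (Fin n × Fin n)))
      (teleport n p q) := by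
  simpa only [schattenV_scalarNorms, ellV_scalarNorms, tensorIdOut_teleport_complex] using
    isCompleteContraction_tensorIdOut_teleport isOperatorSpace_scalarNorms hn p q

theorem isCompleteContraction_recovery (hn : 0 < n) (p : ℝ≥0∞) (hq : 1 ≤ q) :
    IsCompleteContraction (schattenV q n (ell p (Fin n × Fin n))) (schatten p n)
      (recovery n p q) := by
  simpa only [schattenV_scalarNorms, ellV_scalarNorms, tensorIdIn_recovery_complex] using
    isCompleteContraction_tensorIdIn_recovery isOperatorSpace_scalarNorms hn p hq

end Teleportation

end OpSp

end

theorem corollary1p2_general (n : ℕ) (hn : 0 < n) (p q : ℝ≥0∞) (hp : 1 ≤ p) (hq : 1 ≤ q) :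
    OpSp.IsCompletelyPositive (OpSp.matCone n) (OpSp.matEllCone n (Fin n × Fin n))
      (OpSp.teleport n p q) ∧
    ∃ W : Matrix (Fin n) (Fin n) (Fin n × Fin n → ℂ) →ₗ[ℂ] Matrix (Fin n) (Fin n) ℂ,
      OpSp.IsCompletelyPositive (OpSp.matEllCone n (Fin n × Fin n)) (OpSp.matCone n) W ∧
      OpSp.IsCompletelyPositive (OpSp.matEllCone n (Fin n × Fin n))
        (OpSp.matEllCone n (Fin n × Fin n)) (OpSp.teleport n p q ∘ₗ W) ∧
      W ∘ₗ OpSp.teleport n p q = LinearMap.id ∧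
      LinearMap.IsProj (LinearMap.range (OpSp.teleport n p q)) (OpSp.teleport n p q ∘ₗ W) ∧
      OpSp.IsCompleteIsometry (OpSp.schatten p n)
        (OpSp.schattenV q n (OpSp.ell p (Fin n × Fin n))) (OpSp.teleport n p q) ∧
      OpSp.IsCompleteContraction (OpSp.schattenV q n (OpSp.ell p (Fin n × Fin n)))
        (OpSp.schatten p n) W ∧
      OpSp.IsCompleteContraction (OpSp.schattenV q n (OpSp.ell p (Fin n × Fin n)))
        (OpSp.schattenV q n (OpSp.ell p (Fin n × Fin n))) (OpSp.teleport n p q ∘ₗ W) ∧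
      ∀ (E : Type*) [NormedAddCommGroup E] [NormedSpace ℂ E]
        (N : OpSp.MatNorms E), OpSp.IsOperatorSpace N →
        OpSp.tensorIdIn W E ∘ₗ OpSp.tensorIdOut (OpSp.teleport n p q) E = LinearMap.id ∧
        LinearMap.IsProj (LinearMap.range (OpSp.tensorIdOut (OpSp.teleport n p q) E))
          (OpSp.tensorIdOut (OpSp.teleport n p q) E ∘ₗ OpSp.tensorIdIn W E) ∧
        OpSp.IsCompleteIsometry (OpSp.schattenV p n N)
          (OpSp.schattenV q n (OpSp.ellV p (Fin n × Fin n) N))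
          (OpSp.tensorIdOut (OpSp.teleport n p q) E) ∧
        OpSp.IsCompleteContraction (OpSp.schattenV q n (OpSp.ellV p (Fin n × Fin n) N))
          (OpSp.schattenV p n N) (OpSp.tensorIdIn W E) ∧
        OpSp.IsCompleteContraction (OpSp.schattenV q n (OpSp.ellV p (Fin n × Fin n) N))
          (OpSp.schattenV q n (OpSp.ellV p (Fin n × Fin n) N))
          (OpSp.tensorIdOut (OpSp.teleport n p q) E ∘ₗ OpSp.tensorIdIn W E) := by
  have hJ := OpSp.isCompletelyPositive_teleport n p q
  have hW := OpSp.isCompletelyPositive_recovery n p q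
  have hWJ := OpSp.recovery_comp_teleport hn p q
  have hJ_le := OpSp.isCompleteContraction_teleport hn p q
  have hW_le := OpSp.isCompleteContraction_recovery hn p hq
  refine ⟨hJ, OpSp.recovery n p q, hW, fun k y hy => hJ k _ (hW k y hy), hWJ,
    OpSp.isProj_range_of_comp_eq_id hWJ, hJ_le.isCompleteIsometry hW_le hWJ, hW_le,
    hJ_le.comp hW_le, fun E _ _ N hN => ?_⟩
  have hWJE := OpSp.tensorIdIn_recovery_comp_tensorIdOut_teleport (E := E) hn p q
  have hJE_le := OpSp.isCompleteContraction_tensorIdOut_teleport hN hn p q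
  have hWE_le := OpSp.isCompleteContraction_tensorIdIn_recovery hN hn p hq
  exact ⟨hWJE, OpSp.isProj_range_of_comp_eq_id hWJE, hJE_le.isCompleteIsometry hWE_le hWJE,
    hWE_le, hJE_le.comp hWE_le⟩

theorem corollary1p2 (n : ℕ) (hn : 0 < n) (p q : ℝ≥0∞) (hp : 1 ≤ p) (hq : 1 ≤ q) :
    OpSp.IsCompletelyPositive (OpSp.matCone n) (OpSp.matEllCone n (Fin n × Fin n))
      (OpSp.teleport n p q) ∧
    ∃ W : Matrix (Fin n) (Fin n) (Fin n × Fin n → ℂ) →ₗ[ℂ] Matrix (Fin n) (Fin n) ℂ,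
      -- complete positivity of the retraction `W` and of the projection `J W`
      OpSp.IsCompletelyPositive (OpSp.matEllCone n (Fin n × Fin n)) (OpSp.matCone n) W ∧
      OpSp.IsCompletelyPositive (OpSp.matEllCone n (Fin n × Fin n))
        (OpSp.matEllCone n (Fin n × Fin n)) (OpSp.teleport n p q ∘ₗ W) ∧
      -- the scalar case
      W ∘ₗ OpSp.teleport n p q = LinearMap.id ∧
      LinearMap.IsProj (LinearMap.range (OpSp.teleport n p q)) (OpSp.teleport n p q ∘ₗ W) ∧
      OpSp.IsCompleteIsometry (OpSp.schatten p n)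
        (OpSp.schattenV q n (OpSp.ell p (Fin n × Fin n))) (OpSp.teleport n p q) ∧
      OpSp.IsCompleteContraction (OpSp.schattenV q n (OpSp.ell p (Fin n × Fin n)))
        (OpSp.schatten p n) W ∧
      OpSp.IsCompleteContraction (OpSp.schattenV q n (OpSp.ell p (Fin n × Fin n)))
        (OpSp.schattenV q n (OpSp.ell p (Fin n × Fin n))) (OpSp.teleport n p q ∘ₗ W) ∧
      -- the vector valued case
      ∀ (E : Type*) [NormedAddCommGroup E] [NormedSpace ℂ E] [CompleteSpace E]
        (N : OpSp.MatNorms E), OpSp.IsOperatorSpace N →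
        OpSp.tensorIdIn W E ∘ₗ OpSp.tensorIdOut (OpSp.teleport n p q) E = LinearMap.id ∧
        LinearMap.IsProj (LinearMap.range (OpSp.tensorIdOut (OpSp.teleport n p q) E))
          (OpSp.tensorIdOut (OpSp.teleport n p q) E ∘ₗ OpSp.tensorIdIn W E) ∧
        OpSp.IsCompleteIsometry (OpSp.schattenV p n N)
          (OpSp.schattenV q n (OpSp.ellV p (Fin n × Fin n) N))
          (OpSp.tensorIdOut (OpSp.teleport n p q) E) ∧
        OpSp.IsCompleteContraction (OpSp.schattenV q n (OpSp.ellV p (Fin n × Fin n) N))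
          (OpSp.schattenV p n N) (OpSp.tensorIdIn W E) ∧
        OpSp.IsCompleteContraction (OpSp.schattenV q n (OpSp.ellV p (Fin n × Fin n) N))
          (OpSp.schattenV q n (OpSp.ellV p (Fin n × Fin n) N))
          (OpSp.tensorIdOut (OpSp.teleport n p q) E ∘ₗ OpSp.tensorIdIn W E) := by
  obtain ⟨hJ, W, hW, hJW, hWJ, hproj, hiso, hW_le, hJW_le, hE⟩ :=
    corollary1p2_general n hn p q hp hq
  exact ⟨hJ, W, hW, hJW, hWJ, hproj, hiso, hW_le, hJW_le, fun E _ _ _ N hN => hE E N hN⟩
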